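/- **Definitions.** A \emph{graphon} is a pair $\mathcal W=(W,(S,\mathcal S,\mu))$ where $(S,\mathcal S,\mu)$ is a $\sigma$-finite measure space with $\mu(S)>0$ and $W\colon S\times S\to\mathbb R$ is symmetric, measurable and $\mu\times\mu$-integrable. The cut norm is $\|W\|_{\square,\mu}=\sup_{U,V\in\mathcal S}\bigl|\int_{U\times V}W\,d\mu\,d\mu\bigr|$. For graphons over spaces of equal total mass, $\delta_\square(\mathcal W_1,\mathcal W_2)=\inf_\gamma\|W_1^{\pi_1}-W_2^{\pi_2}\|_{\square,\gamma}$, the infimum being over all couplings $\gamma$ of $\mu_1,\mu_2$ (measures on $S_1\times S_2$ with marginals $\mu_1,\mu_2$), where $W_i^{\pi_i}$ is the pullback of $W_i$ under the projection $\pi_i\colon S_1\times S_2\to S_i$; if the total masses differ, both graphons are first extended by $0$ to $\sigma$-finite spaces of equal mass. The \emph{stretched cut metric} is $\delta^s_\square(\mathcal W_1,\mathcal W_2)=\delta_\square(\widehat{\mathcal W}_1,\widehat{\mathcal W}_2)$, where $\widehat{\mathcal W}$ is $W$ over $(S,\mathcal S,\|W\|_1^{-1/2}\mu)$ (and the zero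 graphon over $(S,\mathcal S,\mu)$ if $\|W\|_1=0$). The \emph{rescaled cut metric} is, for graphons over spaces of equal total mass, $\delta^r_\square(\mathcal W_1,\mathcal W_2)=\inf_\gamma\bigl\|\|W_1\|_1^{-1}W_1^{\pi_1}-\|W_2\|_1^{-1}W_2^{\pi_2}\bigr\|_{\square,\gamma}$ over couplings $\gamma$ (the rescaled function being $0$ if $\|W_i\|_1=0$). Let $G$ be a finite simple graph with ordered vertices $v_1,\dots,v_k$ and edge density $\rho(G)=2|E(G)|/|V(G)|^2$. Its canonical graphon $W^G$ over $[0,1]$ (Lebesgue measure) equals $1$ on $I_i\times I_j$ if $v_iv_j\in E(G)$ and $0$ otherwise, where $I_1,\dots,I_k$ are consecutive intervals of length $1/k$; $W^{G,r}=\|W^G\|_1^{-1}W^G$. Let $\widetilde W^G$ over $\mathbb R_+$ be defined in the same way with the intervals $[i-1,i)$ (and $0$ outside), and let $W^{G,s}(x,y)=\widetilde W^G(\|\widetilde W^G\|_1^{1/2}x,\|\widetilde W^G\|_1^{1/2}y)$ over $\mathbb R_+$ be the stretched canonical graphon. For graphs, $\delta^s_\square$ is applied to $\widetilde W^G$ and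 $\delta^r_\square$ to $W^G$. A sequence $(G_n)$ of finite simple graphs is \emph{sparse} if $\rho(G_n)\to0$ and \emph{dense} if $\liminf_n\rho(G_n)>0$. It has \emph{uniformly regular tails} if for every $\varepsilon>0$ there is $M>0$ such that for every $n$ there is a measurable $U\subseteq\mathbb R_+$ of Lebesgue measure at most $M$ with $\|W^{G_n,s}-W^{G_n,s}\mathbf 1_{U\times U}\|_1<\varepsilon$. It is \emph{uniformly upper regular} if there are $K\colon(0,\infty)\to(0,\infty)$ and $\eta_n>0$ with $\eta_n\to0$ and $1/|V(G_n)|<\eta_n$ for all $n$, such that for all $\varepsilon>0$, all $n$, and all partitions $\mathcal P$ of $[0,1]$ induced by partitions of $V(G_n)$ all of whose parts have measure at least $\eta_n$, we have $\bigl\|(W^{G_n,r})_{\mathcal P}\mathbf 1_{|(W^{G_n,r})_{\mathcal P}|\ge K(\varepsilon)}\bigr\|_1\le\varepsilon$, where $W_{\mathcal P}$ is obtained from $W$ by averaging over the products of parts of $\mathcal P$. **Proposition.** (i) Let $(G_n)_{n\in\mathbb N}$ be a sparse sequence of finite simple graphs, each with at least one edge. Then $(G_n)$ is not both uniformly upper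 regular and with uniformly regular tails. Moreover, $(G_n)$ cannot converge for both metrics $\delta^s_\square$ and $\delta^r_\square$: it is not a Cauchy sequence for both, and there do not exist graphons $\mathcal W,\mathcal W'$ with $\delta^s_\square(G_n,\mathcal W)\to0$ and $\delta^r_\square(G_n,\mathcal W')\to0$. (ii) Let $(G_n)_{n\in\mathbb N}$ be a dense sequence of finite simple graphs such that $\rho(G_n)$ converges. Then $(G_n)$ is a Cauchy sequence for $\delta^s_\square$ if and only if it is a Cauchy sequence for $\delta^r_\square$. Without convergence of the edge density neither implication holds: there is a dense sequence of finite simple graphs, each with at least one edge, that is Cauchy for $\delta^r_\square$ but not for $\delta^s_\square$, and there is one that is Cauchy for $\delta^s_\square$ but not for $\delta^r_\square$. -/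

import Mathlib

open MeasureTheory Filter Topology
open scoped NNReal ENNReal

universe u v

noncomputable section

namespace SparseGraphon

/-! ### Graphons over σ-finite measure spaces -/

/-- A graphon: a symmetric, measurable, integrable function `W : S × S → ℝ` over a σ-finite
measure space `(S, μ)` with `μ S > 0`. -/
structure Graphon : Type (u + 1) where
  S : Type u
  [mS : MeasurableSpace S]
  μ : Measure S
  [sf : SigmaFinite μ]
  W : S × S → ℝ
  mass_pos : 0 < μ Set.univ
  symm : ∀ x y, W (x, y) = W (y, x)
  meas : Measurable W
  integrable : Integrable W (μ.prod μ)

attribute [instance] Graphon.mS Graphon.sf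

/-- The `L¹` norm of a graphon. -/
def Graphon.l1 (𝒲 : Graphon.{u}) : ℝ := ∫ z, |𝒲.W z| ∂(𝒲.μ.prod 𝒲.μ)

/-- The cut norm `sup_{U, V} |∫_{U × V} W|` over measurable sets `U, V`. -/
def cutNorm {S : Type u} [MeasurableSpace S] (μ : Measure S) (W : S × S → ℝ) : ℝ≥0∞ :=
  ⨆ (U : Set S) (V : Set S) (_ : MeasurableSet U) (_ : MeasurableSet V),
    ENNReal.ofReal |∫ z in U ×ˢ V, W z ∂(μ.prod μ)|

/-- `γ` is a coupling of `μ₁` and `μ₂`. -/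
def IsCoupling {S₁ : Type u} {S₂ : Type v} [MeasurableSpace S₁] [MeasurableSpace S₂]
    (μ₁ : Measure S₁) (μ₂ : Measure S₂) (γ : Measure (S₁ × S₂)) : Prop :=
  γ.map Prod.fst = μ₁ ∧ γ.map Prod.snd = μ₂

/-- The infimum over all couplings of the cut norm of `W₁^{π₁} - W₂^{π₂}`
(equal to `∞` if the total masses differ, since there is then no coupling). -/
def couplingDist (𝒲₁ : Graphon.{u}) (𝒲₂ : Graphon.{v}) : ℝ≥0∞ :=
  ⨅ (γ : Measure (𝒲₁.S × 𝒲₂.S)) (_ : IsCoupling 𝒲₁.μ 𝒲₂.μ γ),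
    cutNorm γ (fun z => 𝒲₁.W (z.1.1, z.2.1) - 𝒲₂.W (z.1.2, z.2.2))

/-- Lebesgue measure on the half line `ℝ₊ = [0, ∞)`. -/
def halfLine : Measure ℝ≥0 := (volume : Measure ℝ).comap ((↑) : ℝ≥0 → ℝ)

theorem measurableEmbedding_coe : MeasurableEmbedding ((↑) : ℝ≥0 → ℝ) :=
  MeasurableEmbedding.subtype_coe measurableSet_Ici

theorem halfLine_apply (s : Set ℝ≥0) :
    halfLine s = volume (((↑) : ℝ≥0 → ℝ) '' s) :=
  measurableEmbedding_coe.comap_apply _ _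

instance : SigmaFinite halfLine := by
  refine SigmaFinite.of_map (f := ((↑) : ℝ≥0 → ℝ)) _ measurableEmbedding_coe.measurable.aemeasurable ?_
  rw [halfLine, measurableEmbedding_coe.map_comap]
  infer_instance

theorem halfLine_univ : halfLine Set.univ = ⊤ := by
  rw [halfLine_apply, Set.image_univ, show Set.range ((↑) : ℝ≥0 → ℝ) = Set.Ici 0 from
    Subtype.range_coe]
  simp

/-- The measure `μ ⊔ λ` on the disjoint union of `S` and `ℝ₊`. -/
def extMeasure {S : Type u} [MeasurableSpace S] (μ : Measure S) : Measure (S ⊕ ℝ≥0) :=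
  μ.map Sum.inl + halfLine.map Sum.inr

theorem embInl {S : Type u} [MeasurableSpace S] :
    MeasurableEmbedding (Sum.inl : S → S ⊕ ℝ≥0) :=
  ⟨Sum.inl_injective, measurable_inl, fun _ hs => measurableSet_inl_image.2 hs⟩

theorem embInr {S : Type u} [MeasurableSpace S] :
    MeasurableEmbedding (Sum.inr : ℝ≥0 → S ⊕ ℝ≥0) :=
  ⟨Sum.inr_injective, measurable_inr, fun _ hs => measurableSet_inr_image.2 hs⟩

instance {S : Type u} [MeasurableSpace S] (μ : Measure S) [SigmaFinite μ] :
    SigmaFinite (extMeasure μ) := by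
  have h1 : SigmaFinite (μ.map (Sum.inl : S → S ⊕ ℝ≥0)) := embInl.sigmaFinite_map
  have h2 : SigmaFinite (halfLine.map (Sum.inr : ℝ≥0 → S ⊕ ℝ≥0)) := embInr.sigmaFinite_map
  unfold extMeasure
  infer_instance

theorem extMeasure_univ {S : Type u} [MeasurableSpace S] (μ : Measure S) :
    extMeasure μ Set.univ = ⊤ := by
  simp [extMeasure, Measure.map_apply measurable_inr MeasurableSet.univ, halfLine_univ]

theorem extMeasure_restrict {S : Type u} [MeasurableSpace S] (μ : Measure S) :
    (extMeasure μ).restrict (Set.range Sum.inl) = μ.map Sum.inl := by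
  rw [extMeasure, Measure.restrict_add, embInl.restrict_map, embInr.restrict_map]
  simp

/-- The trivial extension of a graphon over `S` to the space of infinite mass `S ⊔ ℝ₊`:
equal to `W` on `S × S` and to `0` elsewhere. -/
def Graphon.extend (𝒲 : Graphon.{u}) : Graphon.{u} where
  S := 𝒲.S ⊕ ℝ≥0
  μ := extMeasure 𝒲.μ
  W := Function.extend (Prod.map Sum.inl Sum.inl) 𝒲.W 0
  mass_pos := by rw [extMeasure_univ]; exact ENNReal.zero_lt_top
  symm := by
    have hinj : Function.Injective
        (Prod.map Sum.inl Sum.inl : 𝒲.S × 𝒲.S → (𝒲.S ⊕ ℝ≥0) × (𝒲.S ⊕ ℝ≥0)) :=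
      Sum.inl_injective.prodMap Sum.inl_injective
    rintro (x | x) (y | y)
    · have h1 := hinj.extend_apply 𝒲.W 0 (x, y)
      have h2 := hinj.extend_apply 𝒲.W 0 (y, x)
      simp only [Prod.map_apply] at h1 h2
      rw [h1, h2, 𝒲.symm]
    all_goals
      rw [Function.extend_apply' _ _ _ (by rintro ⟨⟨a, b⟩, h⟩; simp at h),
        Function.extend_apply' _ _ _ (by rintro ⟨⟨a, b⟩, h⟩; simp at h)]
      rfl
  meas := (embInl.prodMap embInl).measurable_extend 𝒲.meas measurable_const
  integrable := by
    have hemb := (embInl (S := 𝒲.S)).prodMap (embInl (S := 𝒲.S))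
    rw [← integrableOn_iff_integrable_of_support_subset
      (s := Set.range Sum.inl ×ˢ Set.range Sum.inl)]
    · rw [IntegrableOn, ← Measure.prod_restrict, extMeasure_restrict,
        Measure.map_prod_map _ _ measurable_inl measurable_inl, hemb.integrable_map_iff]
      have hcomp : Function.extend (Prod.map Sum.inl Sum.inl) 𝒲.W 0 ∘
          (Prod.map Sum.inl Sum.inl : 𝒲.S × 𝒲.S → (𝒲.S ⊕ ℝ≥0) × (𝒲.S ⊕ ℝ≥0)) = 𝒲.W :=
        funext fun z => hemb.injective.extend_apply 𝒲.W 0 z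
      rw [hcomp]
      exact 𝒲.integrable
    · intro z hz
      by_contra hcon
      apply hz
      rw [Function.extend_apply']
      · rfl
      · rintro ⟨⟨a, b⟩, rfl⟩
        exact hcon ⟨⟨a, rfl⟩, ⟨b, rfl⟩⟩

open Classical in
/-- The cut metric `δ_□`. For graphons over spaces of the same total mass it is `couplingDist`; if
the total masses differ, the graphons are first trivially extended to spaces of equal (here
infinite) mass. -/
def cutDist (𝒲₁ : Graphon.{u}) (𝒲₂ : Graphon.{v}) : ℝ≥0∞ :=
  if 𝒲₁.μ Set.univ = 𝒲₂.μ Set.univ then couplingDist 𝒲₁ 𝒲₂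
  else couplingDist 𝒲₁.extend 𝒲₂.extend

open Classical in
/-- The measure-rescaled graphon `(W, ‖W‖₁^{-1/2} μ)`, or `(0, μ)` if `‖W‖₁ = 0`. -/
def Graphon.stretch (𝒲 : Graphon.{u}) : Graphon.{u} :=
  if h : 𝒲.l1 = 0 then
    { S := 𝒲.S
      μ := 𝒲.μ
      W := 0
      mass_pos := 𝒲.mass_pos
      symm := fun _ _ => rfl
      meas := measurable_const
      integrable := integrable_zero _ _ _ }
  else
    { S := 𝒲.S
      μ := (Real.toNNReal (√𝒲.l1)⁻¹) • 𝒲.μ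
      W := 𝒲.W
      mass_pos := by
        have h0 : 0 < 𝒲.l1 :=
          lt_of_le_of_ne (integral_nonneg fun _ => abs_nonneg _) (Ne.symm h)
        have h1 : 0 < Real.toNNReal (√𝒲.l1)⁻¹ := by
          rw [Real.toNNReal_pos]; positivity
        rw [Measure.smul_apply, ENNReal.smul_def, smul_eq_mul]
        exact ENNReal.mul_pos (by exact_mod_cast h1.ne') 𝒲.mass_pos.ne'
      symm := 𝒲.symm
      meas := 𝒲.meas
      integrable := by
        rw [Measure.prod_smul_left, Measure.prod_smul_right, smul_smul]
        exact 𝒲.integrable.smul_measure_nnreal }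

/-- The stretched cut metric `δ_□^s`. -/
def stretchedCutDist (𝒲₁ : Graphon.{u}) (𝒲₂ : Graphon.{v}) : ℝ≥0∞ :=
  cutDist 𝒲₁.stretch 𝒲₂.stretch

/-- The value-rescaled graphon `‖W‖₁⁻¹ W` (equal to `0` if `‖W‖₁ = 0`). -/
def Graphon.rescale (𝒲 : Graphon.{u}) : Graphon.{u} where
  S := 𝒲.S
  μ := 𝒲.μ
  W := fun z => 𝒲.l1⁻¹ * 𝒲.W z
  mass_pos := 𝒲.mass_pos
  symm := fun x y => by rw [𝒲.symm]
  meas := 𝒲.meas.const_mul _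
  integrable := 𝒲.integrable.const_mul _

/-- The rescaled cut metric `δ_□^r` for graphons over spaces of the same total mass
(it is `∞` if the total masses differ). -/
def rescaledCutDist (𝒲₁ : Graphon.{u}) (𝒲₂ : Graphon.{v}) : ℝ≥0∞ :=
  couplingDist 𝒲₁.rescale 𝒲₂.rescale

/-- A set of graphons is uniformly bounded and has uniformly regular tails. -/
def HasUniformlyRegularTails (𝒜 : Set Graphon.{u}) : Prop :=
  (∃ B : ℝ, ∀ 𝒲 ∈ 𝒜, ∀ z, |𝒲.W z| ≤ B) ∧
  ∀ ε : ℝ, 0 < ε → ∃ M : ℝ≥0, 0 < M ∧ ∀ 𝒲 ∈ 𝒜, ∃ U : Set 𝒲.S, MeasurableSet U ∧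
    ∫ z, |𝒲.W z - (U ×ˢ U).indicator 𝒲.W z| ∂(𝒲.μ.prod 𝒲.μ) < ε ∧ 𝒲.μ U ≤ M

/-- The average `W_P` of `W` over the blocks of a finite partition `P`: on `P a × P b` it equals
`(μ (P a) μ (P b))⁻¹ ∫_{P a × P b} W`. -/
def blockAverage {S : Type u} [MeasurableSpace S] (μ : Measure S) (W : S × S → ℝ)
    {m : ℕ} (P : Fin m → Set S) (z : S × S) : ℝ :=
  ∑ a, ∑ b, (P a ×ˢ P b).indicator
    (fun _ => (μ.real (P a) * μ.real (P b))⁻¹ * ∫ w in P a ×ˢ P b, W w ∂(μ.prod μ)) z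

/-- The `L¹` norm of `V 1_{|V| ≥ K}`. -/
def largePartNorm {S : Type u} [MeasurableSpace S] (μ : Measure S) (V : S × S → ℝ) (K : ℝ) : ℝ :=
  ∫ z, |{w | K ≤ |V w|}.indicator V z| ∂(μ.prod μ)

/-! ### Finite simple graphs and their graphons -/

/-- A finite simple graph whose vertices are ordered as `0, …, k - 1`. -/
abbrev FinGraph := Σ k : ℕ, SimpleGraph (Fin k)

/-- The number of vertices. -/
abbrev FinGraph.card (G : FinGraph) : ℕ := G.1

/-- The graph underlying an ordered finite graph. -/
abbrev FinGraph.graph (G : FinGraph) : SimpleGraph (Fin G.card) := G.2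

/-- The edge density `2|E| / |V|²`. -/
def FinGraph.density (G : FinGraph) : ℝ := 2 * (G.graph.edgeSet.ncard : ℝ) / (G.card : ℝ) ^ 2

open Classical in
/-- The step function equal to `1` on `I i × I j` for adjacent `i, j` and to `0` elsewhere, where
`I` is a family of disjoint sets indexed by the vertices. -/
def stepFun (G : FinGraph) {S : Type u} (I : Fin G.card → Set S) (z : S × S) : ℝ :=
  ∑ i, ∑ j, if G.graph.Adj i j then (I i ×ˢ I j).indicator (fun _ => (1 : ℝ)) z else 0

theorem stepFun_symm (G : FinGraph) {S : Type u} (I : Fin G.card → Set S) (x y : S) :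
    stepFun G I (x, y) = stepFun G I (y, x) := by
  unfold stepFun
  rw [Finset.sum_comm]
  refine Finset.sum_congr rfl fun i _ => Finset.sum_congr rfl fun j _ => ?_
  have h : (x, y) ∈ I j ×ˢ I i ↔ (y, x) ∈ I i ×ˢ I j := and_comm
  by_cases h1 : G.graph.Adj i j <;> by_cases h2 : (y, x) ∈ I i ×ˢ I j <;>
    simp only [Set.indicator, h, h1, h2, G.graph.adj_comm j i, if_true, if_false]

theorem stepFun_meas (G : FinGraph) {S : Type u} [MeasurableSpace S] (I : Fin G.card → Set S)
    (hI : ∀ i, MeasurableSet (I i)) : Measurable (stepFun G I) := by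
  unfold stepFun
  refine Finset.measurable_sum _ fun i _ => Finset.measurable_sum _ fun j _ => ?_
  split_ifs
  · exact measurable_const.indicator ((hI i).prod (hI j))
  · exact measurable_const

theorem stepFun_integrable (G : FinGraph) {S : Type u} [MeasurableSpace S] (μ : Measure S)
    [SigmaFinite μ] (I : Fin G.card → Set S) (hI : ∀ i, MeasurableSet (I i))
    (hfin : ∀ i, μ (I i) ≠ ⊤) : Integrable (stepFun G I) (μ.prod μ) := by
  unfold stepFun
  refine integrable_finsetSum _ fun i _ => integrable_finsetSum _ fun j _ => ?_
  split_ifs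
  · refine (integrable_indicator_iff ((hI i).prod (hI j))).2 (integrableOn_const ?_)
    rw [Measure.prod_prod]
    exact ENNReal.mul_ne_top (hfin i) (hfin j)
  · exact integrable_zero _ _ _

/-- The interval of `[0, 1]` of length `1 / k` that represents the vertex `i`: the first one is
closed, the others are open on the left and closed on the right. -/
def unitCell {k : ℕ} (i : Fin k) : Set unitInterval :=
  {x | ((i : ℕ) = 0 ∨ ((i : ℕ) : ℝ) / k < x) ∧ (x : ℝ) ≤ ((i : ℕ) + 1 : ℝ) / k}

theorem unitCell_meas {k : ℕ} (i : Fin k) : MeasurableSet (unitCell i) := by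
  unfold unitCell
  refine MeasurableSet.inter (MeasurableSet.union (MeasurableSet.const _) ?_) ?_
  · exact measurableSet_lt measurable_const measurable_subtype_coe
  · exact measurableSet_le measurable_subtype_coe measurable_const

/-- The canonical graphon `𝒲^G` over `[0, 1]`. -/
def FinGraph.canonical (G : FinGraph) : Graphon.{0} where
  S := unitInterval
  μ := volume
  W := stepFun G unitCell
  mass_pos := by simp
  symm := stepFun_symm G _
  meas := stepFun_meas G _ unitCell_meas
  integrable := stepFun_integrable G _ _ unitCell_meas fun _ => measure_ne_top _ _

/-- The rescaled canonical graphon `𝒲^{G,r} = ‖W^G‖₁⁻¹ W^G` over `[0, 1]`. -/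
def FinGraph.rescaledCanonical (G : FinGraph) : Graphon.{0} := G.canonical.rescale

/-- The interval `[i, i + 1)` of `ℝ₊` that represents the vertex `i` (with vertex weight `1`). -/
def halfLineCell {k : ℕ} (i : Fin k) : Set ℝ≥0 := Set.Ico (i : ℕ) ((i : ℕ) + 1)

theorem halfLine_Ico_ne_top (a b : ℝ≥0) : halfLine (Set.Ico a b) ≠ ⊤ := by
  rw [halfLine_apply]
  refine ne_top_of_le_ne_top (b := volume (Set.Icc (a : ℝ) b)) (by simp) (measure_mono ?_)
  rintro _ ⟨x, hx, rfl⟩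
  exact ⟨by exact_mod_cast hx.1, by exact_mod_cast hx.2.le⟩

/-- The graphon `𝒲̃^G` over `ℝ₊` in which each vertex is an interval of length `1`. -/
def FinGraph.halfLineGraphon (G : FinGraph) : Graphon.{0} where
  S := ℝ≥0
  μ := halfLine
  W := stepFun G halfLineCell
  mass_pos := by rw [halfLine_univ]; exact ENNReal.zero_lt_top
  symm := stepFun_symm G _
  meas := stepFun_meas G _ fun _ => measurableSet_Ico
  integrable := stepFun_integrable G _ _ (fun _ => measurableSet_Ico)
    fun _ => halfLine_Ico_ne_top _ _

/-- The scaling factor `‖W̃^G‖₁^{1/2}`. -/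
def FinGraph.scale (G : FinGraph) : ℝ≥0 := NNReal.sqrt G.halfLineGraphon.l1.toNNReal

/-- The stretched canonical graphon `𝒲^{G,s}` over `ℝ₊`,
`W^{G,s}(x, y) = W̃^G(‖W̃^G‖₁^{1/2} x, ‖W̃^G‖₁^{1/2} y)`. -/
def FinGraph.stretchedCanonical (G : FinGraph) : Graphon.{0} where
  S := ℝ≥0
  μ := halfLine
  W := fun z => stepFun G halfLineCell (G.scale * z.1, G.scale * z.2)
  mass_pos := by rw [halfLine_univ]; exact ENNReal.zero_lt_top
  symm := fun x y => stepFun_symm G _ _ _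
  meas := (stepFun_meas G _ fun _ => measurableSet_Ico).comp (by fun_prop)
  integrable := by
    by_cases h : G.scale = 0
    · have h0 : stepFun G halfLineCell ((0 : ℝ≥0), (0 : ℝ≥0)) = 0 := by
        unfold stepFun
        refine Finset.sum_eq_zero fun i _ => Finset.sum_eq_zero fun j _ => ?_
        split_ifs with hadj
        · refine Set.indicator_of_notMem ?_ _
          rintro ⟨h1, h2⟩
          have hi : (i : ℕ) = 0 := by
            have h3 : ((i : ℕ) : ℝ≥0) ≤ 0 := h1.1
            exact_mod_cast nonpos_iff_eq_zero.1 h3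
          have hj : (j : ℕ) = 0 := by
            have h3 : ((j : ℕ) : ℝ≥0) ≤ 0 := h2.1
            exact_mod_cast nonpos_iff_eq_zero.1 h3
          exact hadj.ne (Fin.ext (hi.trans hj.symm))
        · rfl
      simp [h, h0]
    · refine stepFun_integrable G halfLine
        (fun i => (fun x => G.scale * x) ⁻¹' halfLineCell i)
        (fun i => (by fun_prop : Measurable fun x : ℝ≥0 => G.scale * x) measurableSet_Ico) ?_
      intro i
      refine ne_top_of_le_ne_top (halfLine_Ico_ne_top 0 (((i : ℕ) + 1) / G.scale))
        (measure_mono fun x hx => ⟨zero_le, ?_⟩)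
      rw [lt_div_iff₀ (pos_iff_ne_zero.2 h), mul_comm]
      exact hx.2

/-- The part of `[0, 1]` formed by the vertices of colour `a`. -/
def vertexBlock {k m : ℕ} (c : Fin k → Fin m) (a : Fin m) : Set unitInterval :=
  ⋃ i ∈ {i | c i = a}, unitCell i

/-! ### Properties of sequences of graphs -/

/-- The edge density tends to `0`. -/
def Sparse (G : ℕ → FinGraph) : Prop := Tendsto (fun n => (G n).density) atTop (𝓝 0)

/-- The lower limit of the edge density is positive. -/
def Dense (G : ℕ → FinGraph) : Prop := 0 < liminf (fun n => (G n).density) atTop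

/-- The edge density converges. -/
def HasConvergentDensity (G : ℕ → FinGraph) : Prop :=
  ∃ ρ : ℝ, Tendsto (fun n => (G n).density) atTop (𝓝 ρ)

/-- The set of stretched canonical graphons has uniformly regular tails. -/
def UniformlyRegularTails (G : ℕ → FinGraph) : Prop :=
  HasUniformlyRegularTails (Set.range fun n => (G n).stretchedCanonical)

/-- Uniform upper regularity of a sequence of graphs, in terms of the rescaled canonical graphons
`W^{G,r} = ‖W^G‖₁⁻¹ W^G`. Partitions of the vertex set into (at most) `m` parts are given by
colourings `c` with `m` colours; each part has positive measure because `η n > 0`. -/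
def UniformlyUpperRegular (G : ℕ → FinGraph) : Prop :=
  ∃ (K : ℝ → ℝ) (η : ℕ → ℝ), (∀ ε, 0 < ε → 0 < K ε) ∧ (∀ n, 0 < η n) ∧
    Tendsto η atTop (𝓝 0) ∧
    (∀ n, 1 / ((G n).card : ℝ) < η n) ∧
    ∀ ε : ℝ, 0 < ε → ∀ (n m : ℕ) (c : Fin (G n).card → Fin m),
      (∀ a, η n ≤ (volume : Measure unitInterval).real (vertexBlock c a)) →
      largePartNorm (S := unitInterval) volume
        (blockAverage (S := unitInterval) volume (G n).rescaledCanonical.W (vertexBlock c)) (K ε) ≤ ε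

/-- The Cauchy property of a sequence for a distance, `d m n` being the distance between the terms
of index `m` and `n`. -/
def IsCauchy (d : ℕ → ℕ → ℝ≥0∞) : Prop :=
  ∀ ε : ℝ≥0∞, 0 < ε → ∃ N, ∀ m ≥ N, ∀ n ≥ N, d m n < ε

/-- `(G n)` is a Cauchy sequence for `δ_□^s`. -/
def CauchyStretched (G : ℕ → FinGraph) : Prop :=
  IsCauchy fun m n => stretchedCutDist (G m).halfLineGraphon (G n).halfLineGraphon

/-- `(G n)` is a Cauchy sequence for `δ_□^r`. -/
def CauchyRescaled (G : ℕ → FinGraph) : Prop :=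
  IsCauchy fun m n => rescaledCutDist (G m).canonical (G n).canonical

/-- `(G n)` converges to the graphon `𝒲` for `δ_□^s`. -/
def TendstoStretched (G : ℕ → FinGraph) (𝒲 : Graphon.{u}) : Prop :=
  Tendsto (fun n => stretchedCutDist (G n).halfLineGraphon 𝒲) atTop (𝓝 0)

/-- `(G n)` converges to the graphon `𝒲` for `δ_□^r`. -/
def TendstoRescaled (G : ℕ → FinGraph) (𝒲 : Graphon.{u}) : Prop :=
  Tendsto (fun n => rescaledCutDist (G n).canonical 𝒲) atTop (𝓝 0)

end SparseGraphon

end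

/-! Everything rests on one reduction. The graphons of a finite graph are step functions, so a
coupling of two of them matters only through the matrix `τ` of masses that it gives to pairs of
cells, and the cut norm of the difference is governed by a bilinear form on the box `[0, τ]`. In one
direction, a coupling yields a matrix, because a bilinear form on a box is extremal at vertices and
these correspond to unions of cells. In the other direction, a matrix with the right marginals lifts
to a coupling by spreading its mass over products of cells. The extra index `none` stands for the
region where the graphon vanishes.

Dense sequences. A vertex has weight `1/k` in the canonical graphon and `ρ^(-1/2)/k` in the
stretched one, so at equal densities a matrix for one metric can be rescaled and adapted for the
other. When the densities differ, surplus mass is sent to the zero region, or missing mass is added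
by a product coupling. Both repairs cost a constant times `|1/ρ - 1/ρ'|`, and inverse densities form
a Cauchy sequence when the density has a positive limit
(`stretchedCutDist_le_of_rescaledCutDist_lt`, `rescaledCutDist_le_of_stretchedCutDist_lt`).

Counterexamples. Complete graphs and quasirandom graphs of density near `1/2` look alike after the
values are rescaled, but not after the measure is stretched. Adding isolated vertices to a clique
leaves the half-line graphon unchanged, but concentrates the rescaled graphon on a smaller square.
Alternating the two kinds destroys one Cauchy property and keeps the other. The graphs of density
about `1/2` come from Sylvester matrices, whose orthogonal columns force a small cut norm.

Sparse sequences. Closeness to one fixed graphon in the stretched metric, or uniformly regular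
tails, places half of the edges inside a set of at most `M * √(2|E|)` vertices. Its proportion of
the vertices is at most `M * √ρ`, which tends to `0`. Closeness to one fixed graphon in the rescaled
metric forbids this by uniform integrability: a vanishing proportion of the vertices cannot carry
half of the rescaled mass. Upper regularity forbids it too, through a two-part partition. A late
term of a Cauchy sequence can serve as the fixed graphon, so the Cauchy and limit statements share
one proof, `not_stretched_and_rescaled_close`. -/

noncomputable section

namespace SparseGraphon

set_option linter.unusedSectionVars false

/-! ### Bilinear forms on finite index sets -/

section Bilinear

variable {α : Type*} {β : Type*} [Fintype α] [Fintype β]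

/-- The bilinear form `∑ i j, x i * y j * f i j`. -/
def bil (f : α → α → ℝ) (x y : α → ℝ) : ℝ := ∑ i, ∑ j, x i * y j * f i j

theorem bil_add_left (f : α → α → ℝ) (x x' y : α → ℝ) :
    bil f (fun i => x i + x' i) y = bil f x y + bil f x' y := by
  simp only [bil, add_mul, Finset.sum_add_distrib]

theorem bil_add_right (f : α → α → ℝ) (x y y' : α → ℝ) :
    bil f x (fun i => y i + y' i) = bil f x y + bil f x y' := by
  simp only [bil, add_mul, mul_add, Finset.sum_add_distrib]

theorem bil_smul_left (f : α → α → ℝ) (c : ℝ) (x y : α → ℝ) :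
    bil f (fun i => c * x i) y = c * bil f x y := by
  simp only [bil, Finset.mul_sum, mul_assoc]

theorem bil_smul_right (f : α → α → ℝ) (c : ℝ) (x y : α → ℝ) :
    bil f x (fun i => c * y i) = c * bil f x y := by
  simp only [bil, Finset.mul_sum]
  exact Finset.sum_congr rfl fun i _ => Finset.sum_congr rfl fun j _ => by ring

theorem bil_add_fun (f g : α → α → ℝ) (x y : α → ℝ) :
    bil (fun i j => f i j + g i j) x y = bil f x y + bil g x y := by
  simp only [bil, mul_add, Finset.sum_add_distrib]

theorem bil_smul_fun (f : α → α → ℝ) (c : ℝ) (x y : α → ℝ) :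
    bil (fun i j => c * f i j) x y = c * bil f x y := by
  simp only [bil, Finset.mul_sum]
  exact Finset.sum_congr rfl fun i _ => Finset.sum_congr rfl fun j _ => by ring

theorem bil_const (c : ℝ) (x y : α → ℝ) :
    bil (fun _ _ => c) x y = c * ((∑ i, x i) * ∑ j, y j) := by
  rw [Finset.sum_mul_sum]
  simp only [bil, Finset.mul_sum]
  exact Finset.sum_congr rfl fun i _ => Finset.sum_congr rfl fun j _ => by ring

theorem abs_bil_le (f : α → α → ℝ) (hf : ∀ i j, |f i j| ≤ 1) (x y : α → ℝ)
    (hx : ∀ i, 0 ≤ x i) (hy : ∀ i, 0 ≤ y i) : |bil f x y| ≤ (∑ i, x i) * ∑ j, y j := by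
  rw [Finset.sum_mul_sum]
  refine (Finset.abs_sum_le_sum_abs _ _).trans (Finset.sum_le_sum fun i _ => ?_)
  refine (Finset.abs_sum_le_sum_abs _ _).trans (Finset.sum_le_sum fun j _ => ?_)
  rw [abs_mul, abs_of_nonneg (mul_nonneg (hx i) (hy j))]
  exact mul_le_of_le_one_right (mul_nonneg (hx i) (hy j)) (hf i j)

/-- The bilinear form of `f` is at most `ε` in absolute value on vectors between `0` and `τ`. -/
def BoxBound (f : α → α → ℝ) (τ : α → ℝ) (ε : ℝ) : Prop :=
  ∀ u v : α → ℝ, (∀ i, 0 ≤ u i) → (∀ i, u i ≤ τ i) → (∀ i, 0 ≤ v i) → (∀ i, v i ≤ τ i) →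
    |bil f u v| ≤ ε

/-- A linear functional on the box is largest when each coordinate with a positive coefficient is
full and the others are zero, and smallest in the opposite case. -/
theorem abs_sum_mul_le_of_indicator (g τ u : α → ℝ) (ε : ℝ) (hu : ∀ i, 0 ≤ u i)
    (huτ : ∀ i, u i ≤ τ i) (h : ∀ S : Set α, |∑ i, S.indicator τ i * g i| ≤ ε) :
    |∑ i, u i * g i| ≤ ε := by
  classical
  rw [abs_le]
  constructor
  · refine (abs_le.1 (h {i | g i < 0})).1.trans (Finset.sum_le_sum fun i _ => ?_)
    by_cases hi : g i < 0
    · rw [Set.indicator_of_mem (by exact hi)]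
      exact mul_le_mul_of_nonpos_right (huτ i) hi.le
    · rw [Set.indicator_of_notMem (by exact hi), zero_mul]
      exact mul_nonneg (hu i) (not_lt.1 hi)
  · refine le_trans (Finset.sum_le_sum fun i _ => ?_) (abs_le.1 (h {i | 0 < g i})).2
    by_cases hi : 0 < g i
    · rw [Set.indicator_of_mem (by exact hi)]
      exact mul_le_mul_of_nonneg_right (huτ i) hi.le
    · rw [Set.indicator_of_notMem (by exact hi), zero_mul]
      exact mul_nonpos_of_nonneg_of_nonpos (hu i) (not_lt.1 hi)

theorem bil_eq_sum_left (f : α → α → ℝ) (x y : α → ℝ) :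
    bil f x y = ∑ i, x i * ∑ j, y j * f i j := by
  simp only [bil, Finset.mul_sum, mul_assoc]

theorem bil_eq_sum_right (f : α → α → ℝ) (x y : α → ℝ) :
    bil f x y = ∑ j, y j * ∑ i, x i * f i j := by
  rw [bil, Finset.sum_comm]
  simp only [Finset.mul_sum]
  exact Finset.sum_congr rfl fun i _ => Finset.sum_congr rfl fun j _ => by ring

/-- A bilinear form on a box is extremal at the vertices of the box. -/
theorem boxBound_of_indicator (f : α → α → ℝ) (τ : α → ℝ) (ε : ℝ)
    (h : ∀ S T : Set α, |bil f (S.indicator τ) (T.indicator τ)| ≤ ε) : BoxBound f τ ε := by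
  intro u v hu huτ hv hvτ
  rw [bil_eq_sum_left]
  refine abs_sum_mul_le_of_indicator _ τ u ε hu huτ fun S => ?_
  rw [← bil_eq_sum_left, bil_eq_sum_right]
  refine abs_sum_mul_le_of_indicator _ τ v ε hv hvτ fun T => ?_
  rw [← bil_eq_sum_right]
  exact h S T

theorem BoxBound.mono {f : α → α → ℝ} {τ τ' : α → ℝ} {ε ε' : ℝ} (h : BoxBound f τ ε)
    (hτ : ∀ i, τ' i ≤ τ i) (hε : ε ≤ ε') : BoxBound f τ' ε' :=
  fun u v hu huτ hv hvτ =>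
    (h u v hu (fun i => (huτ i).trans (hτ i)) hv fun i => (hvτ i).trans (hτ i)).trans hε

theorem BoxBound.smul {f : α → α → ℝ} {τ : α → ℝ} {ε c : ℝ} (hc : 0 < c) (h : BoxBound f τ ε) :
    BoxBound f (fun i => c * τ i) (c ^ 2 * ε) := by
  intro u v hu huτ hv hvτ
  have key := h (fun i => c⁻¹ * u i) (fun i => c⁻¹ * v i)
    (fun i => mul_nonneg (inv_nonneg.2 hc.le) (hu i))
    (fun i => by rw [inv_mul_le_iff₀ hc]; exact huτ i)
    (fun i => mul_nonneg (inv_nonneg.2 hc.le) (hv i))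
    (fun i => by rw [inv_mul_le_iff₀ hc]; exact hvτ i)
  rw [bil_smul_left, bil_smul_right, ← mul_assoc, abs_mul,
    abs_of_pos (by positivity : 0 < c⁻¹ * c⁻¹)] at key
  calc |bil f u v| = c ^ 2 * (c⁻¹ * c⁻¹ * |bil f u v|) := by field_simp
    _ ≤ c ^ 2 * ε := by gcongr

/-- The difference of the pullbacks of `f` and `g` to the product. -/
def diffMat (f : α → α → ℝ) (g : β → β → ℝ) (e e' : α × β) : ℝ := f e.1 e'.1 - g e.2 e'.2

/-- Row sums. -/
def rows (u : α × β → ℝ) (i : α) : ℝ := ∑ j, u (i, j)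

/-- Column sums. -/
def cols (u : α × β → ℝ) (j : β) : ℝ := ∑ i, u (i, j)

theorem sum_rows (u : α × β → ℝ) : ∑ i, rows u i = ∑ e, u e := by
  rw [Fintype.sum_prod_type]; rfl

theorem sum_cols (u : α × β → ℝ) : ∑ j, cols u j = ∑ e, u e := by
  rw [Fintype.sum_prod_type_right]; rfl

theorem rows_nonneg {u : α × β → ℝ} (hu : ∀ e, 0 ≤ u e) (i : α) : 0 ≤ rows u i :=
  Finset.sum_nonneg fun _ _ => hu _

theorem cols_nonneg {u : α × β → ℝ} (hu : ∀ e, 0 ≤ u e) (j : β) : 0 ≤ cols u j :=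
  Finset.sum_nonneg fun _ _ => hu _

theorem rows_mono {u v : α × β → ℝ} (h : ∀ e, u e ≤ v e) (i : α) : rows u i ≤ rows v i :=
  Finset.sum_le_sum fun _ _ => h _

theorem cols_mono {u v : α × β → ℝ} (h : ∀ e, u e ≤ v e) (j : β) : cols u j ≤ cols v j :=
  Finset.sum_le_sum fun _ _ => h _

theorem rows_add (u v : α × β → ℝ) (i : α) :
    rows (fun e => u e + v e) i = rows u i + rows v i := Finset.sum_add_distrib

theorem cols_add (u v : α × β → ℝ) (j : β) :
    cols (fun e => u e + v e) j = cols u j + cols v j := Finset.sum_add_distrib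

theorem bil_fst (f : α → α → ℝ) (u v : α × β → ℝ) :
    bil (fun e e' : α × β => f e.1 e'.1) u v = bil f (rows u) (rows v) := by
  simp only [bil, rows, Fintype.sum_prod_type, Finset.sum_mul, Finset.mul_sum]
  refine Finset.sum_congr rfl fun i _ => ?_
  rw [Finset.sum_comm]
  exact Finset.sum_congr rfl fun _ _ => Finset.sum_comm

theorem bil_snd (g : β → β → ℝ) (u v : α × β → ℝ) :
    bil (fun e e' : α × β => g e.2 e'.2) u v = bil g (cols u) (cols v) := by
  simp only [bil, cols, Fintype.sum_prod_type_right, Finset.sum_mul, Finset.mul_sum]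
  refine Finset.sum_congr rfl fun i _ => ?_
  rw [Finset.sum_comm]
  exact Finset.sum_congr rfl fun _ _ => Finset.sum_comm

/-- Each of the two kernels sees only one coordinate, so test vectors enter only through their
marginals. Hence mass may be moved freely between cells as long as the relevant row and column sums
are kept. -/
theorem bil_diffMat (f : α → α → ℝ) (g : β → β → ℝ) (u v : α × β → ℝ) :
    bil (diffMat f g) u v = bil f (rows u) (rows v) - bil g (cols u) (cols v) := by
  rw [← bil_fst f u v, ← bil_snd g u v]
  simp only [bil, diffMat, mul_sub, Finset.sum_sub_distrib]

end Bilinear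

/-! ### Integrals and cut norms of step functions -/

section Index

variable {Ω : Type*} [MeasurableSpace Ω] {α : Type*} [Fintype α]

theorem comp_index_eq_sum (p : Ω → α) (f : α → α → ℝ) (z : Ω × Ω) :
    f (p z.1) (p z.2) = ∑ e, ∑ e', ((p ⁻¹' {e}) ×ˢ (p ⁻¹' {e'})).indicator
      (fun _ => f e e') z := by
  classical
  rw [Finset.sum_eq_single (p z.1), Finset.sum_eq_single (p z.2)]
  · rw [Set.indicator_of_mem]; exact ⟨rfl, rfl⟩
  · intro e' _ he'
    refine Set.indicator_of_notMem (fun h => he' ?_) _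
    exact h.2.symm
  · simp
  · intro e _ he
    refine Finset.sum_eq_zero fun e' _ => Set.indicator_of_notMem (fun h => he ?_) _
    exact h.1.symm
  · simp

theorem integrable_cell (γ : Measure Ω) [SFinite γ] (p : Ω → α)
    (hp : ∀ e, MeasurableSet (p ⁻¹' {e})) (f : α → α → ℝ)
    (hf : ∀ e e', f e e' ≠ 0 → γ (p ⁻¹' {e}) ≠ ⊤ ∧ γ (p ⁻¹' {e'}) ≠ ⊤) (e e' : α) :
    Integrable (((p ⁻¹' {e}) ×ˢ (p ⁻¹' {e'})).indicator (fun _ => f e e')) (γ.prod γ) := by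
  by_cases h : f e e' = 0
  · simp [h]
  · refine (integrable_indicator_iff ((hp e).prod (hp e'))).2 (integrableOn_const ?_)
    rw [Measure.prod_prod]
    exact ENNReal.mul_ne_top (hf e e' h).1 (hf e e' h).2

theorem integrable_comp_index (γ : Measure Ω) [SFinite γ] (p : Ω → α)
    (hp : ∀ e, MeasurableSet (p ⁻¹' {e})) (f : α → α → ℝ)
    (hf : ∀ e e', f e e' ≠ 0 → γ (p ⁻¹' {e}) ≠ ⊤ ∧ γ (p ⁻¹' {e'}) ≠ ⊤) :
    Integrable (fun z : Ω × Ω => f (p z.1) (p z.2)) (γ.prod γ) := by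
  simp only [comp_index_eq_sum p f]
  exact integrable_finsetSum _ fun e _ => integrable_finsetSum _ fun e' _ =>
    integrable_cell γ p hp f hf e e'

theorem setIntegral_comp_index (γ : Measure Ω) [SFinite γ] (p : Ω → α)
    (hp : ∀ e, MeasurableSet (p ⁻¹' {e})) (f : α → α → ℝ)
    (hf : ∀ e e', f e e' ≠ 0 → γ (p ⁻¹' {e}) ≠ ⊤ ∧ γ (p ⁻¹' {e'}) ≠ ⊤)
    (U V : Set Ω) :
    ∫ z in U ×ˢ V, f (p z.1) (p z.2) ∂(γ.prod γ) =
      bil f (fun e => γ.real (U ∩ p ⁻¹' {e})) (fun e => γ.real (V ∩ p ⁻¹' {e})) := by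
  simp only [comp_index_eq_sum p f]
  rw [integral_finsetSum _ fun e _ => integrable_finsetSum _ fun e' _ =>
    (integrable_cell γ p hp f hf e e').integrableOn, bil]
  refine Finset.sum_congr rfl fun e _ => ?_
  rw [integral_finsetSum _ fun e' _ => (integrable_cell γ p hp f hf e e').integrableOn]
  refine Finset.sum_congr rfl fun e' _ => ?_
  rw [integral_indicator_const _ ((hp e).prod (hp e')),
    measureReal_restrict_apply ((hp e).prod (hp e')), Set.prod_inter_prod, measureReal_prod_prod,
    smul_eq_mul, Set.inter_comm, Set.inter_comm (p ⁻¹' {e'})]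

theorem le_cutNorm (γ : Measure Ω) (W : Ω × Ω → ℝ) {U V : Set Ω} (hU : MeasurableSet U)
    (hV : MeasurableSet V) :
    ENNReal.ofReal |∫ z in U ×ˢ V, W z ∂(γ.prod γ)| ≤ cutNorm γ W :=
  le_iSup₂_of_le U V (le_iSup₂_of_le hU hV le_rfl)

theorem abs_setIntegral_le_of_cutNorm {γ : Measure Ω} {W : Ω × Ω → ℝ} {ε : ℝ} (hε : 0 ≤ ε)
    (h : cutNorm γ W ≤ ENNReal.ofReal ε) {U V : Set Ω} (hU : MeasurableSet U)
    (hV : MeasurableSet V) : |∫ z in U ×ˢ V, W z ∂(γ.prod γ)| ≤ ε :=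
  (ENNReal.ofReal_le_ofReal_iff hε).1 ((le_cutNorm γ W hU hV).trans h)

/-- The cut norm tests unions of cells, which give exactly the vertices of the box; the remaining
vectors follow by extremality. -/
theorem boxBound_of_cutNorm (γ : Measure Ω) [SFinite γ] (p : Ω → α)
    (hp : ∀ e, MeasurableSet (p ⁻¹' {e})) (f : α → α → ℝ)
    (hf : ∀ e e', f e e' ≠ 0 → γ (p ⁻¹' {e}) ≠ ⊤ ∧ γ (p ⁻¹' {e'}) ≠ ⊤) {ε : ℝ} (hε : 0 ≤ ε)
    (h : cutNorm γ (fun z => f (p z.1) (p z.2)) ≤ ENNReal.ofReal ε) :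
    BoxBound f (fun e => γ.real (p ⁻¹' {e})) ε := by
  classical
  have hmeas : ∀ S : Set α, MeasurableSet (p ⁻¹' S) := fun S => by
    rw [← Set.biUnion_preimage_singleton]
    exact MeasurableSet.biUnion S.to_countable fun e _ => hp e
  have hind : ∀ S : Set α, (fun e => γ.real (p ⁻¹' S ∩ p ⁻¹' {e})) =
      S.indicator (fun e => γ.real (p ⁻¹' {e})) := fun S => by
    funext e
    by_cases he : e ∈ S
    · rw [Set.indicator_of_mem he, ← Set.preimage_inter,
        Set.inter_eq_self_of_subset_right (Set.singleton_subset_iff.2 he)]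
    · rw [Set.indicator_of_notMem he, ← Set.preimage_inter, Set.inter_singleton_eq_empty.2 he]
      simp
  refine boxBound_of_indicator _ _ _ fun S T => ?_
  have := abs_setIntegral_le_of_cutNorm hε h (hmeas S) (hmeas T)
  rwa [setIntegral_comp_index γ p hp f hf, hind, hind] at this

/-- An arbitrary test set meets the cells in masses that form a vector of the box. Cells on which
`f` vanishes are unconstrained and may even have infinite measure. -/
theorem cutNorm_le_of_boxBound (γ : Measure Ω) [SFinite γ] (p : Ω → α)
    (hp : ∀ e, MeasurableSet (p ⁻¹' {e})) (f : α → α → ℝ) (τ : α → ℝ) (hτ : ∀ e, 0 ≤ τ e)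
    (hf : ∀ e e', f e e' ≠ 0 →
      γ (p ⁻¹' {e}) ≤ ENNReal.ofReal (τ e) ∧ γ (p ⁻¹' {e'}) ≤ ENNReal.ofReal (τ e'))
    {ε : ℝ} (h : BoxBound f τ ε) :
    cutNorm γ (fun z => f (p z.1) (p z.2)) ≤ ENNReal.ofReal ε := by
  refine iSup₂_le fun U V => iSup₂_le fun _ _ => ENNReal.ofReal_le_ofReal ?_
  have hf' : ∀ e e', f e e' ≠ 0 → γ (p ⁻¹' {e}) ≠ ⊤ ∧ γ (p ⁻¹' {e'}) ≠ ⊤ := fun e e' h =>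
    ⟨ne_top_of_le_ne_top ENNReal.ofReal_ne_top (hf e e' h).1,
      ne_top_of_le_ne_top ENNReal.ofReal_ne_top (hf e e' h).2⟩
  have hle : ∀ (U : Set Ω) e, γ (p ⁻¹' {e}) ≤ ENNReal.ofReal (τ e) →
      γ.real (U ∩ p ⁻¹' {e}) ≤ τ e := fun U e he =>
    ENNReal.toReal_le_of_le_ofReal (hτ e) ((measure_mono Set.inter_subset_right).trans he)
  rw [setIntegral_comp_index γ p hp f hf']
  -- Clipping at `τ` changes only coordinates whose coefficients are all zero, and it puts the
  -- vectors inside the box.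
  have key : bil f (fun e => γ.real (U ∩ p ⁻¹' {e})) (fun e => γ.real (V ∩ p ⁻¹' {e})) =
      bil f (fun e => min (γ.real (U ∩ p ⁻¹' {e})) (τ e))
        (fun e => min (γ.real (V ∩ p ⁻¹' {e})) (τ e)) := by
    refine Finset.sum_congr rfl fun e _ => Finset.sum_congr rfl fun e' _ => ?_
    by_cases h0 : f e e' = 0
    · simp [h0]
    · dsimp only
      rw [min_eq_left (hle U e (hf e e' h0).1), min_eq_left (hle V e' (hf e e' h0).2)]
  rw [key]
  exact h _ _ (fun e => le_min measureReal_nonneg (hτ e)) (fun e => min_le_right _ _)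
    (fun e => le_min measureReal_nonneg (hτ e)) (fun e => min_le_right _ _)

end Index

/-! ### Graphons that are step functions -/

/-- The graphon `𝒲` is the step function `f ∘ (idx × idx)`, where the part of index `none` carries
the value `0` and all the other parts have measure `w`. -/
structure IsModel (𝒲 : Graphon.{u}) {α : Type*} (f : Option α → Option α → ℝ)
    (idx : 𝒲.S → Option α) (w : ℝ) : Prop where
  measurableSet_cell : ∀ e, MeasurableSet (idx ⁻¹' {e})
  W_eq : ∀ z, 𝒲.W z = f (idx z.1) (idx z.2)
  none_left : ∀ e, f none e = 0
  none_right : ∀ e, f e none = 0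
  w_nonneg : 0 ≤ w
  measure_cell : ∀ i, 𝒲.μ (idx ⁻¹' {some i}) = ENNReal.ofReal w

section Model

variable {α β : Type*} [Fintype α] [Fintype β] {𝒲 : Graphon.{u}} {𝒲' : Graphon.{v}}
  {f : Option α → Option α → ℝ} {g : Option β → Option β → ℝ}
  {idx : 𝒲.S → Option α} {idx' : 𝒲'.S → Option β} {w w' : ℝ}

theorem IsModel.finite_cell (h : IsModel 𝒲 f idx w) (e e' : Option α) (he : f e e' ≠ 0) :
    𝒲.μ (idx ⁻¹' {e}) ≠ ⊤ ∧ 𝒲.μ (idx ⁻¹' {e'}) ≠ ⊤ := by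
  rcases e with _ | i
  · exact absurd (h.none_left e') he
  rcases e' with _ | j
  · exact absurd (h.none_right _) he
  rw [h.measure_cell, h.measure_cell]
  exact ⟨ENNReal.ofReal_ne_top, ENNReal.ofReal_ne_top⟩

theorem IsModel.l1_eq (h : IsModel 𝒲 f idx w) :
    𝒲.l1 = w ^ 2 * ∑ i, ∑ j, |f (some i) (some j)| := by
  have h1 := setIntegral_comp_index 𝒲.μ idx h.measurableSet_cell (fun e e' => |f e e'|)
    (fun e e' he => h.finite_cell e e' (by simpa using he)) Set.univ Set.univ
  rw [Set.univ_prod_univ, Measure.restrict_univ] at h1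
  have h2 : 𝒲.l1 = ∫ z, |f (idx z.1) (idx z.2)| ∂(𝒲.μ.prod 𝒲.μ) := by
    simp only [Graphon.l1, h.W_eq]
  rw [h2, h1]
  simp only [bil, Fintype.sum_option, h.none_left, h.none_right, abs_zero, mul_zero,
    Finset.sum_const_zero, zero_add, Set.univ_inter, Finset.mul_sum]
  refine Finset.sum_congr rfl fun i _ => Finset.sum_congr rfl fun j _ => ?_
  simp only [Measure.real, h.measure_cell, ENNReal.toReal_ofReal h.w_nonneg]
  ring

theorem IsCoupling.sigmaFinite {S₁ : Type u} {S₂ : Type v} [MeasurableSpace S₁]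
    [MeasurableSpace S₂] {μ₁ : Measure S₁} {μ₂ : Measure S₂} [SigmaFinite μ₁]
    {γ : Measure (S₁ × S₂)} (h : IsCoupling μ₁ μ₂ γ) : SigmaFinite γ :=
  SigmaFinite.of_map γ measurable_fst.aemeasurable (by rw [h.1]; infer_instance)

theorem IsCoupling.measure_fst {S₁ : Type u} {S₂ : Type v} [MeasurableSpace S₁]
    [MeasurableSpace S₂] {μ₁ : Measure S₁} {μ₂ : Measure S₂}
    {γ : Measure (S₁ × S₂)} (h : IsCoupling μ₁ μ₂ γ) {s : Set S₁} (hs : MeasurableSet s) :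
    γ (Prod.fst ⁻¹' s) = μ₁ s := by
  rw [← h.1, Measure.map_apply measurable_fst hs]

theorem IsCoupling.measure_snd {S₁ : Type u} {S₂ : Type v} [MeasurableSpace S₁]
    [MeasurableSpace S₂] {μ₁ : Measure S₁} {μ₂ : Measure S₂}
    {γ : Measure (S₁ × S₂)} (h : IsCoupling μ₁ μ₂ γ) {s : Set S₂} (hs : MeasurableSet s) :
    γ (Prod.snd ⁻¹' s) = μ₂ s := by
  rw [← h.2, Measure.map_apply measurable_snd hs]

theorem exists_coupling_of_couplingDist_lt {𝒲₁ : Graphon.{u}} {𝒲₂ : Graphon.{v}} {ε : ℝ}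
    (h : couplingDist 𝒲₁ 𝒲₂ < ENNReal.ofReal ε) :
    ∃ γ : Measure (𝒲₁.S × 𝒲₂.S), IsCoupling 𝒲₁.μ 𝒲₂.μ γ ∧
      cutNorm γ (fun z => 𝒲₁.W (z.1.1, z.2.1) - 𝒲₂.W (z.1.2, z.2.2)) ≤ ENNReal.ofReal ε := by
  obtain ⟨γ, hγ⟩ := iInf_lt_iff.1 h
  obtain ⟨hc, hγ⟩ := iInf_lt_iff.1 hγ
  exact ⟨γ, hc, hγ.le⟩

theorem cell_prod (idx : 𝒲.S → Option α) (idx' : 𝒲'.S → Option β) (e : Option α × Option β) :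
    Prod.map idx idx' ⁻¹' {e} = (idx ⁻¹' {e.1}) ×ˢ (idx' ⁻¹' {e.2}) := by
  ext z
  simp [Prod.ext_iff]

theorem diffMat_model_ne_zero (h : IsModel 𝒲 f idx w) (h' : IsModel 𝒲' g idx' w')
    {e e' : Option α × Option β} (he : diffMat f g e e' ≠ 0) :
    e ≠ (none, none) ∧ e' ≠ (none, none) := by
  constructor <;> rintro rfl <;> apply he
  · simp [diffMat, h.none_left, h'.none_left]
  · simp [diffMat, h.none_right, h'.none_right]

/-- Every other cell lies over a `some` cell of one of the factors and inherits its finite measure.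
Only the cell over both zero regions can be infinite, and there the difference kernel vanishes. -/
theorem coupling_cell_ne_top (h : IsModel 𝒲 f idx w) (h' : IsModel 𝒲' g idx' w')
    {γ : Measure (𝒲.S × 𝒲'.S)} (hγ : IsCoupling 𝒲.μ 𝒲'.μ γ)
    {e : Option α × Option β} (he : e ≠ (none, none)) : γ (Prod.map idx idx' ⁻¹' {e}) ≠ ⊤ := by
  rw [cell_prod]
  rcases e with ⟨_ | i, j⟩
  · rcases j with _ | j
    · exact absurd rfl he
    · refine ne_top_of_le_ne_top ?_
        (measure_mono (fun z hz => hz.2 : _ ⊆ Prod.snd ⁻¹' (idx' ⁻¹' {some j})))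
      rw [hγ.measure_snd (h'.measurableSet_cell _), h'.measure_cell]
      exact ENNReal.ofReal_ne_top
  · refine ne_top_of_le_ne_top ?_
      (measure_mono (fun z hz => hz.1 : _ ⊆ Prod.fst ⁻¹' (idx ⁻¹' {some i})))
    rw [hγ.measure_fst (h.measurableSet_cell _), h.measure_cell]
    exact ENNReal.ofReal_ne_top

/-- A matrix with the marginals of a coupling of two step functions. -/
structure IsTransport (τ : Option α × Option β → ℝ) (w w' : ℝ) : Prop where
  nonneg : ∀ e, 0 ≤ τ e
  none_none : τ (none, none) = 0
  rows_some : ∀ i, rows τ (some i) = w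
  cols_some : ∀ j, cols τ (some j) = w'

theorem sum_cells {Ω : Type*} [MeasurableSpace Ω] {ι : Type*} [Fintype ι] (γ : Measure Ω)
    (s : ι → Set Ω) (t : Set Ω) (ht : γ t ≠ ⊤) (hs : ∀ i, MeasurableSet (s i))
    (hd : Pairwise (Function.onFun Disjoint s)) (hu : ⋃ i, s i = t) :
    ∑ i, γ.real (s i) = γ.real t := by
  have hle : ∀ i, s i ⊆ t := fun i => hu ▸ Set.subset_iUnion s i
  rw [← hu, Measure.real, measure_iUnion hd hs, tsum_fintype, ENNReal.toReal_sum]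
  · rfl
  · exact fun i _ => ne_top_of_le_ne_top ht (measure_mono (hle i))

/-- A coupling of two step functions with small cut norm yields a matrix with small box norm. -/
theorem exists_transport_of_couplingDist_lt (h : IsModel 𝒲 f idx w) (h' : IsModel 𝒲' g idx' w')
    {ε : ℝ} (hε : 0 ≤ ε) (hd : couplingDist 𝒲 𝒲' < ENNReal.ofReal ε) :
    ∃ τ : Option α × Option β → ℝ, IsTransport τ w w' ∧ BoxBound (diffMat f g) τ ε := by
  classical
  obtain ⟨γ, hγ, hcut⟩ := exists_coupling_of_couplingDist_lt hd
  have := hγ.sigmaFinite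
  have hmeas : ∀ e, MeasurableSet (Prod.map idx idx' ⁻¹' {e}) := fun e => by
    rw [cell_prod]; exact (h.measurableSet_cell _).prod (h'.measurableSet_cell _)
  have hcut' : cutNorm γ (fun z => diffMat f g (Prod.map idx idx' z.1) (Prod.map idx idx' z.2)) ≤
      ENNReal.ofReal ε := by
    simpa only [diffMat, h.W_eq, h'.W_eq, Prod.map_fst, Prod.map_snd] using hcut
  have hbox := boxBound_of_cutNorm γ (Prod.map idx idx') hmeas (diffMat f g)
    (fun e e' he => ⟨coupling_cell_ne_top h h' hγ (diffMat_model_ne_zero h h' he).1,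
      coupling_cell_ne_top h h' hγ (diffMat_model_ne_zero h h' he).2⟩) hε hcut'
  -- The mass over both zero regions is discarded: it is invisible to the kernel and enters neither
  -- a `some` row nor a `some` column.
  refine ⟨fun e => if e = (none, none) then 0 else γ.real (Prod.map idx idx' ⁻¹' {e}),
    ⟨fun e => ?_, ?_, fun i => ?_, fun j => ?_⟩, hbox.mono (fun e => ?_) le_rfl⟩
  · split_ifs
    exacts [le_rfl, measureReal_nonneg]
  · simp
  · have hcell : γ (Prod.fst ⁻¹' (idx ⁻¹' {some i})) = ENNReal.ofReal w := by
      rw [hγ.measure_fst (h.measurableSet_cell _), h.measure_cell]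
    have := sum_cells γ (fun j => Prod.map idx idx' ⁻¹' {(some i, j)})
      (Prod.fst ⁻¹' (idx ⁻¹' {some i})) (by rw [hcell]; exact ENNReal.ofReal_ne_top)
      (fun j => hmeas _) (fun j j' hj => Disjoint.preimage _ (by simpa using hj)) (by
        ext z; simp [Prod.ext_iff])
    rw [Measure.real, hcell, ENNReal.toReal_ofReal h.w_nonneg] at this
    rw [← this]
    simp [rows]
  · have hcell : γ (Prod.snd ⁻¹' (idx' ⁻¹' {some j})) = ENNReal.ofReal w' := by
      rw [hγ.measure_snd (h'.measurableSet_cell _), h'.measure_cell]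
    have := sum_cells γ (fun i => Prod.map idx idx' ⁻¹' {(i, some j)})
      (Prod.snd ⁻¹' (idx' ⁻¹' {some j})) (by rw [hcell]; exact ENNReal.ofReal_ne_top)
      (fun j => hmeas _) (fun j j' hj => Disjoint.preimage _ (by simpa using hj)) (by
        ext z; simp [Prod.ext_iff])
    rw [Measure.real, hcell, ENNReal.toReal_ofReal h'.w_nonneg] at this
    rw [← this]
    simp [cols]
  · split_ifs
    exacts [measureReal_nonneg, le_rfl]

/-- The measure with masses `τ` on products of the given measures, plus a remainder `γ₀`. -/
def liftMeasure {S₁ S₂ : Type*} [MeasurableSpace S₁] [MeasurableSpace S₂]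
    (τ : Option α × Option β → ℝ) (ν : Option α → Measure S₁) (ν' : Option β → Measure S₂)
    (γ₀ : Measure (S₁ × S₂)) : Measure (S₁ × S₂) :=
  (∑ e, ENNReal.ofReal (τ e) • (ν e.1).prod (ν' e.2)) + γ₀

theorem liftMeasure_fst {S₁ S₂ : Type*} [MeasurableSpace S₁] [MeasurableSpace S₂]
    {τ : Option α × Option β → ℝ} (hτ : ∀ e, 0 ≤ τ e) (ν : Option α → Measure S₁)
    (ν' : Option β → Measure S₂) [∀ j, IsProbabilityMeasure (ν' j)] (γ₀ : Measure (S₁ × S₂)) :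
    (liftMeasure τ ν ν' γ₀).map Prod.fst =
      (∑ i, ENNReal.ofReal (rows τ i) • ν i) + γ₀.map Prod.fst := by
  rw [liftMeasure, Measure.map_add _ _ measurable_fst,
    Measure.map_finset_sum measurable_fst.aemeasurable, Fintype.sum_prod_type]
  congr 1
  refine Finset.sum_congr rfl fun i _ => ?_
  rw [rows, ENNReal.ofReal_sum_of_nonneg fun j _ => hτ _, Finset.sum_smul]
  refine Finset.sum_congr rfl fun j _ => ?_
  rw [Measure.map_smul, Measure.map_fst_prod, measure_univ, one_smul]

theorem liftMeasure_snd {S₁ S₂ : Type*} [MeasurableSpace S₁] [MeasurableSpace S₂]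
    {τ : Option α × Option β → ℝ} (hτ : ∀ e, 0 ≤ τ e) (ν : Option α → Measure S₁)
    (ν' : Option β → Measure S₂) [∀ i, IsProbabilityMeasure (ν i)]
    [∀ j, IsProbabilityMeasure (ν' j)] (γ₀ : Measure (S₁ × S₂)) :
    (liftMeasure τ ν ν' γ₀).map Prod.snd =
      (∑ j, ENNReal.ofReal (cols τ j) • ν' j) + γ₀.map Prod.snd := by
  rw [liftMeasure, Measure.map_add _ _ measurable_snd,
    Measure.map_finset_sum measurable_snd.aemeasurable, Fintype.sum_prod_type_right]
  congr 1
  refine Finset.sum_congr rfl fun i _ => ?_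
  rw [cols, ENNReal.ofReal_sum_of_nonneg fun j _ => hτ _, Finset.sum_smul]
  refine Finset.sum_congr rfl fun j _ => ?_
  rw [Measure.map_smul, Measure.map_snd_prod, measure_univ, one_smul]

/-- A matrix with small box norm yields a coupling with small cut norm. -/
theorem couplingDist_le_of_lift (h : IsModel 𝒲 f idx w) (h' : IsModel 𝒲' g idx' w')
    {τ : Option α × Option β → ℝ} (hτ : ∀ e, 0 ≤ τ e) (ν : Option α → Measure 𝒲.S)
    (ν' : Option β → Measure 𝒲'.S) (hp : ∀ i, IsProbabilityMeasure (ν i))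
    (hp' : ∀ j, IsProbabilityMeasure (ν' j)) (γ₀ : Measure (𝒲.S × 𝒲'.S))
    (hν : ∀ e, τ e ≠ 0 → ν e.1 (idx ⁻¹' {e.1})ᶜ = 0 ∧ ν' e.2 (idx' ⁻¹' {e.2})ᶜ = 0)
    (hγ₀ : γ₀ (Prod.map idx idx' ⁻¹' {(none, none)})ᶜ = 0)
    (h₁ : (∑ i, ENNReal.ofReal (rows τ i) • ν i) + γ₀.map Prod.fst = 𝒲.μ)
    (h₂ : (∑ j, ENNReal.ofReal (cols τ j) • ν' j) + γ₀.map Prod.snd = 𝒲'.μ)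
    {ε : ℝ} (hbox : BoxBound (diffMat f g) τ ε) :
    couplingDist 𝒲 𝒲' ≤ ENNReal.ofReal ε := by
  classical
  have hγ : IsCoupling 𝒲.μ 𝒲'.μ (liftMeasure τ ν ν' γ₀) :=
    ⟨(liftMeasure_fst hτ ν ν' γ₀).trans h₁, (liftMeasure_snd hτ ν ν' γ₀).trans h₂⟩
  have := hγ.sigmaFinite
  refine (iInf₂_le (liftMeasure τ ν ν' γ₀) hγ).trans ?_
  have hmeas : ∀ e, MeasurableSet (Prod.map idx idx' ⁻¹' {e}) := fun e => by
    rw [cell_prod]; exact (h.measurableSet_cell _).prod (h'.measurableSet_cell _)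
  have hcell : ∀ e, e ≠ (none, none) →
      -- The remainder `γ₀` lives over both zero regions, so a cell elsewhere receives only the
      -- summand carrying its own index.
      liftMeasure τ ν ν' γ₀ (Prod.map idx idx' ⁻¹' {e}) ≤ ENNReal.ofReal (τ e) := by
    intro e he
    rw [liftMeasure, Measure.add_apply, Measure.finsetSum_apply,
      measure_mono_null (t := (Prod.map idx idx' ⁻¹' {(none, none)})ᶜ)
        (fun z hz hz' => he (hz.symm.trans hz')) hγ₀, add_zero,
      Finset.sum_eq_single e]
    · rw [Measure.smul_apply, smul_eq_mul]
      exact mul_le_of_le_one_right' prob_le_one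
    · intro e' _ he'
      rw [Measure.smul_apply, smul_eq_mul, cell_prod, Measure.prod_prod]
      by_cases h0 : τ e' = 0
      · simp [h0]
      by_cases h1 : e'.1 = e.1
      · have h2 : e'.2 ≠ e.2 := fun h2 => he' (Prod.ext h1 h2)
        rw [measure_mono_null (s := idx' ⁻¹' {e.2}) (t := (idx' ⁻¹' {e'.2})ᶜ)
          (fun z hz hz' => h2 (hz'.symm.trans hz))
          (hν e' h0).2]
        simp
      · rw [measure_mono_null (s := idx ⁻¹' {e.1}) (t := (idx ⁻¹' {e'.1})ᶜ)
          (fun z hz hz' => h1 (hz'.symm.trans hz))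
          (hν e' h0).1]
        simp
    · simp
  have := cutNorm_le_of_boxBound (liftMeasure τ ν ν' γ₀) (Prod.map idx idx') hmeas (diffMat f g) τ
    hτ (fun e e' he => ⟨hcell e (diffMat_model_ne_zero h h' he).1,
      hcell e' (diffMat_model_ne_zero h h' he).2⟩) hbox
  simpa only [diffMat, h.W_eq, h'.W_eq, Prod.map_fst, Prod.map_snd] using this

end Model

/-! ### The graphons of a finite graph as step functions -/

open Classical in
/-- The adjacency matrix. -/
def FinGraph.adjR (G : FinGraph) (i j : Fin G.card) : ℝ := if G.graph.Adj i j then 1 else 0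

/-- The adjacency matrix with an additional isolated vertex `none`. -/
def FinGraph.adjO (G : FinGraph) : Option (Fin G.card) → Option (Fin G.card) → ℝ
  | some i, some j => G.adjR i j
  | none, _ => 0
  | _, none => 0

@[simp] theorem FinGraph.adjO_none_left (G : FinGraph) (e) : G.adjO none e = 0 := rfl

@[simp] theorem FinGraph.adjO_none_right (G : FinGraph) (e) : G.adjO e none = 0 := by
  cases e <;> rfl

@[simp] theorem FinGraph.adjO_some (G : FinGraph) (i j) : G.adjO (some i) (some j) = G.adjR i j :=
  rfl

theorem FinGraph.adjR_nonneg (G : FinGraph) (i j) : 0 ≤ G.adjR i j := by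
  unfold adjR; split_ifs <;> norm_num

theorem FinGraph.adjR_le_one (G : FinGraph) (i j) : G.adjR i j ≤ 1 := by
  unfold adjR; split_ifs <;> norm_num

theorem FinGraph.adjO_nonneg (G : FinGraph) (i j) : 0 ≤ G.adjO i j := by
  cases i <;> cases j <;> simp [adjR_nonneg]

theorem FinGraph.abs_adjO_le_one (G : FinGraph) (i j) : |G.adjO i j| ≤ 1 := by
  cases i <;> cases j <;> simp [abs_of_nonneg, adjR_nonneg, adjR_le_one]

/-- The number of ordered pairs of adjacent vertices. -/
def FinGraph.deg2 (G : FinGraph) : ℝ := ∑ i, ∑ j, G.adjR i j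

theorem FinGraph.deg2_eq (G : FinGraph) : G.deg2 = 2 * (G.graph.edgeSet.ncard : ℝ) := by
  classical
  have h := G.graph.sum_degrees_eq_twice_card_edges
  have h1 : G.graph.edgeSet.ncard = G.graph.edgeFinset.card := by
    rw [← SimpleGraph.coe_edgeFinset, Set.ncard_coe_finset]
  have h2 : ∀ i, ∑ j, G.adjR i j = (G.graph.degree i : ℝ) := fun i => by
    simp [FinGraph.adjR, ← SimpleGraph.card_neighborFinset_eq_degree,
      SimpleGraph.neighborFinset_eq_filter]
  simp only [FinGraph.deg2, h2]
  rw [h1]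
  exact_mod_cast h

theorem FinGraph.deg2_nonneg (G : FinGraph) : 0 ≤ G.deg2 :=
  Finset.sum_nonneg fun _ _ => Finset.sum_nonneg fun _ _ => G.adjR_nonneg _ _

theorem FinGraph.deg2_pos (G : FinGraph) (h : G.graph.edgeSet.Nonempty) : 0 < G.deg2 := by
  rw [G.deg2_eq]
  have : 0 < G.graph.edgeSet.ncard := (Set.ncard_pos (Set.toFinite _)).2 h
  positivity

theorem FinGraph.density_eq (G : FinGraph) : G.density = G.deg2 / (G.card : ℝ) ^ 2 := by
  rw [G.deg2_eq]; rfl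

theorem FinGraph.deg2_le (G : FinGraph) : G.deg2 ≤ (G.card : ℝ) ^ 2 := by
  calc G.deg2 ≤ ∑ _i : Fin G.card, ∑ _j : Fin G.card, (1 : ℝ) :=
        Finset.sum_le_sum fun _ _ => Finset.sum_le_sum fun _ _ => G.adjR_le_one _ _
    _ = (G.card : ℝ) ^ 2 := by simp [sq]

theorem FinGraph.density_le_one (G : FinGraph) : G.density ≤ 1 := by
  rw [G.density_eq]; exact div_le_one_of_le₀ G.deg2_le (sq_nonneg _)

theorem FinGraph.card_pos_of_density_pos (G : FinGraph) (h : 0 < G.density) :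
    0 < (G.card : ℝ) := by
  rcases Nat.eq_zero_or_pos G.card with h0 | h0
  · rw [G.density_eq, h0] at h; simp at h
  · exact_mod_cast h0

theorem FinGraph.deg2_pos_of_density_pos (G : FinGraph) (h : 0 < G.density) : 0 < G.deg2 := by
  refine lt_of_le_of_ne G.deg2_nonneg fun h0 => ?_
  rw [G.density_eq, ← h0] at h; simp at h

theorem FinGraph.density_pos (G : FinGraph) (h : 0 < G.deg2) : 0 < G.density := by
  rw [G.density_eq]
  have : 0 < (G.card : ℝ) ^ 2 := h.trans_le G.deg2_le
  positivity

theorem stepFun_eq (G : FinGraph) {S : Type u} (I : Fin G.card → Set S)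
    (idx : S → Option (Fin G.card)) (h : ∀ x i, x ∈ I i ↔ idx x = some i) (z : S × S) :
    stepFun G I z = G.adjO (idx z.1) (idx z.2) := by
  classical
  have hterm : ∀ i j, (if G.graph.Adj i j then (I i ×ˢ I j).indicator (fun _ => (1 : ℝ)) z else 0) =
      if idx z.1 = some i ∧ idx z.2 = some j then G.adjR i j else 0 := fun i j => by
    have : z ∈ I i ×ˢ I j ↔ idx z.1 = some i ∧ idx z.2 = some j := by
      rw [Set.mem_prod, h, h]
    simp only [Set.indicator, this, FinGraph.adjR]
    split_ifs <;> rfl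
  unfold stepFun
  simp only [hterm]
  rcases h1 : idx z.1 with _ | a
  · simp
  rcases h2 : idx z.2 with _ | b
  · simp
  simp only [Option.some.injEq, FinGraph.adjO_some]
  rw [Finset.sum_eq_single a, Finset.sum_eq_single b]
  · simp
  · intro j _ hj; simp [hj.symm]
  · simp
  · intro i _ hi; exact Finset.sum_eq_zero fun j _ => by simp [hi.symm]
  · simp

/-- The vertex whose cell `[i, i + 1)` contains `x`. -/
def halfIdx (k : ℕ) (x : ℝ≥0) : Option (Fin k) :=
  if h : ⌊x⌋₊ < k then some ⟨⌊x⌋₊, h⟩ else none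

theorem mem_halfLineCell {k : ℕ} (x : ℝ≥0) (i : Fin k) :
    x ∈ halfLineCell i ↔ halfIdx k x = some i := by
  unfold halfLineCell halfIdx
  rw [Set.mem_Ico, ← Nat.floor_eq_iff zero_le]
  constructor
  · intro h
    simp [h, i.2]
  · intro h
    split_ifs at h with h'
    exact congrArg Fin.val (Option.some.inj h)

theorem halfIdx_eq_none {k : ℕ} (x : ℝ≥0) : halfIdx k x = none ↔ (k : ℝ≥0) ≤ x := by
  unfold halfIdx
  rw [← Nat.le_floor_iff zero_le]
  split_ifs with h
  · simpa using h
  · simpa using not_lt.1 h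

theorem halfIdx_preimage_some {k : ℕ} (i : Fin k) : halfIdx k ⁻¹' {some i} = halfLineCell i :=
  Set.ext fun x => (mem_halfLineCell x i).symm

theorem halfIdx_preimage_none {k : ℕ} : halfIdx k ⁻¹' {none} = Set.Ici (k : ℝ≥0) :=
  Set.ext fun x => halfIdx_eq_none x

theorem measurableSet_halfIdx {k : ℕ} (e : Option (Fin k)) :
    MeasurableSet (halfIdx k ⁻¹' {e}) := by
  rcases e with _ | i
  · rw [halfIdx_preimage_none]; exact measurableSet_Ici
  · rw [halfIdx_preimage_some]; exact measurableSet_Ico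

theorem halfLine_Ico (a b : ℝ≥0) : halfLine (Set.Ico a b) = ENNReal.ofReal (b - a) := by
  have : ((↑) : ℝ≥0 → ℝ) '' Set.Ico a b = Set.Ico (a : ℝ) b := by
    ext x
    constructor
    · rintro ⟨y, hy, rfl⟩; exact ⟨by exact_mod_cast hy.1, by exact_mod_cast hy.2⟩
    · rintro ⟨h1, h2⟩
      exact ⟨⟨x, a.2.trans h1⟩, ⟨h1, h2⟩, rfl⟩
  rw [halfLine_apply, this, Real.volume_Ico]

theorem halfLine_halfLineCell {k : ℕ} (i : Fin k) : halfLine (halfLineCell i) = 1 := by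
  rw [halfLineCell, halfLine_Ico]; simp

theorem halfLineGraphon_isModel (G : FinGraph) :
    IsModel G.halfLineGraphon G.adjO (halfIdx G.card) 1 where
  measurableSet_cell := measurableSet_halfIdx
  W_eq := stepFun_eq G _ _ mem_halfLineCell
  none_left := by simp
  none_right := by simp
  w_nonneg := zero_le_one
  measure_cell i := by
    have : halfLine (halfIdx G.card ⁻¹' {some i}) = ENNReal.ofReal 1 := by
      rw [halfIdx_preimage_some, ENNReal.ofReal_one, halfLine_halfLineCell]
    exact this

theorem halfLineGraphon_l1 (G : FinGraph) : G.halfLineGraphon.l1 = G.deg2 := by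
  rw [(halfLineGraphon_isModel G).l1_eq]
  simp [FinGraph.deg2, abs_of_nonneg (G.adjR_nonneg _ _)]

theorem coe_scale (G : FinGraph) : (G.scale : ℝ) = √G.deg2 := by
  rw [FinGraph.scale, halfLineGraphon_l1, Real.sqrt, NNReal.coe_inj]

/-- The graphon over the measure space `(S, c • μ)`. -/
def Graphon.scaleMeasure (𝒲 : Graphon.{u}) (c : ℝ≥0) (hc : c ≠ 0) : Graphon.{u} where
  S := 𝒲.S
  μ := c • 𝒲.μ
  W := 𝒲.W
  mass_pos := by
    rw [Measure.smul_apply, ENNReal.smul_def, smul_eq_mul]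
    exact ENNReal.mul_pos (by exact_mod_cast hc) 𝒲.mass_pos.ne'
  symm := 𝒲.symm
  meas := 𝒲.meas
  integrable := by
    rw [Measure.prod_smul_left, Measure.prod_smul_right, smul_smul]
    exact 𝒲.integrable.smul_measure_nnreal

theorem scale_inv_ne_zero {G : FinGraph} (h : 0 < G.deg2) : (G.scale)⁻¹ ≠ 0 := by
  refine inv_ne_zero fun h0 => ?_
  have := coe_scale G
  rw [h0] at this
  exact (Real.sqrt_pos.2 h).ne this

theorem stretch_halfLineGraphon (G : FinGraph) (h : 0 < G.deg2) :
    G.halfLineGraphon.stretch = G.halfLineGraphon.scaleMeasure (G.scale)⁻¹ (scale_inv_ne_zero h) := by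
  have h1 : Real.toNNReal (√G.halfLineGraphon.l1)⁻¹ = (G.scale)⁻¹ := by
    rw [Real.toNNReal_inv, halfLineGraphon_l1, ← coe_scale, Real.toNNReal_coe]
  rw [Graphon.stretch, dif_neg (by rw [halfLineGraphon_l1]; exact h.ne')]
  simp only [h1]
  rfl

/-- The stretched graphon of a graph over the half line with the scaled Lebesgue measure. -/
abbrev FinGraph.stretched (G : FinGraph) (h : 0 < G.deg2) : Graphon.{0} :=
  G.halfLineGraphon.scaleMeasure (G.scale)⁻¹ (scale_inv_ne_zero h)

theorem stretched_isModel (G : FinGraph) (h : 0 < G.deg2) :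
    IsModel (G.stretched h) G.adjO (halfIdx G.card) (√G.deg2)⁻¹ where
  measurableSet_cell := measurableSet_halfIdx
  W_eq := stepFun_eq G _ _ mem_halfLineCell
  none_left := by simp
  none_right := by simp
  w_nonneg := by positivity
  measure_cell i := by
    have : ((G.scale)⁻¹ • halfLine) (halfIdx G.card ⁻¹' {some i}) =
        ENNReal.ofReal (√G.deg2)⁻¹ := by
      rw [halfIdx_preimage_some, Measure.smul_apply, halfLine_halfLineCell, ENNReal.smul_def, smul_eq_mul, mul_one,
        ← coe_scale, ← NNReal.coe_inv, ENNReal.ofReal_coe_nnreal]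
    exact this

theorem stretched_univ (G : FinGraph) (h : 0 < G.deg2) : (G.stretched h).μ Set.univ = ⊤ := by
  have : ((G.scale)⁻¹ • halfLine) Set.univ = ⊤ := by
    rw [Measure.smul_apply, halfLine_univ, ENNReal.smul_def, smul_eq_mul]
    exact ENNReal.mul_top (by exact_mod_cast scale_inv_ne_zero h)
  exact this

/-- Both half lines have infinite mass, so the cut metric takes its branch without extension. -/
theorem stretchedCutDist_eq (G H : FinGraph) (hG : 0 < G.deg2) (hH : 0 < H.deg2) :
    stretchedCutDist G.halfLineGraphon H.halfLineGraphon =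
      couplingDist (G.stretched hG) (H.stretched hH) := by
  rw [stretchedCutDist, stretch_halfLineGraphon G hG, stretch_halfLineGraphon H hH, cutDist,
    if_pos]
  exact (stretched_univ G hG).trans (stretched_univ H hH).symm

theorem halfLine_map_mul (c : ℝ≥0) (hc : c ≠ 0) :
    halfLine.map (fun x => c * x) = c⁻¹ • halfLine := by
  ext s hs
  have hm : Measurable fun x : ℝ≥0 => c * x := by fun_prop
  have hc' : (c : ℝ) ≠ 0 := by exact_mod_cast hc
  rw [Measure.map_apply hm hs, Measure.smul_apply, halfLine_apply, halfLine_apply]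
  have : ((↑) : ℝ≥0 → ℝ) '' ((fun x => c * x) ⁻¹' s) =
      (fun x : ℝ => c * x) ⁻¹' (((↑) : ℝ≥0 → ℝ) '' s) := by
    ext x
    constructor
    · rintro ⟨y, hy, rfl⟩; exact ⟨c * y, hy, by simp⟩
    · rintro ⟨y, hy, hyx⟩
      have hx : x = (c⁻¹ * y : ℝ≥0) := by
        push_cast; dsimp only at hyx; rw [hyx]; field_simp
      refine ⟨c⁻¹ * y, ?_, hx.symm⟩
      rw [Set.mem_preimage, mul_inv_cancel_left₀ hc]; exact hy
  rw [this, Real.volume_preimage_mul_left hc', ENNReal.smul_def, smul_eq_mul, abs_inv,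
    abs_of_nonneg c.coe_nonneg, ← NNReal.coe_inv, ENNReal.ofReal_coe_nnreal]

theorem stretchedCanonical_isModel (G : FinGraph) (h : 0 < G.deg2) :
    IsModel G.stretchedCanonical G.adjO (fun x : ℝ≥0 => halfIdx G.card (G.scale * x))
      (√G.deg2)⁻¹ where
  measurableSet_cell e := (by fun_prop : Measurable fun x : ℝ≥0 => G.scale * x)
    (measurableSet_halfIdx e)
  W_eq := fun z : ℝ≥0 × ℝ≥0 => stepFun_eq G _ _ mem_halfLineCell (G.scale * z.1, G.scale * z.2)
  none_left := by simp
  none_right := by simp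
  w_nonneg := by positivity
  measure_cell i := by
    change halfLine ((fun x : ℝ≥0 => G.scale * x) ⁻¹' (halfIdx G.card ⁻¹' {some i})) = _
    rw [← Measure.map_apply (by fun_prop) (measurableSet_halfIdx _),
      halfLine_map_mul _ (fun h0 => scale_inv_ne_zero h (by rw [h0, inv_zero])), halfIdx_preimage_some,
      Measure.smul_apply, halfLine_halfLineCell, ENNReal.smul_def, smul_eq_mul, mul_one,
      ← coe_scale, ← NNReal.coe_inv, ENNReal.ofReal_coe_nnreal]

/-- The vertex whose cell in `[0, 1]` contains `x`. -/
def unitIdx (k : ℕ) (x : unitInterval) : Option (Fin k) :=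
  if h : ⌈(k : ℝ) * x⌉₊ - 1 < k then some ⟨⌈(k : ℝ) * x⌉₊ - 1, h⟩ else none

theorem mem_unitCell {k : ℕ} (x : unitInterval) (i : Fin k) :
    x ∈ unitCell i ↔ unitIdx k x = some i := by
  have hk : (0 : ℝ) < k := by exact_mod_cast i.pos
  -- At `x = 0` the ceiling is `0` and truncated subtraction returns `0`, in agreement with the
  -- first cell being closed on the left.
  have h1 : x ∈ unitCell i ↔ ⌈(k : ℝ) * x⌉₊ - 1 = i := by
    have h2 : ((i : ℕ) : ℝ) / k < x ↔ (i : ℕ) < ⌈(k : ℝ) * x⌉₊ := by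
      rw [Nat.lt_ceil, div_lt_iff₀ hk, mul_comm]
    have h3 : (x : ℝ) ≤ ((i : ℕ) + 1 : ℝ) / k ↔ ⌈(k : ℝ) * x⌉₊ ≤ i + 1 := by
      rw [Nat.ceil_le, le_div_iff₀ hk, mul_comm]; push_cast; rfl
    unfold unitCell
    rw [Set.mem_ofPred_eq, h2, h3]
    omega
  rw [h1, unitIdx]
  constructor
  · intro h
    simp [h, i.2]
  · intro h
    split_ifs at h with h'
    exact congrArg Fin.val (Option.some.inj h)

theorem unitIdx_ne_none {k : ℕ} (hk : 0 < k) (x : unitInterval) : unitIdx k x ≠ none := by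
  have h : ⌈(k : ℝ) * x⌉₊ ≤ k := by
    rw [Nat.ceil_le]
    exact mul_le_of_le_one_right (Nat.cast_nonneg k) x.2.2
  rw [unitIdx, dif_pos (by omega)]
  simp

theorem unitIdx_preimage_some {k : ℕ} (i : Fin k) : unitIdx k ⁻¹' {some i} = unitCell i :=
  Set.ext fun x => (mem_unitCell x i).symm

theorem measurableSet_unitIdx {k : ℕ} (e : Option (Fin k)) :
    MeasurableSet (unitIdx k ⁻¹' {e}) := by
  rcases e with _ | i
  · have : unitIdx k ⁻¹' {none} = (⋃ i : Fin k, unitCell i)ᶜ := by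
      ext x
      simp only [Set.mem_preimage, Set.mem_singleton_iff, Set.mem_compl_iff, Set.mem_iUnion,
        mem_unitCell]
      rcases unitIdx k x <;> simp
    rw [this]
    exact (MeasurableSet.iUnion fun i => unitCell_meas i).compl
  · rw [unitIdx_preimage_some]; exact unitCell_meas i

theorem volume_unitCell {k : ℕ} (i : Fin k) :
    (volume : Measure unitInterval) (unitCell i) = ENNReal.ofReal (k : ℝ)⁻¹ := by
  have hk : (0 : ℝ) < k := by exact_mod_cast i.pos
  have hi : ((i : ℕ) + 1 : ℝ) / k ≤ 1 := by
    rw [div_le_one hk]; exact_mod_cast i.2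
  have hlen : ((i : ℕ) + 1 : ℝ) / k - (i : ℕ) / k = (k : ℝ)⁻¹ := by field_simp; ring
  rw [unitInterval.volume_apply, ← hlen]
  refine le_antisymm ?_ ?_
  · rw [← Real.volume_Icc]
    refine measure_mono ?_
    rintro _ ⟨x, ⟨h1, h2⟩, rfl⟩
    refine ⟨?_, h2⟩
    rcases h1 with h1 | h1
    · simpa [h1] using x.2.1
    · exact h1.le
  · rw [← Real.volume_Ioc]
    refine measure_mono fun x hx => ?_
    have h0 : 0 ≤ x := le_trans (by positivity) hx.1.le
    exact ⟨⟨x, h0, hx.2.trans hi⟩, ⟨Or.inr hx.1, hx.2⟩, rfl⟩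

theorem canonical_isModel (G : FinGraph) :
    IsModel G.canonical G.adjO (unitIdx G.card) (G.card : ℝ)⁻¹ where
  measurableSet_cell := measurableSet_unitIdx
  W_eq := stepFun_eq G _ _ mem_unitCell
  none_left := by simp
  none_right := by simp
  w_nonneg := by positivity
  measure_cell i := by
    have : (volume : Measure unitInterval) (unitIdx G.card ⁻¹' {some i}) =
        ENNReal.ofReal (G.card : ℝ)⁻¹ := by
      rw [unitIdx_preimage_some, volume_unitCell]
    exact this

theorem canonical_l1 (G : FinGraph) : G.canonical.l1 = G.density := by
  rw [(canonical_isModel G).l1_eq, G.density_eq]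
  simp [FinGraph.deg2, abs_of_nonneg (G.adjR_nonneg _ _), div_eq_inv_mul]

theorem rescaled_isModel (G : FinGraph) :
    IsModel G.canonical.rescale (fun e e' => G.density⁻¹ * G.adjO e e') (unitIdx G.card)
      (G.card : ℝ)⁻¹ where
  measurableSet_cell := measurableSet_unitIdx
  W_eq z := by
    rw [← canonical_l1]
    exact congrArg (G.canonical.l1⁻¹ * ·) ((canonical_isModel G).W_eq z)
  none_left := by simp
  none_right := by simp
  w_nonneg := by positivity
  measure_cell := (canonical_isModel G).measure_cell

/-- The added half line joins the cell of index `none`; the matrix and the other weights do not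
change. -/
theorem IsModel.extend {𝒲 : Graphon.{u}} {α : Type*} {f : Option α → Option α → ℝ}
    {idx : 𝒲.S → Option α} {w : ℝ} (h : IsModel 𝒲 f idx w) :
    IsModel 𝒲.extend f (Sum.elim idx fun _ => none : 𝒲.S ⊕ ℝ≥0 → Option α) w where
  measurableSet_cell e := by
    refine measurableSet_sum_iff.2 ⟨h.measurableSet_cell e, ?_⟩
    change MeasurableSet ((fun _ : ℝ≥0 => (none : Option α)) ⁻¹' {e})
    by_cases he : none = e <;> simp [Set.preimage, he]
  W_eq := by
    have hinj : Function.Injective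
        (Prod.map Sum.inl Sum.inl : 𝒲.S × 𝒲.S → (𝒲.S ⊕ ℝ≥0) × (𝒲.S ⊕ ℝ≥0)) :=
      Sum.inl_injective.prodMap Sum.inl_injective
    have hW : ∀ z : (𝒲.S ⊕ ℝ≥0) × (𝒲.S ⊕ ℝ≥0),
        Function.extend (Prod.map Sum.inl Sum.inl) 𝒲.W 0 z =
          f (Sum.elim idx (fun _ => none) z.1) (Sum.elim idx (fun _ => none) z.2) := by
      rintro ⟨x | x, y | y⟩
      · exact (hinj.extend_apply 𝒲.W 0 (x, y)).trans (h.W_eq _)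
      all_goals
        rw [Function.extend_apply' _ _ _ (by rintro ⟨⟨a, b⟩, h⟩; simp at h)]
        simp [h.none_left, h.none_right]
    exact hW
  none_left := h.none_left
  none_right := h.none_right
  w_nonneg := h.w_nonneg
  measure_cell i := by
    have hm : MeasurableSet ((Sum.elim idx fun _ => none : 𝒲.S ⊕ ℝ≥0 → Option α) ⁻¹' {some i}) := by
      refine measurableSet_sum_iff.2 ⟨h.measurableSet_cell _, ?_⟩
      change MeasurableSet ((fun _ : ℝ≥0 => (none : Option α)) ⁻¹' {some i})
      simp [Set.preimage]
    have hemp : Sum.inr ⁻¹' ((Sum.elim idx fun _ => none : 𝒲.S ⊕ ℝ≥0 → Option α) ⁻¹' {some i}) =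
        ∅ := by
      ext x; simp
    have : extMeasure 𝒲.μ ((Sum.elim idx fun _ => none : 𝒲.S ⊕ ℝ≥0 → Option α) ⁻¹' {some i}) =
        ENNReal.ofReal w := by
      rw [extMeasure, Measure.add_apply, Measure.map_apply measurable_inl hm,
        Measure.map_apply measurable_inr hm, ← h.measure_cell i, hemp, measure_empty, add_zero]
      rfl
    exact this

/-! ### Couplings built from matrices -/

theorem sum_restrict_cells {S ι : Type*} [MeasurableSpace S] [Fintype ι] (μ : Measure S)
    (s : ι → Set S) (hs : ∀ i, MeasurableSet (s i)) (hd : Pairwise (Function.onFun Disjoint s)) :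
    ∑ i, μ.restrict (s i) = μ.restrict (⋃ i, s i) := by
  rw [Measure.restrict_iUnion hd hs, Measure.sum_fintype]

theorem smul_cond_eq_restrict {S : Type*} [MeasurableSpace S] {μ : Measure S} {s : Set S} {w : ℝ}
    (hw : 0 < w) (hs : μ s = ENNReal.ofReal w) :
    ENNReal.ofReal w • ProbabilityTheory.cond μ s = μ.restrict s := by
  rw [ProbabilityTheory.cond, hs, smul_smul,
    ENNReal.mul_inv_cancel (by simpa using hw) ENNReal.ofReal_ne_top, one_smul]

theorem isProbabilityMeasure_cond {S : Type*} [MeasurableSpace S] {μ : Measure S} {s : Set S}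
    {w : ℝ} (hw : 0 < w) (hs : μ s = ENNReal.ofReal w) :
    IsProbabilityMeasure (ProbabilityTheory.cond μ s) :=
  ProbabilityTheory.cond_isProbabilityMeasure_of_finite (by rw [hs]; simpa using hw)
    (by rw [hs]; exact ENNReal.ofReal_ne_top)

theorem cond_compl_eq_zero {S : Type*} [MeasurableSpace S] (μ : Measure S) {s : Set S}
    (h : MeasurableSet s) : ProbabilityTheory.cond μ s sᶜ = 0 := by
  rw [ProbabilityTheory.cond_apply h]; simp

theorem disjoint_halfLineCell {k : ℕ} :
    Pairwise (Function.onFun Disjoint (halfLineCell : Fin k → Set ℝ≥0)) := fun i j hij => by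
  refine Set.disjoint_left.2 fun x hx hx' => hij ?_
  rw [mem_halfLineCell] at hx hx'
  exact Option.some.inj (hx.symm.trans hx')

theorem disjoint_unitCell {k : ℕ} :
    Pairwise (Function.onFun Disjoint (unitCell : Fin k → Set unitInterval)) := fun i j hij => by
  refine Set.disjoint_left.2 fun x hx hx' => hij ?_
  rw [mem_unitCell] at hx hx'
  exact Option.some.inj (hx.symm.trans hx')

theorem iUnion_halfLineCell {k : ℕ} :
    ⋃ i : Fin k, halfLineCell i = Set.Iio (k : ℝ≥0) := by
  ext x
  rw [Set.mem_iUnion, Set.mem_Iio, ← not_le, ← halfIdx_eq_none]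
  simp only [mem_halfLineCell]
  rcases halfIdx k x <;> simp

theorem iUnion_unitCell {k : ℕ} (hk : 0 < k) :
    ⋃ i : Fin k, (unitCell i : Set unitInterval) = Set.univ := by
  refine Set.eq_univ_of_forall fun x => ?_
  simp only [Set.mem_iUnion, mem_unitCell]
  have := unitIdx_ne_none hk x
  rcases h : unitIdx k x with _ | i
  · exact absurd h this
  · exact ⟨i, rfl⟩

theorem halfLine_map_add (a : ℝ≥0) :
    halfLine.map (fun x => a + x) = halfLine.restrict (Set.Ici a) := by
  ext s hs
  have hm : Measurable fun x : ℝ≥0 => a + x := by fun_prop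
  rw [Measure.map_apply hm hs, Measure.restrict_apply hs, halfLine_apply, halfLine_apply]
  have : ((↑) : ℝ≥0 → ℝ) '' ((fun x => a + x) ⁻¹' s) =
      (fun x : ℝ => a + x) ⁻¹' (((↑) : ℝ≥0 → ℝ) '' (s ∩ Set.Ici a)) := by
    ext x
    constructor
    · rintro ⟨y, hy, rfl⟩
      exact ⟨a + y, ⟨hy, Set.mem_Ici.2 (le_add_of_nonneg_right zero_le)⟩, by simp⟩
    · rintro ⟨y, ⟨hy, hya⟩, hyx⟩
      obtain ⟨t, rfl⟩ := exists_add_of_le (show a ≤ y from hya)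
      refine ⟨t, hy, ?_⟩
      push_cast at hyx
      linarith
  rw [this, measure_preimage_add]

theorem halfLine_map_affine (a c : ℝ≥0) (hc : c ≠ 0) :
    halfLine.map (fun x => a + c⁻¹ * x) = (c • halfLine).restrict (Set.Ici a) := by
  have h := halfLine_map_mul c⁻¹ (inv_ne_zero hc)
  rw [inv_inv] at h
  rw [Measure.restrict_smul, ← halfLine_map_add, ← Measure.map_smul, ← h,
    Measure.map_map (by fun_prop) (by fun_prop)]
  rfl

theorem exists_tail_measure (c : ℝ≥0) (hc : c ≠ 0) (a : ℝ≥0) {B : ℝ} (hB : 0 ≤ B) :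
    ∃ (ν : Measure ℝ≥0) (b : ℝ≥0), IsProbabilityMeasure ν ∧ a ≤ b ∧ ν (Set.Ici a)ᶜ = 0 ∧
      ENNReal.ofReal B • ν = (c • halfLine).restrict (Set.Ico a b) := by
  rcases hB.eq_or_lt with rfl | hB
  -- With no mass to place, any probability measure on the tail will do.
  · exact ⟨Measure.dirac a, a, inferInstance, le_rfl, by simp, by simp⟩
  · have hs : (c • halfLine) (Set.Ico a (a + c⁻¹ * B.toNNReal)) = ENNReal.ofReal B := by
      rw [Measure.smul_apply, halfLine_Ico, ENNReal.smul_def, smul_eq_mul,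
        ← ENNReal.ofReal_coe_nnreal, ← ENNReal.ofReal_mul c.coe_nonneg]
      congr 1
      have : (c : ℝ) ≠ 0 := by exact_mod_cast hc
      push_cast
      rw [Real.coe_toNNReal _ hB.le]
      field_simp
      ring
    refine ⟨_, _, isProbabilityMeasure_cond hB hs, le_add_of_nonneg_right zero_le, ?_,
      smul_cond_eq_restrict hB hs⟩
    exact measure_mono_null (Set.compl_subset_compl.2 Set.Ico_subset_Ici_self)
      (cond_compl_eq_zero _ measurableSet_Ico)

theorem halfLine_decomp (c : ℝ≥0) (k : ℕ) {b : ℝ≥0} (hb : (k : ℝ≥0) ≤ b) :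
    (∑ i : Fin k, (c • halfLine).restrict (halfLineCell i)) +
      (c • halfLine).restrict (Set.Ico (k : ℝ≥0) b) + (c • halfLine).restrict (Set.Ici b) =
      c • halfLine := by
  rw [sum_restrict_cells _ (halfLineCell : Fin k → Set ℝ≥0) (fun _ => measurableSet_Ico)
    disjoint_halfLineCell, iUnion_halfLineCell,
    ← Measure.restrict_union _ measurableSet_Ico, Set.Iio_union_Ico_eq_Iio hb,
    ← Measure.restrict_union _ measurableSet_Ici, Set.Iio_union_Ici, Measure.restrict_univ]
  · exact Set.disjoint_left.2 fun x hx hx' => not_lt.2 (Set.mem_Ici.1 hx') (Set.mem_Iio.1 hx)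
  · exact Set.disjoint_left.2 fun x hx hx' => not_lt.2 hx'.1 (Set.mem_Iio.1 hx)

theorem smul_halfLineCell (G : FinGraph) (h : 0 < G.deg2) (i : Fin G.card) :
    ((G.scale)⁻¹ • halfLine) (halfLineCell i) = ENNReal.ofReal (√G.deg2)⁻¹ := by
  rw [← halfIdx_preimage_some]
  exact (stretched_isModel G h).measure_cell i

/-- A probability measure on the half line for each part of the stretched graphon. -/
def tailFamily (G : FinGraph) (ν : Measure ℝ≥0) : Option (Fin G.card) → Measure ℝ≥0
  | none => ν
  | some i => ProbabilityTheory.cond ((G.scale)⁻¹ • halfLine) (halfLineCell i)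

theorem isProbabilityMeasure_tailFamily (G : FinGraph) (h : 0 < G.deg2) (ν : Measure ℝ≥0)
    (hν : IsProbabilityMeasure ν) (i : Option (Fin G.card)) :
    IsProbabilityMeasure (tailFamily G ν i) := by
  rcases i with _ | i
  · exact hν
  · exact isProbabilityMeasure_cond (inv_pos.2 (Real.sqrt_pos.2 h)) (smul_halfLineCell G h i)

theorem tailFamily_compl (G : FinGraph) (ν : Measure ℝ≥0)
    (hν : ν (Set.Ici (G.card : ℝ≥0))ᶜ = 0) (i : Option (Fin G.card)) :
    tailFamily G ν i (halfIdx G.card ⁻¹' {i})ᶜ = 0 := by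
  rcases i with _ | i
  · rw [halfIdx_preimage_none]; exact hν
  · rw [halfIdx_preimage_some]
    exact cond_compl_eq_zero _ measurableSet_Ico

theorem sum_tailFamily (G : FinGraph) (h : 0 < G.deg2) (ν : Measure ℝ≥0) {b : ℝ≥0}
    (hb : (G.card : ℝ≥0) ≤ b) (r : Option (Fin G.card) → ℝ)
    (hr : ∀ i, r (some i) = (√G.deg2)⁻¹)
    (hν : ENNReal.ofReal (r none) • ν =
      ((G.scale)⁻¹ • halfLine).restrict (Set.Ico (G.card : ℝ≥0) b)) :
    (∑ i, ENNReal.ofReal (r i) • tailFamily G ν i) +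
      ((G.scale)⁻¹ • halfLine).restrict (Set.Ici b) = (G.scale)⁻¹ • halfLine := by
  refine Eq.trans ?_ (halfLine_decomp (G.scale)⁻¹ G.card hb)
  rw [Fintype.sum_option]
  simp only [hr, tailFamily]
  simp only [smul_cond_eq_restrict (inv_pos.2 (Real.sqrt_pos.2 h)) (smul_halfLineCell G h _)]
  rw [hν, add_comm (Measure.restrict _ (Set.Ico _ _))]

/-- Mass of `τ` with one index `none` is placed on an initial piece of the corresponding tail of the
half line. What then remains of the two tails has infinite mass on both sides and lies in the zero
regions, so it can be coupled at no cost. -/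
theorem stretchedCutDist_le (G H : FinGraph) (hG : 0 < G.deg2) (hH : 0 < H.deg2)
    {τ : Option (Fin G.card) × Option (Fin H.card) → ℝ}
    (hτ : IsTransport τ (√G.deg2)⁻¹ (√H.deg2)⁻¹) {ε : ℝ}
    (hbox : BoxBound (diffMat G.adjO H.adjO) τ ε) :
    stretchedCutDist G.halfLineGraphon H.halfLineGraphon ≤ ENNReal.ofReal ε := by
  rw [stretchedCutDist_eq G H hG hH]
  obtain ⟨ν, b, hνp, hb, hν0, hν⟩ := exists_tail_measure (G.scale)⁻¹ (scale_inv_ne_zero hG)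
    G.card (rows_nonneg hτ.nonneg none)
  obtain ⟨ν', b', hνp', hb', hν0', hν'⟩ := exists_tail_measure (H.scale)⁻¹ (scale_inv_ne_zero hH)
    H.card (cols_nonneg hτ.nonneg none)
  -- The remaining tails are coupled along a ray: pushing Lebesgue measure through a map of slope
  -- `scale` gives density `scale⁻¹` on each side.
  set γ₀ : Measure (ℝ≥0 × ℝ≥0) := halfLine.map fun x =>
    (b + ((G.scale)⁻¹)⁻¹ * x, b' + ((H.scale)⁻¹)⁻¹ * x) with hγ₀
  have hm : Measurable fun x : ℝ≥0 =>
    (b + ((G.scale)⁻¹)⁻¹ * x, b' + ((H.scale)⁻¹)⁻¹ * x) := by fun_prop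
  have h₁ : γ₀.map Prod.fst = ((G.scale)⁻¹ • halfLine).restrict (Set.Ici b) := by
    rw [hγ₀, Measure.map_map measurable_fst hm, ← halfLine_map_affine _ _ (scale_inv_ne_zero hG)]
    rfl
  have h₂ : γ₀.map Prod.snd = ((H.scale)⁻¹ • halfLine).restrict (Set.Ici b') := by
    rw [hγ₀, Measure.map_map measurable_snd hm, ← halfLine_map_affine _ _ (scale_inv_ne_zero hH)]
    rfl
  have h0 : γ₀ (Prod.map (halfIdx G.card) (halfIdx H.card) ⁻¹' {(none, none)})ᶜ = 0 := by
    have hset : Prod.map (halfIdx G.card) (halfIdx H.card) ⁻¹' {(none, none)} =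
        Set.Ici (G.card : ℝ≥0) ×ˢ Set.Ici (H.card : ℝ≥0) := by
      ext z; simp [Prod.ext_iff, halfIdx_eq_none, Prod.le_def]
    rw [hset, hγ₀, Measure.map_apply hm (measurableSet_Ici.prod measurableSet_Ici).compl]
    refine measure_mono_null (t := ∅) (fun x hx => hx ?_) measure_empty
    exact ⟨hb.trans (le_add_of_nonneg_right zero_le), hb'.trans (le_add_of_nonneg_right zero_le)⟩
  have p₁ := isProbabilityMeasure_tailFamily G hG ν hνp
  have p₂ := isProbabilityMeasure_tailFamily H hH ν' hνp'
  have e₁ := sum_tailFamily G hG ν hb (rows τ) hτ.rows_some hν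
  have e₂ := sum_tailFamily H hH ν' hb' (cols τ) hτ.cols_some hν'
  rw [← h₁] at e₁
  rw [← h₂] at e₂
  exact couplingDist_le_of_lift (𝒲 := G.stretched hG) (𝒲' := H.stretched hH)
    (stretched_isModel G hG) (stretched_isModel H hH) hτ.nonneg (tailFamily G ν)
    (tailFamily H ν') p₁ p₂ γ₀
    (fun e _ => ⟨tailFamily_compl G ν hν0 e.1, tailFamily_compl H ν' hν0' e.2⟩) h0 e₁ e₂ hbox

/-- A probability measure on the unit interval for each part of the canonical graphon. -/
def unitFamily (k : ℕ) : Option (Fin k) → Measure unitInterval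
  | none => volume
  | some i => ProbabilityTheory.cond volume (unitCell i)

theorem isProbabilityMeasure_unitFamily {k : ℕ} (i : Option (Fin k)) :
    IsProbabilityMeasure (unitFamily k i) := by
  rcases i with _ | i
  · exact inferInstanceAs (IsProbabilityMeasure (volume : Measure unitInterval))
  · exact isProbabilityMeasure_cond (inv_pos.2 (by exact_mod_cast i.pos)) (volume_unitCell i)

theorem sum_unitFamily {k : ℕ} (hk : 0 < k) (r : Option (Fin k) → ℝ)
    (hr : ∀ i, r (some i) = (k : ℝ)⁻¹) (h0 : r none = 0) :
    ∑ i, ENNReal.ofReal (r i) • unitFamily k i = volume := by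
  rw [Fintype.sum_option]
  simp only [hr, h0, unitFamily, ENNReal.ofReal_zero, zero_smul, zero_add]
  simp only [smul_cond_eq_restrict (inv_pos.2 (by exact_mod_cast hk)) (volume_unitCell _)]
  rw [sum_restrict_cells _ _ unitCell_meas disjoint_unitCell, iUnion_unitCell hk,
    Measure.restrict_univ]

theorem rescaledCutDist_le (G H : FinGraph) (hG : 0 < G.card) (hH : 0 < H.card)
    {τ : Option (Fin G.card) × Option (Fin H.card) → ℝ}
    (hτ : IsTransport τ (G.card : ℝ)⁻¹ (H.card : ℝ)⁻¹) (hl : ∀ j, τ (none, j) = 0)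
    (hr : ∀ i, τ (i, none) = 0) {ε : ℝ}
    (hbox : BoxBound (diffMat (fun e e' => G.density⁻¹ * G.adjO e e')
      (fun e e' => H.density⁻¹ * H.adjO e e')) τ ε) :
    rescaledCutDist G.canonical H.canonical ≤ ENNReal.ofReal ε := by
  have p₁ := isProbabilityMeasure_unitFamily (k := G.card)
  have p₂ := isProbabilityMeasure_unitFamily (k := H.card)
  have e₁ := sum_unitFamily hG (rows τ) hτ.rows_some (Finset.sum_eq_zero fun j _ => hl j)
  have e₂ := sum_unitFamily hH (cols τ) hτ.cols_some (Finset.sum_eq_zero fun j _ => hr j)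
  rw [← add_zero (Finset.sum _ _), ← Measure.map_zero (Prod.fst : unitInterval × unitInterval → _)]
    at e₁
  rw [← add_zero (Finset.sum _ _), ← Measure.map_zero (Prod.snd : unitInterval × unitInterval → _)]
    at e₂
  have key : ∀ {k : ℕ} (i : Option (Fin k)), i ≠ none →
      unitFamily k i (unitIdx k ⁻¹' {i})ᶜ = 0 := fun {k} i hi => by
    rcases i with _ | i
    · exact absurd rfl hi
    · rw [unitIdx_preimage_some]; exact cond_compl_eq_zero _ (unitCell_meas i)
  refine couplingDist_le_of_lift (𝒲 := G.canonical.rescale) (𝒲' := H.canonical.rescale)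
    (rescaled_isModel G) (rescaled_isModel H) hτ.nonneg (unitFamily G.card)
    (unitFamily H.card) p₁ p₂ 0 (fun e he => ⟨key _ ?_, key _ ?_⟩) (by simp) e₁ e₂ hbox
  · intro h; exact he (by rw [← hl e.2, ← h])
  · intro h; exact he (by rw [← hr e.1, ← h])

theorem exists_transport_of_stretchedCutDist_lt (G H : FinGraph) (hG : 0 < G.deg2)
    (hH : 0 < H.deg2) {ε : ℝ} (hε : 0 ≤ ε)
    (h : stretchedCutDist G.halfLineGraphon H.halfLineGraphon < ENNReal.ofReal ε) :
    ∃ τ : Option (Fin G.card) × Option (Fin H.card) → ℝ,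
      IsTransport τ (√G.deg2)⁻¹ (√H.deg2)⁻¹ ∧ BoxBound (diffMat G.adjO H.adjO) τ ε := by
  rw [stretchedCutDist_eq G H hG hH] at h
  exact exists_transport_of_couplingDist_lt (stretched_isModel G hG) (stretched_isModel H hH) hε h

theorem exists_transport_of_rescaledCutDist_lt (G H : FinGraph) {ε : ℝ} (hε : 0 ≤ ε)
    (h : rescaledCutDist G.canonical H.canonical < ENNReal.ofReal ε) :
    ∃ τ : Option (Fin G.card) × Option (Fin H.card) → ℝ,
      IsTransport τ (G.card : ℝ)⁻¹ (H.card : ℝ)⁻¹ ∧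
      BoxBound (diffMat (fun e e' => G.density⁻¹ * G.adjO e e')
        (fun e e' => H.density⁻¹ * H.adjO e e')) τ ε :=
  exists_transport_of_couplingDist_lt (rescaled_isModel G) (rescaled_isModel H) hε h

/-! ### Comparison of the two metrics -/

theorem bil_adjO (G : FinGraph) (x y : Option (Fin G.card) → ℝ) :
    bil G.adjO x y = bil G.adjR (fun i => x (some i)) (fun i => y (some i)) := by
  simp [bil, Fintype.sum_option]

theorem FinGraph.abs_adjR_le_one (G : FinGraph) (i j) : |G.adjR i j| ≤ 1 := by
  rw [abs_of_nonneg (G.adjR_nonneg i j)]; exact G.adjR_le_one i j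

theorem abs_diffMat_adjO_le (G H : FinGraph) (e e' : Option (Fin G.card) × Option (Fin H.card)) :
    |diffMat G.adjO H.adjO e e'| ≤ 1 := by
  have h1 := G.adjO_nonneg e.1 e'.1
  have h2 := H.adjO_nonneg e.2 e'.2
  have h3 := (abs_le.1 (G.abs_adjO_le_one e.1 e'.1)).2
  have h4 := (abs_le.1 (H.abs_adjO_le_one e.2 e'.2)).2
  rw [diffMat, abs_le]
  constructor <;> linarith

/-- This is the dictionary between the two metrics: the weight of a vertex in the stretched graphon
is its weight in the canonical graphon times `ρ^(-1/2)`. -/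
theorem inv_sqrt_deg2 (G : FinGraph) (h : 0 < G.density) :
    (√G.deg2)⁻¹ = (√G.density)⁻¹ / G.card := by
  have hk := G.card_pos_of_density_pos h
  have : G.deg2 = G.density * (G.card : ℝ) ^ 2 := by
    rw [G.density_eq]; field_simp
  rw [this, Real.sqrt_mul h.le, Real.sqrt_sq hk.le, mul_inv, div_eq_mul_inv]

/-- Splitting a vector bounded by `s + t` into vectors bounded by `s` and `t`. -/
theorem exists_split {α : Type*} {u s t : α → ℝ} (hu : ∀ i, 0 ≤ u i) (hs : ∀ i, 0 ≤ s i)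
    (ht : ∀ i, 0 ≤ t i) (h : ∀ i, u i ≤ s i + t i) :
    ∃ u₀ u₁ : α → ℝ, (∀ i, 0 ≤ u₀ i) ∧ (∀ i, u₀ i ≤ s i) ∧ (∀ i, 0 ≤ u₁ i) ∧
      (∀ i, u₁ i ≤ t i) ∧ u = fun i => u₀ i + u₁ i := by
  refine ⟨fun i => min (u i) (s i), fun i => u i - min (u i) (s i), fun i => le_min (hu i) (hs i),
    fun i => min_le_right _ _, fun i => sub_nonneg.2 (min_le_left _ _), fun i => ?_, ?_⟩
  · rcases le_total (u i) (s i) with h' | h'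
    · simp [min_eq_left h', ht i]
    · simp only [min_eq_right h']; linarith [h i]
  · funext i; ring

/-- The rows over vertices have known sums; the row of index `none` is charged to the columns. -/
theorem sum_transport_le {α β : Type*} [Fintype α] [Fintype β] {τ : Option α × Option β → ℝ}
    {w w' : ℝ} (h : IsTransport τ w w') :
    ∑ e, τ e ≤ Fintype.card α * w + Fintype.card β * w' := by
  rw [← sum_rows, Fintype.sum_option]
  have h1 : ∑ i : α, rows τ (some i) = Fintype.card α * w := by
    simp [h.rows_some]
  have h2 : rows τ none ≤ ∑ j : β, cols τ (some j) := by
    rw [rows, Fintype.sum_option, h.none_none, zero_add]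
    exact Finset.sum_le_sum fun j _ =>
      Finset.single_le_sum (f := fun i => τ (i, some j)) (fun _ _ => h.nonneg _)
        (Finset.mem_univ none)
  have h3 : ∑ j : β, cols τ (some j) = Fintype.card β * w' := by
    simp [h.cols_some]
  linarith

theorem abs_bil_adjO_cols_le (G H : FinGraph) {m : ℝ}
    {τ u v : Option (Fin G.card) × Option (Fin H.card) → ℝ} (hτ : ∑ e, τ e ≤ m)
    (hu : ∀ e, 0 ≤ u e) (huτ : ∀ e, u e ≤ τ e) (hv : ∀ e, 0 ≤ v e) (hvτ : ∀ e, v e ≤ τ e) :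
    |bil (fun e e' : Option (Fin G.card) × Option (Fin H.card) => H.adjO e.2 e'.2) u v| ≤ m * m := by
  have h1 : ∑ e, u e ≤ m := (Finset.sum_le_sum fun e _ => huτ e).trans hτ
  have h2 : ∑ e, v e ≤ m := (Finset.sum_le_sum fun e _ => hvτ e).trans hτ
  have h3 : 0 ≤ ∑ e, v e := Finset.sum_nonneg fun e _ => hv e
  have h4 : 0 ≤ ∑ e, u e := Finset.sum_nonneg fun e _ => hu e
  exact (abs_bil_le _ (fun _ _ => H.abs_adjO_le_one _ _) u v hu hv).trans
    (mul_le_mul h1 h2 h3 (h4.trans h1))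

/-- This is `p f - q g = p (f - g) + (p - q) g`: a common normalization costs `|p - q|` times the
square of the total mass. -/
theorem bil_diffMat_eq (G H : FinGraph) (p q : ℝ)
    (u v : Option (Fin G.card) × Option (Fin H.card) → ℝ) :
    bil (diffMat (fun e e' => p * G.adjO e e') (fun e e' => q * H.adjO e e')) u v =
      p * bil (diffMat G.adjO H.adjO) u v + (p - q) *
        bil (fun e e' : Option (Fin G.card) × Option (Fin H.card) => H.adjO e.2 e'.2) u v := by
  rw [← bil_smul_fun, ← bil_smul_fun, ← bil_add_fun]
  congr 1
  funext e e'
  simp only [diffMat]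
  ring

/-- A difference of squares, which converts errors in the stretch factors into errors in the inverse
densities. -/
theorem mul_abs_sub_inv_sqrt {p q : ℝ} (hp : 0 < p) (hq : 0 < q) :
    ((√p)⁻¹ + (√q)⁻¹) * |(√p)⁻¹ - (√q)⁻¹| = |p⁻¹ - q⁻¹| := by
  have h1 : (√p)⁻¹ ^ 2 = p⁻¹ := by rw [inv_pow, Real.sq_sqrt hp.le]
  have h2 : (√q)⁻¹ ^ 2 = q⁻¹ := by rw [inv_pow, Real.sq_sqrt hq.le]
  rw [← h1, ← h2, sq_sub_sq, abs_mul, abs_of_pos (by positivity : 0 < (√p)⁻¹ + (√q)⁻¹)]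

/-- With stretch factors `a` and `b`, the matrix is multiplied by `c = min a b`; the missing mass of
the side with the larger factor is coupled with the zero region of the other. In the constant `8`, a
part `4` pays for the change of normalization and a part `4` for the surplus mass. -/
theorem stretchedCutDist_le_of_rescaledCutDist_lt (G H : FinGraph) (hG : 0 < G.density)
    (hH : 0 < H.density) {ε : ℝ} (hε : 0 ≤ ε)
    (h : rescaledCutDist G.canonical H.canonical < ENNReal.ofReal ε) :
    stretchedCutDist G.halfLineGraphon H.halfLineGraphon ≤
      ENNReal.ofReal (ε + 8 * |G.density⁻¹ - H.density⁻¹|) := by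
  obtain ⟨τ, hτ, hbox⟩ := exists_transport_of_rescaledCutDist_lt G H hε h
  have hk := G.card_pos_of_density_pos hG
  have hl := H.card_pos_of_density_pos hH
  set a : ℝ := (√G.density)⁻¹ with ha
  set b : ℝ := (√H.density)⁻¹ with hb
  have ha0 : 0 < a := by positivity
  have hb0 : 0 < b := by positivity
  set c : ℝ := min a b with hc
  have hc0 : 0 < c := lt_min ha0 hb0
  have hca : c ≤ a := min_le_left _ _
  have hcb : c ≤ b := min_le_right _ _
  have hsum : (a - c) + (b - c) = |a - b| := by
    rcases le_total a b with h | h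
    · rw [hc, min_eq_left h, abs_of_nonpos (by linarith)]; ring
    · rw [hc, min_eq_right h, abs_of_nonneg (by linarith)]; ring
  -- The bound is `2` and not `1` because the general extraction does not record that the index
  -- `none` has no mass here.
  have hmass : ∑ e, τ e ≤ 2 := by
    refine (sum_transport_le hτ).trans_eq ?_
    simp only [Fintype.card_fin]
    field_simp
    norm_num
  set R : Option (Fin G.card) × Option (Fin H.card) → ℝ := fun e =>
    match e with
    | (some _, none) => (a - c) / G.card
    | (none, some _) => (b - c) / H.card
    | _ => 0 with hR
  have hR0 : ∀ e, 0 ≤ R e := by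
    rintro ⟨_ | i, _ | j⟩ <;> simp only [hR] <;>
      first
      | exact le_rfl
      | exact div_nonneg (sub_nonneg.2 hca) hk.le
      | exact div_nonneg (sub_nonneg.2 hcb) hl.le
  have hRsum : ∑ e, R e = |a - b| := by
    rw [Fintype.sum_prod_type, Fintype.sum_option]
    simp only [Fintype.sum_option, hR, Finset.sum_const_zero, add_zero, zero_add,
      Finset.sum_const, Finset.card_univ, Fintype.card_fin, nsmul_eq_mul]
    rw [← hsum]
    field_simp
    ring
  have hboxD : BoxBound (diffMat G.adjO H.adjO) τ
      (G.density * (ε + 4 * |G.density⁻¹ - H.density⁻¹|)) := by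
    intro u v hu huτ hv hvτ
    have h1 := hbox u v hu huτ hv hvτ
    have h2 := abs_bil_adjO_cols_le G H hmass hu huτ hv hvτ
    rw [bil_diffMat_eq] at h1
    set X := bil (diffMat G.adjO H.adjO) u v
    set Y := bil (fun e e' : Option (Fin G.card) × Option (Fin H.card) => H.adjO e.2 e'.2) u v
    have h3 : X = G.density * ((G.density⁻¹ * X + (G.density⁻¹ - H.density⁻¹) * Y) -
      (G.density⁻¹ - H.density⁻¹) * Y) := by field_simp; ring
    rw [h3, abs_mul, abs_of_pos hG]
    refine mul_le_mul_of_nonneg_left ((abs_sub _ _).trans (add_le_add h1 ?_)) hG.le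
    rw [abs_mul, mul_comm]
    exact mul_le_mul_of_nonneg_right (h2.trans (by norm_num)) (abs_nonneg _)
  have hboxc := hboxD.smul hc0
  refine stretchedCutDist_le G H (G.deg2_pos_of_density_pos hG) (H.deg2_pos_of_density_pos hH)
    (τ := fun e => c * τ e + R e) ⟨fun e => ?_, ?_, fun i => ?_, fun j => ?_⟩ ?_
  · exact add_nonneg (mul_nonneg hc0.le (hτ.nonneg e)) (hR0 e)
  · simp [hR, hτ.none_none]
  · rw [inv_sqrt_deg2 G hG, rows_add]
    have h1 : rows (fun e => c * τ e) (some i) = c * (G.card : ℝ)⁻¹ := by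
      rw [← hτ.rows_some i, rows, rows, Finset.mul_sum]
    have h2 : rows R (some i) = (a - c) / G.card := by
      rw [rows, Fintype.sum_option]; simp [hR]
    rw [h1, h2]; ring
  · rw [inv_sqrt_deg2 H hH, cols_add]
    have h1 : cols (fun e => c * τ e) (some j) = c * (H.card : ℝ)⁻¹ := by
      rw [← hτ.cols_some j, cols, cols, Finset.mul_sum]
    have h2 : cols R (some j) = (b - c) / H.card := by
      rw [cols, Fintype.sum_option]; simp [hR]
    rw [h1, h2]; ring
  · intro u v hu huτ hv hvτ
    have hcτ : ∀ e, 0 ≤ c * τ e := fun e => mul_nonneg hc0.le (hτ.nonneg e)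
    obtain ⟨u₀, u₁, hu₀, hu₀τ, hu₁, hu₁R, rfl⟩ := exists_split hu hcτ hR0 huτ
    obtain ⟨v₀, v₁, hv₀, hv₀τ, hv₁, hv₁R, rfl⟩ := exists_split hv hcτ hR0 hvτ
    have hm0 : ∀ x : Option (Fin G.card) × Option (Fin H.card) → ℝ, (∀ e, x e ≤ c * τ e) →
        ∑ e, x e ≤ 2 * c := fun x hx => by
      refine (Finset.sum_le_sum fun e _ => hx e).trans ?_
      rw [← Finset.mul_sum]
      nlinarith
    have hm1 : ∀ x : Option (Fin G.card) × Option (Fin H.card) → ℝ, (∀ e, x e ≤ R e) →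
        ∑ e, x e ≤ |a - b| := fun x hx => (Finset.sum_le_sum fun e _ => hx e).trans_eq hRsum
    have hvsum : ∑ e, (v₀ e + v₁ e) ≤ 2 * (a + b) := by
      rw [Finset.sum_add_distrib]
      linarith [hm0 v₀ hv₀τ, hm1 v₁ hv₁R]
    have husum : ∑ e, u₀ e ≤ 2 * (a + b) := by linarith [hm0 u₀ hu₀τ]
    have e1 := hboxc u₀ v₀ hu₀ hu₀τ hv₀ hv₀τ
    have e2 : |bil (diffMat G.adjO H.adjO) u₁ (fun e => v₀ e + v₁ e)| ≤ |a - b| * (2 * (a + b)) :=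
      (abs_bil_le _ (abs_diffMat_adjO_le G H) _ _ hu₁ hv).trans
        (mul_le_mul (hm1 u₁ hu₁R) hvsum (Finset.sum_nonneg fun e _ => hv e) (abs_nonneg _))
    have e3 : |bil (diffMat G.adjO H.adjO) u₀ v₁| ≤ (2 * (a + b)) * |a - b| :=
      (abs_bil_le _ (abs_diffMat_adjO_le G H) _ _ hu₀ hv₁).trans
        (mul_le_mul husum (hm1 v₁ hv₁R) (Finset.sum_nonneg fun e _ => hv₁ e) (by positivity))
    have hdec : bil (diffMat G.adjO H.adjO) (fun e => u₀ e + u₁ e) (fun e => v₀ e + v₁ e) =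
        bil (diffMat G.adjO H.adjO) u₀ v₀ + bil (diffMat G.adjO H.adjO) u₀ v₁ +
          bil (diffMat G.adjO H.adjO) u₁ (fun e => v₀ e + v₁ e) := by
      rw [bil_add_left, bil_add_right]
    -- Scaling the box by `c` multiplies the form by `c ^ 2`, and this absorbs the factor `ρ` in
    -- `hboxD` because `c ≤ a = ρ^(-1/2)`.
    have hcρ : c ^ 2 * G.density ≤ 1 := by
      have : a ^ 2 * G.density = 1 := by
        rw [ha, inv_pow, Real.sq_sqrt hG.le, inv_mul_cancel₀ hG.ne']
      rw [← this]
      exact mul_le_mul_of_nonneg_right (pow_le_pow_left₀ hc0.le hca 2) hG.le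
    have hab := mul_abs_sub_inv_sqrt hG hH
    rw [← ha, ← hb] at hab
    have e1' : |bil (diffMat G.adjO H.adjO) u₀ v₀| ≤ ε + 4 * |G.density⁻¹ - H.density⁻¹| := by
      refine e1.trans ?_
      rw [← mul_assoc]
      exact mul_le_of_le_one_left (by positivity) hcρ
    rw [hdec]
    refine (abs_add_three _ _ _).trans ?_
    nlinarith

/-- Here mass coupled with a zero region must be brought back. With `M = max a b`, all vertices are
raised to weight `M/k` or `M/l`, and everything not matched vertex to vertex is coupled by a
product. Test vectors of the new matrix are compared with test vectors of the old one through their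
marginals. In the constant `3`, a part `2` comes from the raised weights and a part `1` from the
change of normalization. -/
theorem rescaledCutDist_le_of_stretchedCutDist_lt (G H : FinGraph) (hG : 0 < G.density)
    (hH : 0 < H.density) {ε : ℝ} (hε : 0 ≤ ε)
    (h : stretchedCutDist G.halfLineGraphon H.halfLineGraphon < ENNReal.ofReal ε) :
    rescaledCutDist G.canonical H.canonical ≤
      ENNReal.ofReal (ε + 3 * |G.density⁻¹ - H.density⁻¹|) := by
  obtain ⟨τ, hτ, hbox⟩ := exists_transport_of_stretchedCutDist_lt G H
    (G.deg2_pos_of_density_pos hG) (H.deg2_pos_of_density_pos hH) hε h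
  have hk := G.card_pos_of_density_pos hG
  have hl := H.card_pos_of_density_pos hH
  rw [inv_sqrt_deg2 G hG, inv_sqrt_deg2 H hH] at hτ
  have hab := mul_abs_sub_inv_sqrt hG hH
  have haρ : (√G.density)⁻¹ ^ 2 * G.density = 1 := by
    rw [inv_pow, Real.sq_sqrt hG.le, inv_mul_cancel₀ hG.ne']
  have ha0 : 0 < (√G.density)⁻¹ := by positivity
  have hb0 : 0 < (√H.density)⁻¹ := by positivity
  generalize (√G.density)⁻¹ = a at *
  generalize (√H.density)⁻¹ = b at *
  obtain ⟨M, hM⟩ : ∃ M, M = max a b := ⟨_, rfl⟩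
  have hMa : a ≤ M := hM ▸ le_max_left _ _
  have hMb : b ≤ M := hM ▸ le_max_right _ _
  have hMab : M ≤ a + b := by rw [hM]; exact max_le (by linarith) (by linarith)
  have hM0 : 0 < M := ha0.trans_le hMa
  have hsum : (M - a) + (M - b) = |a - b| := by
    rcases le_total a b with h | h
    · rw [hM, max_eq_right h, abs_of_nonpos (by linarith)]; ring
    · rw [hM, max_eq_left h, abs_of_nonneg (by linarith)]; ring
  set t : ℝ := ∑ i : Fin G.card, ∑ j : Fin H.card, τ (some i, some j) with ht
  -- The unmatched mass of a vertex: what was coupled with the zero region, plus what is added to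
  -- reach the weight `M/k`. The totals of `α` and `β` agree, so a product coupling of them exists.
  set α : Fin G.card → ℝ := fun i => τ (some i, none) + (M - a) / G.card with hα
  set β : Fin H.card → ℝ := fun j => τ (none, some j) + (M - b) / H.card with hβ
  have hα0 : ∀ i, 0 ≤ α i := fun i =>
    add_nonneg (hτ.nonneg _) (div_nonneg (sub_nonneg.2 hMa) hk.le)
  have hβ0 : ∀ i, 0 ≤ β i := fun i =>
    add_nonneg (hτ.nonneg _) (div_nonneg (sub_nonneg.2 hMb) hl.le)
  have hrow : ∀ i, ∑ j, τ (some i, some j) = M / G.card - α i := fun i => by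
    have := hτ.rows_some i
    rw [rows, Fintype.sum_option] at this
    simp only [hα]
    rw [sub_div]
    linarith
  have hcol : ∀ j, ∑ i, τ (some i, some j) = M / H.card - β j := fun j => by
    have := hτ.cols_some j
    rw [cols, Fintype.sum_option] at this
    simp only [hβ]
    rw [sub_div]
    linarith
  have hαsum : ∑ i, α i = M - t := by
    rw [ht]
    simp only [hrow]
    rw [Finset.sum_sub_distrib]
    simp only [Finset.sum_const, Finset.card_univ, Fintype.card_fin, nsmul_eq_mul]
    field_simp
    ring
  have hβsum : ∑ i, β i = M - t := by
    rw [ht, Finset.sum_comm]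
    simp only [hcol]
    rw [Finset.sum_sub_distrib]
    simp only [Finset.sum_const, Finset.card_univ, Fintype.card_fin, nsmul_eq_mul]
    field_simp
    ring
  have hr0 : 0 ≤ M - t := hαsum ▸ Finset.sum_nonneg fun i _ => hα0 i
  -- If `M - t = 0` the quotient is `0` by convention, and then `α` vanishes as well.
  have hαr : ∀ i, α i * (M - t) / (M - t) = α i := fun i => by
    by_cases hr : M - t = 0
    · rw [hr] at hαsum
      have := (Finset.sum_eq_zero_iff_of_nonneg fun i _ => hα0 i).1 hαsum i (Finset.mem_univ i)
      simp [this]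
    · field_simp
  have hβr : ∀ i, β i * (M - t) / (M - t) = β i := fun i => by
    by_cases hr : M - t = 0
    · rw [hr] at hβsum
      have := (Finset.sum_eq_zero_iff_of_nonneg fun i _ => hβ0 i).1 hβsum i (Finset.mem_univ i)
      simp [this]
    · field_simp
  -- the part of the new matrix taken from `τ`, and the rest
  set T : Option (Fin G.card) × Option (Fin H.card) → ℝ := fun e =>
    match e with
    | (some i, some j) => τ (some i, some j)
    | _ => 0 with hT
  set R : Option (Fin G.card) × Option (Fin H.card) → ℝ := fun e =>
    match e with
    | (some i, some j) => α i * β j / (M - t)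
    | _ => 0 with hR
  have hT0 : ∀ e, 0 ≤ T e := by
    rintro ⟨_ | i, _ | j⟩ <;> simp only [hT] <;> first | exact le_rfl | exact hτ.nonneg _
  have hR0 : ∀ e, 0 ≤ R e := by
    rintro ⟨_ | i, _ | j⟩ <;> simp only [hR] <;>
      first | exact le_rfl | exact div_nonneg (mul_nonneg (hα0 _) (hβ0 _)) hr0
  have hRrow : ∀ i, rows R (some i) = α i := fun i => by
    rw [rows, Fintype.sum_option]
    simp only [hR, zero_add]
    rw [← Finset.sum_div, ← Finset.mul_sum, hβsum, hαr]
  have hRcol : ∀ j, cols R (some j) = β j := fun j => by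
    rw [cols, Fintype.sum_option]
    simp only [hR, zero_add]
    rw [← Finset.sum_div, ← Finset.sum_mul, hαsum, mul_comm, hβr]
  have hTrow : ∀ i, rows T (some i) = M / G.card - α i := fun i => by
    rw [rows, Fintype.sum_option, ← hrow]
    simp only [hT, zero_add]
  have hTcol : ∀ j, cols T (some j) = M / H.card - β j := fun j => by
    rw [cols, Fintype.sum_option, ← hcol]
    simp only [hT, zero_add]
  -- The part of `u` below `R` is pushed back to the zero regions: its row sums are split into a
  -- piece below `τ (some i, none)` and an added piece `p i`, and columns likewise. The result `v`
  -- lies below the old matrix `τ` and has the marginals of `u` up to `p` and `q`.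
  have key : ∀ u : Option (Fin G.card) × Option (Fin H.card) → ℝ, (∀ e, 0 ≤ u e) →
      (∀ e, u e ≤ T e + R e) →
      ∃ (v : Option (Fin G.card) × Option (Fin H.card) → ℝ) (p : Fin G.card → ℝ)
        (q : Fin H.card → ℝ), (∀ e, 0 ≤ v e) ∧ (∀ e, v e ≤ τ e) ∧ (∀ i, 0 ≤ p i) ∧
        (∀ i, 0 ≤ q i) ∧ ∑ i, p i ≤ M - a ∧ ∑ j, q j ≤ M - b ∧
        (∀ i, rows u (some i) = rows v (some i) + p i) ∧
        (∀ j, cols u (some j) = cols v (some j) + q j) := by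
    intro u hu huTR
    obtain ⟨u₀, u₁, hu₀, hu₀T, hu₁, hu₁R, rfl⟩ := exists_split hu hT0 hR0 huTR
    obtain ⟨x, p, hx, hxτ, hp, hpa, hxp⟩ := exists_split (u := fun i => rows u₁ (some i))
      (s := fun i => τ (some i, none)) (t := fun _ => (M - a) / G.card)
      (fun i => rows_nonneg hu₁ _) (fun i => hτ.nonneg _)
      (fun i => div_nonneg (sub_nonneg.2 hMa) hk.le)
      (fun i => (rows_mono hu₁R (some i)).trans_eq (hRrow i))
    obtain ⟨y, q, hy, hyτ, hq, hqb, hyq⟩ := exists_split (u := fun j => cols u₁ (some j))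
      (s := fun j => τ (none, some j)) (t := fun _ => (M - b) / H.card)
      (fun i => cols_nonneg hu₁ _) (fun i => hτ.nonneg _)
      (fun i => div_nonneg (sub_nonneg.2 hMb) hl.le)
      (fun i => (cols_mono hu₁R (some i)).trans_eq (hRcol i))
    have hu₀none : ∀ i j, i = none ∨ j = none → u₀ (i, j) = 0 := by
      rintro i j hij
      refine le_antisymm ((hu₀T _).trans_eq ?_) (hu₀ _)
      rcases hij with rfl | rfl
      · rfl
      · cases i <;> rfl
    refine ⟨fun e => match e with
      | (some i, some j) => u₀ (some i, some j)
      | (some i, none) => x i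
      | (none, some j) => y j
      | (none, none) => 0, p, q, ?_, ?_, hp, hq, ?_, ?_, fun i => ?_, fun j => ?_⟩
    · rintro ⟨_ | i, _ | j⟩
      exacts [le_rfl, hy j, hx i, hu₀ _]
    · rintro ⟨_ | i, _ | j⟩
      exacts [hτ.nonneg _, hyτ j, hxτ i, hu₀T (some i, some j)]
    · refine (Finset.sum_le_sum fun i _ => hpa i).trans_eq ?_
      simp only [Finset.sum_const, Finset.card_univ, Fintype.card_fin, nsmul_eq_mul]
      field_simp
    · refine (Finset.sum_le_sum fun i _ => hqb i).trans_eq ?_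
      simp only [Finset.sum_const, Finset.card_univ, Fintype.card_fin, nsmul_eq_mul]
      field_simp
    · rw [rows_add, congrFun hxp i, rows, rows, Fintype.sum_option, Fintype.sum_option,
        hu₀none _ _ (Or.inr rfl)]
      ring
    · rw [cols_add, congrFun hyq j, cols, cols, Fintype.sum_option, Fintype.sum_option,
        hu₀none _ _ (Or.inl rfl)]
      ring
  have hcmp : ∀ (K : FinGraph) (d : ℝ) (x x' y y' p p' : Fin K.card → ℝ), (∀ i, 0 ≤ x' i) →
      (∀ i, 0 ≤ x i) → (∀ i, 0 ≤ y i) → (∀ i, 0 ≤ y' i) →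
      (∀ i, 0 ≤ p i) → (∀ i, 0 ≤ p' i) → (∀ i, x i = y i + p i) → (∀ i, x' i = y' i + p' i) →
      ∑ i, p i ≤ d → ∑ i, p' i ≤ d → ∑ i, x i ≤ M → ∑ i, x' i ≤ M →
      |bil K.adjR x x' - bil K.adjR y y'| ≤ 2 * M * d := by
    intro K d x x' y y' p p' hx' hx hy hy' hp hp' hxe hxe' hpd hpd' hxM hxM'
    have hd : 0 ≤ d := (Finset.sum_nonneg fun i _ => hp i).trans hpd
    have h1 : bil K.adjR x x' - bil K.adjR y y' = bil K.adjR p x' + bil K.adjR y p' := by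
      have h2 : bil K.adjR x x' = bil K.adjR y x' + bil K.adjR p x' := by
        rw [← bil_add_left]; congr 1; funext i; exact hxe i
      have h3 : bil K.adjR y x' = bil K.adjR y y' + bil K.adjR y p' := by
        rw [← bil_add_right]; congr 1; funext i; exact hxe' i
      rw [h2, h3]; ring
    have h2 := (abs_bil_le _ K.abs_adjR_le_one p x' hp hx').trans
      (mul_le_mul hpd hxM' (Finset.sum_nonneg fun i _ => hx' i) hd)
    have hyM : ∑ i, y i ≤ M :=
      (Finset.sum_le_sum fun i _ => by rw [hxe i]; linarith [hp i]).trans hxM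
    have h3 := (abs_bil_le _ K.abs_adjR_le_one y p' hy hp').trans
      (mul_le_mul hyM hpd' (Finset.sum_nonneg fun i _ => hp' i) hM0.le)
    rw [h1]
    refine (abs_add_le _ _).trans ?_
    linarith
  have hrowM : ∀ u : Option (Fin G.card) × Option (Fin H.card) → ℝ, (∀ e, u e ≤ T e + R e) →
      ∑ i, rows u (some i) ≤ M := fun u hu => by
    have : ∀ i, rows u (some i) ≤ M / G.card := fun i => by
      refine (rows_mono hu _).trans_eq ?_
      rw [rows_add, hTrow, hRrow]; ring
    refine (Finset.sum_le_sum fun i _ => this i).trans_eq ?_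
    simp only [Finset.sum_const, Finset.card_univ, Fintype.card_fin, nsmul_eq_mul]
    field_simp
  have hcolM : ∀ u : Option (Fin G.card) × Option (Fin H.card) → ℝ, (∀ e, u e ≤ T e + R e) →
      ∑ i, cols u (some i) ≤ M := fun u hu => by
    have : ∀ i, cols u (some i) ≤ M / H.card := fun i => by
      refine (cols_mono hu _).trans_eq ?_
      rw [cols_add, hTcol, hRcol]; ring
    refine (Finset.sum_le_sum fun i _ => this i).trans_eq ?_
    simp only [Finset.sum_const, Finset.card_univ, Fintype.card_fin, nsmul_eq_mul]
    field_simp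
  have hboxD : BoxBound (diffMat G.adjO H.adjO) (fun e => T e + R e)
      (ε + 2 * |G.density⁻¹ - H.density⁻¹|) := by
    intro u u' hu huT hu' huT'
    obtain ⟨v, p, q, hv, hvτ, hp, hq, hpa, hqb, hup, huq⟩ := key u hu huT
    obtain ⟨v', p', q', hv', hvτ', hp', hq', hpa', hqb', hup', huq'⟩ := key u' hu' huT'
    have h1 := hbox v v' hv hvτ hv' hvτ'
    rw [bil_diffMat, bil_adjO, bil_adjO] at h1 ⊢
    have h2 := hcmp G (M - a) _ _ _ _ p p' (fun i => rows_nonneg hu' (some i))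
      (fun i => rows_nonneg hu (some i)) (fun i => rows_nonneg hv (some i))
      (fun i => rows_nonneg hv' (some i)) hp hp' hup hup' hpa hpa' (hrowM u huT) (hrowM u' huT')
    have h3 := hcmp H (M - b) _ _ _ _ q q' (fun i => cols_nonneg hu' (some i))
      (fun i => cols_nonneg hu (some i)) (fun i => cols_nonneg hv (some i))
      (fun i => cols_nonneg hv' (some i)) hq hq' huq huq' hqb hqb' (hcolM u huT) (hcolM u' huT')
    have h4 : 2 * M * (M - a) + 2 * M * (M - b) ≤ 2 * |G.density⁻¹ - H.density⁻¹| := by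
      rw [← hab, ← mul_add, hsum]
      have := mul_le_mul_of_nonneg_right hMab (abs_nonneg (a - b))
      linarith
    rw [abs_le] at *
    constructor <;> linarith
  have hboxM := hboxD.smul (inv_pos.2 hM0)
  -- The new matrix has no mass at `none`, so its total is at most `1` and the change of
  -- normalization costs only one multiple of the difference.
  have hmass : ∑ e, M⁻¹ * (T e + R e) ≤ 1 := by
    rw [← Finset.mul_sum, inv_mul_le_iff₀ hM0, mul_one, ← sum_rows, Fintype.sum_option]
    have h0 : rows (fun e => T e + R e) none = 0 :=
      Finset.sum_eq_zero fun j _ => by simp [hT, hR]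
    rw [h0, zero_add]
    exact hrowM _ fun e => le_rfl
  refine rescaledCutDist_le G H (by exact_mod_cast hk) (by exact_mod_cast hl)
    (τ := fun e => M⁻¹ * (T e + R e)) ⟨fun e => ?_, ?_, fun i => ?_, fun j => ?_⟩ (fun j => ?_)
    (fun i => ?_) ?_
  · exact mul_nonneg (inv_nonneg.2 hM0.le) (add_nonneg (hT0 e) (hR0 e))
  · simp [hT, hR]
  · have : rows (fun e => M⁻¹ * (T e + R e)) (some i) = M⁻¹ * rows (fun e => T e + R e) (some i) := by
      rw [rows, rows, Finset.mul_sum]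
    rw [this, rows_add, hTrow, hRrow]
    field_simp
    ring
  · have : cols (fun e => M⁻¹ * (T e + R e)) (some j) = M⁻¹ * cols (fun e => T e + R e) (some j) := by
      rw [cols, cols, Finset.mul_sum]
    rw [this, cols_add, hTcol, hRcol]
    field_simp
    ring
  · simp [hT, hR]
  · cases i <;> simp [hT, hR]
  · intro u v hu huτ hv hvτ
    have h1 := hboxM u v hu huτ hv hvτ
    have h2 := abs_bil_adjO_cols_le G H hmass hu huτ hv hvτ
    rw [bil_diffMat_eq]
    refine (abs_add_le _ _).trans ?_
    rw [abs_mul, abs_mul, abs_of_pos (inv_pos.2 hG)]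
    have h3 : G.density⁻¹ * |bil (diffMat G.adjO H.adjO) u v| ≤
        ε + 2 * |G.density⁻¹ - H.density⁻¹| := by
      rw [inv_mul_le_iff₀ hG]
      refine h1.trans (mul_le_mul_of_nonneg_right ?_ (by positivity))
      rw [inv_pow, inv_le_iff_one_le_mul₀ (by positivity), ← haρ, mul_comm]
      exact mul_le_mul_of_nonneg_left (pow_le_pow_left₀ ha0.le hMa 2) hG.le
    have h4 := mul_le_mul_of_nonneg_left h2 (abs_nonneg (G.density⁻¹ - H.density⁻¹))
    linarith

/-! ### Cauchy sequences of graphs with convergent positive density -/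

theorem isCauchy_iff (d : ℕ → ℕ → ℝ≥0∞) :
    IsCauchy d ↔ ∀ ε : ℝ, 0 < ε → ∃ N, ∀ m ≥ N, ∀ n ≥ N, d m n < ENNReal.ofReal ε := by
  constructor
  · intro h ε hε
    exact h _ (by simpa using hε)
  · intro h ε hε
    rcases eq_or_ne ε ⊤ with rfl | htop
    · obtain ⟨N, hN⟩ := h 1 one_pos
      exact ⟨N, fun m hm n hn => (hN m hm n hn).trans ENNReal.ofReal_lt_top⟩
    · obtain ⟨N, hN⟩ := h ε.toReal (ENNReal.toReal_pos hε.ne' htop)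
      exact ⟨N, fun m hm n hn => by simpa [ENNReal.ofReal_toReal htop] using hN m hm n hn⟩

/-- In the application `r` is the inverse density, which converges because the density has a
positive limit. -/
theorem IsCauchy.of_le {d d' : ℕ → ℕ → ℝ≥0∞} {r : ℕ → ℝ} (hr : CauchySeq r) {c : ℝ} (hc : 0 < c)
    (h : IsCauchy d)
    (hle : ∃ N, ∀ m ≥ N, ∀ n ≥ N, ∀ ε : ℝ, 0 ≤ ε → d m n < ENNReal.ofReal ε →
      d' m n ≤ ENNReal.ofReal (ε + c * |r m - r n|)) : IsCauchy d' := by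
  rw [isCauchy_iff] at h ⊢
  intro ε hε
  obtain ⟨N₁, h₁⟩ := h (ε / 4) (by positivity)
  obtain ⟨N₂, h₂⟩ := Metric.cauchySeq_iff.1 hr (ε / (4 * c)) (by positivity)
  obtain ⟨N₃, h₃⟩ := hle
  refine ⟨max N₁ (max N₂ N₃), fun m hm n hn => ?_⟩
  have e1 := h₁ m (le_of_max_le_left hm) n (le_of_max_le_left hn)
  have e2 := h₂ m (le_of_max_le_left (le_of_max_le_right hm)) n
    (le_of_max_le_left (le_of_max_le_right hn))
  have e3 := h₃ m (le_of_max_le_right (le_of_max_le_right hm)) n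
    (le_of_max_le_right (le_of_max_le_right hn)) (ε / 4) (by positivity) e1
  refine e3.trans_lt ((ENNReal.ofReal_lt_ofReal_iff hε).2 ?_)
  rw [Real.dist_eq, lt_div_iff₀ (by positivity)] at e2
  linarith

theorem cauchyStretched_iff_cauchyRescaled (G : ℕ → FinGraph) (hD : Dense G)
    (hC : HasConvergentDensity G) : CauchyStretched G ↔ CauchyRescaled G := by
  obtain ⟨ρ, hρ⟩ := hC
  have hρ0 : 0 < ρ := by
    have := hρ.liminf_eq
    rw [Dense, this] at hD
    exact hD
  have hr : CauchySeq fun n => (G n).density⁻¹ := (hρ.inv₀ hρ0.ne').cauchySeq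
  obtain ⟨N, hN⟩ := eventually_atTop.1 (hρ.eventually (lt_mem_nhds hρ0))
  constructor
  · intro h
    exact h.of_le hr (by norm_num : (0 : ℝ) < 3) ⟨N, fun m hm n hn ε hε hlt =>
      rescaledCutDist_le_of_stretchedCutDist_lt _ _ (hN m hm) (hN n hn) hε hlt⟩
  · intro h
    exact h.of_le hr (by norm_num : (0 : ℝ) < 8) ⟨N, fun m hm n hn ε hε hlt =>
      stretchedCutDist_le_of_rescaledCutDist_lt _ _ (hN m hm) (hN n hn) hε hlt⟩

/-! ### Quasirandom graphs -/

/-- The graph is within `ε` of the constant `p` in the (normalized) cut norm. -/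
def IsQuasirandom (G : FinGraph) (p ε : ℝ) : Prop :=
  BoxBound (fun i j => G.adjR i j - p) (fun _ => (G.card : ℝ)⁻¹) ε

theorem bil_adjR_eq (G : FinGraph) (p : ℝ) (x y : Fin G.card → ℝ) :
    bil G.adjR x y = bil (fun i j => G.adjR i j - p) x y + p * ((∑ i, x i) * ∑ j, y j) := by
  rw [← bil_const, ← bil_add_fun]
  simp

/-- On the full vector of the box the form of the adjacency matrix is the density and the constant
contributes `p`. -/
theorem IsQuasirandom.abs_density_sub_le {G : FinGraph} {p ε : ℝ} (h : IsQuasirandom G p ε)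
    (hk : 0 < G.card) : |G.density - p| ≤ ε := by
  have hk' : (0 : ℝ) < G.card := by exact_mod_cast hk
  have h1 := h (fun _ => (G.card : ℝ)⁻¹) (fun _ => (G.card : ℝ)⁻¹) (fun _ => by positivity)
    (fun _ => le_rfl) (fun _ => by positivity) (fun _ => le_rfl)
  have h2 := bil_adjR_eq G p (fun _ => (G.card : ℝ)⁻¹) (fun _ => (G.card : ℝ)⁻¹)
  have h3 : bil G.adjR (fun _ => (G.card : ℝ)⁻¹) (fun _ => (G.card : ℝ)⁻¹) = G.density := by
    rw [G.density_eq, FinGraph.deg2, bil, Finset.sum_div]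
    refine Finset.sum_congr rfl fun i _ => ?_
    rw [Finset.sum_div]
    refine Finset.sum_congr rfl fun j _ => ?_
    field_simp
  have h4 : ∑ _i : Fin G.card, (G.card : ℝ)⁻¹ = 1 := by
    simp only [Finset.sum_const, Finset.card_univ, Fintype.card_fin, nsmul_eq_mul]
    field_simp
  rw [h3, h4] at h2
  rw [h2]
  convert h1 using 2
  ring

/-- Both rescaled graphons are close to the constant `1`, whatever `p` and `q` are, so the product
coupling works: both forms are near the product of the total masses of the test vectors. One `ε`
accounts for quasirandomness, the other for replacing `p` by the density. -/
theorem rescaledCutDist_le_of_isQuasirandom {G H : FinGraph} {p q ε ε' : ℝ}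
    (hG : IsQuasirandom G p ε) (hH : IsQuasirandom H q ε') (hρ : 0 < G.density)
    (hρ' : 0 < H.density) :
    rescaledCutDist G.canonical H.canonical ≤
      ENNReal.ofReal (2 * ε / G.density + 2 * ε' / H.density) := by
  have hk := G.card_pos_of_density_pos hρ
  have hl := H.card_pos_of_density_pos hρ'
  set τ : Option (Fin G.card) × Option (Fin H.card) → ℝ := fun e =>
    match e with
    | (some _, some _) => (G.card : ℝ)⁻¹ * (H.card : ℝ)⁻¹
    | _ => 0 with hτ
  have hrow : ∀ i, rows τ (some i) = (G.card : ℝ)⁻¹ := fun i => by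
    rw [rows, Fintype.sum_option]
    simp only [hτ, Finset.sum_const, Finset.card_univ, Fintype.card_fin, nsmul_eq_mul, zero_add]
    field_simp
  have hcol : ∀ j, cols τ (some j) = (H.card : ℝ)⁻¹ := fun j => by
    rw [cols, Fintype.sum_option]
    simp only [hτ, Finset.sum_const, Finset.card_univ, Fintype.card_fin, nsmul_eq_mul, zero_add]
    field_simp
  have hone : ∀ (K : FinGraph) (_ : 0 < K.density) (p ε : ℝ) (_ : IsQuasirandom K p ε)
      (x y : Fin K.card → ℝ), (∀ i, 0 ≤ x i) → (∀ i, x i ≤ (K.card : ℝ)⁻¹) → (∀ i, 0 ≤ y i) →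
      (∀ i, y i ≤ (K.card : ℝ)⁻¹) →
      |K.density⁻¹ * bil K.adjR x y - (∑ i, x i) * ∑ i, y i| ≤ 2 * ε / K.density := by
    intro K hK p ε hq x y hx hxk hy hyk
    have hkc : (0 : ℝ) < K.card := K.card_pos_of_density_pos hK
    have h1 := hq x y hx hxk hy hyk
    have h2 := hq.abs_density_sub_le (by exact_mod_cast hkc)
    have hs : ∀ z : Fin K.card → ℝ, (∀ i, z i ≤ (K.card : ℝ)⁻¹) → ∑ i, z i ≤ 1 := fun z hz => by
      refine (Finset.sum_le_sum fun i _ => hz i).trans_eq ?_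
      simp only [Finset.sum_const, Finset.card_univ, Fintype.card_fin, nsmul_eq_mul]
      field_simp
    have hX0 : 0 ≤ ∑ i, x i := Finset.sum_nonneg fun i _ => hx i
    have hY0 : 0 ≤ ∑ i, y i := Finset.sum_nonneg fun i _ => hy i
    have hXY : (∑ i, x i) * ∑ i, y i ≤ 1 := mul_le_one₀ (hs x hxk) hY0 (hs y hyk)
    have hXY0 : 0 ≤ (∑ i, x i) * ∑ i, y i := mul_nonneg hX0 hY0
    rw [bil_adjR_eq K p]
    generalize (∑ i, x i) * ∑ i, y i = Z at *
    generalize bil (fun i j => K.adjR i j - p) x y = B at *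
    have h3 : K.density⁻¹ * (B + p * Z) - Z = (B - (K.density - p) * Z) / K.density := by
      field_simp
      ring
    rw [h3, abs_div, abs_of_pos hK]
    refine div_le_div_of_nonneg_right ((abs_sub _ _).trans ?_) hK.le
    rw [abs_mul, abs_of_nonneg hXY0]
    have := mul_le_of_le_one_right (abs_nonneg (K.density - p)) hXY
    linarith
  refine rescaledCutDist_le G H (by exact_mod_cast hk) (by exact_mod_cast hl) (τ := τ)
    ⟨?_, rfl, hrow, hcol⟩ (fun j => rfl) (fun i => by cases i <;> rfl) ?_
  · rintro ⟨_ | i, _ | j⟩ <;> simp only [hτ] <;> positivity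
  · intro u v hu huτ hv hvτ
    have hrs : ∀ x : Option (Fin G.card) × Option (Fin H.card) → ℝ, (∀ e, 0 ≤ x e) →
        (∀ e, x e ≤ τ e) → ∑ i, rows x (some i) = ∑ j, cols x (some j) := by
      intro x hx hxτ
      have h1 := (sum_rows x).trans (sum_cols x).symm
      rw [Fintype.sum_option, Fintype.sum_option] at h1
      have h2 : rows x none = 0 := Finset.sum_eq_zero fun j _ =>
        le_antisymm (hxτ (none, j)) (hx _)
      have h3 : cols x none = 0 := Finset.sum_eq_zero fun i _ =>
        le_antisymm ((hxτ (i, none)).trans_eq (by cases i <;> rfl)) (hx _)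
      rwa [h2, h3, zero_add, zero_add] at h1
    rw [bil_diffMat, bil_smul_fun, bil_smul_fun, bil_adjO, bil_adjO]
    have e1 := hone G hρ p ε hG (fun i => rows u (some i)) (fun i => rows v (some i))
      (fun i => rows_nonneg hu _) (fun i => (rows_mono huτ _).trans_eq (hrow i))
      (fun i => rows_nonneg hv _) (fun i => (rows_mono hvτ _).trans_eq (hrow i))
    have e2 := hone H hρ' q ε' hH (fun i => cols u (some i)) (fun i => cols v (some i))
      (fun i => cols_nonneg hu _) (fun i => (cols_mono huτ _).trans_eq (hcol i))
      (fun i => cols_nonneg hv _) (fun i => (cols_mono hvτ _).trans_eq (hcol i))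
    rw [hrs u hu huτ, hrs v hv hvτ] at e1
    rw [abs_le] at *
    constructor <;> linarith

/-- The mass over the vertices of `G` gives `G` the full value `1`. That mass is at most
`ρ(G)^(-1/2)`, close to `1`, so on the side of `H`, whose kernel is close to `1/2`, it gives at most
`8/15 + 1/7`. -/
theorem not_stretchedCutDist_lt_of_isQuasirandom {G H : FinGraph} {ε : ℝ} (hε : ε ≤ 1 / 16)
    (hG : IsQuasirandom G 1 ε) (hH : IsQuasirandom H (1 / 2) ε) (hk : 0 < G.card)
    (hl : 0 < H.card) :
    ¬ stretchedCutDist G.halfLineGraphon H.halfLineGraphon < ENNReal.ofReal (1 / 8) := by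
  intro h
  have h1 := hG.abs_density_sub_le hk
  have h2 := hH.abs_density_sub_le hl
  have hρ : 15 / 16 ≤ G.density := by linarith [(abs_le.1 h1).1]
  have hρ' : 7 / 16 ≤ H.density := by linarith [(abs_le.1 h2).1]
  have hρ0 : 0 < G.density := by linarith
  have hρ0' : 0 < H.density := by linarith
  have hd := G.deg2_pos_of_density_pos hρ0
  have hd' := H.deg2_pos_of_density_pos hρ0'
  obtain ⟨τ, hτ, hbox⟩ := exists_transport_of_stretchedCutDist_lt G H hd hd' (by norm_num) h
  -- The test vector takes all the mass over the vertices of `G` and nothing over its zero region.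
  set u : Option (Fin G.card) × Option (Fin H.card) → ℝ := fun e =>
    match e with
    | (some i, j) => τ (some i, j)
    | (none, _) => 0 with hu
  have hu0 : ∀ e, 0 ≤ u e := by
    rintro ⟨_ | i, j⟩
    exacts [le_rfl, hτ.nonneg _]
  have huτ : ∀ e, u e ≤ τ e := by
    rintro ⟨_ | i, j⟩
    exacts [hτ.nonneg _, le_rfl]
  have hb := hbox u u hu0 huτ hu0 huτ
  rw [bil_diffMat, bil_adjO, bil_adjO] at hb
  have hr : ∀ i, rows u (some i) = (√G.deg2)⁻¹ := fun i => hτ.rows_some i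
  have hc : ∀ j, cols u (some j) ≤ (√H.deg2)⁻¹ := fun j =>
    (cols_mono huτ _).trans_eq (hτ.cols_some j)
  have hGone : bil G.adjR (fun i => rows u (some i)) (fun i => rows u (some i)) = 1 := by
    simp only [hr, bil, ← Finset.mul_sum]
    change (√G.deg2)⁻¹ * (√G.deg2)⁻¹ * G.deg2 = 1
    rw [← mul_inv, Real.mul_self_sqrt hd.le, inv_mul_cancel₀ hd.ne']
  have hY : ∑ j, cols u (some j) ≤ (√G.density)⁻¹ := by
    calc ∑ j, cols u (some j) ≤ ∑ j, cols u j := by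
          rw [Fintype.sum_option]
          linarith [cols_nonneg hu0 none]
      _ = ∑ i, rows u i := by rw [sum_cols, sum_rows]
      _ = (√G.density)⁻¹ := by
          rw [Fintype.sum_option]
          have : rows u none = 0 := Finset.sum_eq_zero fun j _ => rfl
          have hk' : (0 : ℝ) < G.card := by exact_mod_cast hk
          rw [this, zero_add]
          simp only [hr, inv_sqrt_deg2 G hρ0, Finset.sum_const, Finset.card_univ,
            Fintype.card_fin, nsmul_eq_mul]
          field_simp
  have hY0 : 0 ≤ ∑ j, cols u (some j) := Finset.sum_nonneg fun j _ => cols_nonneg hu0 _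
  have hY2 : (∑ j, cols u (some j)) * ∑ j, cols u (some j) ≤ G.density⁻¹ := by
    refine (mul_le_mul hY hY hY0 (by positivity)).trans_eq ?_
    rw [← mul_inv, Real.mul_self_sqrt hρ0.le]
  have hb0 : 0 < (√H.density)⁻¹ := by positivity
  have hq := BoxBound.smul hb0 hH
  have hq' := hq (fun j => cols u (some j)) (fun j => cols u (some j))
    (fun j => cols_nonneg hu0 _) (fun j => (hc j).trans_eq (inv_sqrt_deg2 H hρ0'))
    (fun j => cols_nonneg hu0 _) (fun j => (hc j).trans_eq (inv_sqrt_deg2 H hρ0'))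
  rw [inv_pow, Real.sq_sqrt hρ0'.le] at hq'
  rw [hGone, bil_adjR_eq H (1 / 2)] at hb
  have hε' : H.density⁻¹ * ε ≤ 1 / 7 := by
    rw [inv_mul_le_iff₀ hρ0']; linarith
  have hinv : G.density⁻¹ ≤ 16 / 15 := by
    rw [inv_le_comm₀ hρ0 (by norm_num)]; linarith
  have e1 := (abs_le.1 hb).2
  have e2 := (abs_le.1 hq').2
  linarith

/-! ### Complete graphs with isolated vertices -/

/-- The complete graph on the first `a` of `k` vertices. -/
def cliqueGraph (a k : ℕ) : FinGraph :=
  ⟨k, { Adj := fun i j => i ≠ j ∧ (i : ℕ) < a ∧ (j : ℕ) < a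
        symm := ⟨fun _ _ h => ⟨h.1.symm, h.2.2, h.2.1⟩⟩
        loopless := ⟨fun _ h => h.1 rfl⟩ }⟩

open Classical in
theorem cliqueGraph_adjR (a k : ℕ) (i j : Fin (cliqueGraph a k).card) :
    (cliqueGraph a k).adjR i j = if i ≠ j ∧ (i : ℕ) < a ∧ (j : ℕ) < a then 1 else 0 := by
  exact if_congr Iff.rfl rfl rfl

/-- Only the diagonal differs from the constant `1`: it has `n` entries, each of weight at most `n⁻¹
* n⁻¹`. -/
theorem isQuasirandom_cliqueGraph (n : ℕ) (hn : 0 < n) :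
    IsQuasirandom (cliqueGraph n n) 1 (n : ℝ)⁻¹ := by
  classical
  have hn' : (0 : ℝ) < n := by exact_mod_cast hn
  intro u v hu hun hv hvn
  have h1 : bil (fun i j => (cliqueGraph n n).adjR i j - 1) u v = -∑ i, u i * v i := by
    rw [bil, ← Finset.sum_neg_distrib]
    refine Finset.sum_congr rfl fun i _ => ?_
    rw [Finset.sum_eq_single i]
    · simp [cliqueGraph_adjR]
    · intro j _ hj
      have : (cliqueGraph n n).adjR i j = 1 := by
        rw [cliqueGraph_adjR, if_pos ⟨hj.symm, i.2, j.2⟩]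
      simp [this]
    · simp
  rw [h1, abs_neg, abs_of_nonneg (Finset.sum_nonneg fun i _ => mul_nonneg (hu i) (hv i))]
  calc ∑ i, u i * v i ≤ ∑ _i : Fin n, (n : ℝ)⁻¹ * (n : ℝ)⁻¹ :=
        Finset.sum_le_sum fun i _ => mul_le_mul (hun i) (hvn i) (hv i) (by positivity)
    _ = (n : ℝ)⁻¹ := by
        simp only [Finset.sum_const, Finset.card_univ, Fintype.card_fin, nsmul_eq_mul]
        field_simp

/-- The right side does not involve `k`, which is how the isolated vertices disappear. -/
theorem cliqueGraph_adjO (a k : ℕ) (h : a ≤ k) (x y : ℝ≥0) :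
    (cliqueGraph a k).adjO (halfIdx k x) (halfIdx k y) =
      if ⌊x⌋₊ ≠ ⌊y⌋₊ ∧ ⌊x⌋₊ < a ∧ ⌊y⌋₊ < a then 1 else 0 := by
  classical
  by_cases hx : ⌊x⌋₊ < k
  · by_cases hy : ⌊y⌋₊ < k
    · have hx' : halfIdx k x = some ⟨⌊x⌋₊, hx⟩ := dif_pos hx
      have hy' : halfIdx k y = some ⟨⌊y⌋₊, hy⟩ := dif_pos hy
      rw [hx', hy']
      refine (cliqueGraph_adjR a k ⟨⌊x⌋₊, hx⟩ ⟨⌊y⌋₊, hy⟩).trans ?_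
      simp [cliqueGraph]
    · have hy' : halfIdx k y = none := dif_neg hy
      rw [hy', if_neg (by omega)]
      exact FinGraph.adjO_none_right _ _
  · have hx' : halfIdx k x = none := dif_neg hx
    rw [hx', if_neg (by omega)]
    rfl

/-- Isolated vertices do not change the graphon over the half line. -/
theorem cliqueGraph_halfLineGraphon (a k : ℕ) (h : a ≤ k) :
    (cliqueGraph a k).halfLineGraphon = (cliqueGraph a a).halfLineGraphon := by
  have : stepFun (cliqueGraph a k) (halfLineCell : Fin k → Set ℝ≥0) =
      stepFun (cliqueGraph a a) (halfLineCell : Fin a → Set ℝ≥0) := by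
    funext z
    refine (stepFun_eq (cliqueGraph a k) _ _ mem_halfLineCell z).trans ?_
    refine Eq.trans ?_ (stepFun_eq (cliqueGraph a a) _ _ mem_halfLineCell z).symm
    exact (cliqueGraph_adjO a k h z.1 z.2).trans (cliqueGraph_adjO a a le_rfl z.1 z.2).symm
  unfold FinGraph.halfLineGraphon
  congr 1

theorem cliqueGraph_deg2 (a k : ℕ) (h : a ≤ k) :
    (cliqueGraph a k).deg2 = (cliqueGraph a a).deg2 := by
  rw [← halfLineGraphon_l1, ← halfLineGraphon_l1, cliqueGraph_halfLineGraphon a k h]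

theorem density_cliqueGraph_self (a : ℕ) (ha : 2 ≤ a) : 1 / 2 ≤ (cliqueGraph a a).density := by
  have h := (isQuasirandom_cliqueGraph a (by omega)).abs_density_sub_le (show 0 < a by omega)
  have h2 : (a : ℝ)⁻¹ ≤ 1 / 2 := by
    rw [one_div]; exact inv_anti₀ two_pos (by exact_mod_cast ha)
  linarith [(abs_le.1 h).1]

theorem density_cliqueGraph_double (a : ℕ) (ha : 2 ≤ a) :
    1 / 8 ≤ (cliqueGraph a (2 * a)).density := by
  have h := density_cliqueGraph_self a ha
  have ha' : (0 : ℝ) < a := by exact_mod_cast (by omega : 0 < a)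
  have : (cliqueGraph a (2 * a)).density = (cliqueGraph a a).density / 4 := by
    rw [FinGraph.density_eq, FinGraph.density_eq, cliqueGraph_deg2 a (2 * a) (by omega)]
    change _ / ((2 * a : ℕ) : ℝ) ^ 2 = _ / (a : ℝ) ^ 2 / 4
    push_cast
    field_simp
    norm_num
  linarith

/-- Over the clique, which is half of the vertices, the rescaled graphon has its whole mass `1`. On
the side of `G` a set of measure `1/2` carries at most `ρ(G)⁻¹ / 4 ≤ 1/2`. -/
theorem not_rescaledCutDist_lt_cliqueGraph (G : FinGraph) (hG : 1 / 2 ≤ G.density) (a : ℕ)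
    (ha : 2 ≤ a) :
    ¬ rescaledCutDist G.canonical (cliqueGraph a (2 * a)).canonical < ENNReal.ofReal (1 / 4) := by
  classical
  intro h
  have hH := density_cliqueGraph_double a ha
  have ha' : (0 : ℝ) < a := by exact_mod_cast (by omega : 0 < a)
  set H := cliqueGraph a (2 * a) with hHdef
  have hcard : (H.card : ℝ) = 2 * a := by
    change ((2 * a : ℕ) : ℝ) = _; push_cast; rfl
  have hd := H.deg2_pos_of_density_pos (by linarith)
  obtain ⟨τ, hτ, hbox⟩ := exists_transport_of_rescaledCutDist_lt G H (by norm_num) h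
  set u : Option (Fin G.card) × Option (Fin H.card) → ℝ := fun e =>
    match e with
    | (i, some j) => if (j : ℕ) < a then τ (i, some j) else 0
    | (_, none) => 0 with hu
  have hu0 : ∀ e, 0 ≤ u e := by
    rintro ⟨i, _ | j⟩ <;> simp only [hu]
    · exact le_rfl
    · split_ifs
      exacts [hτ.nonneg _, le_rfl]
  have huτ : ∀ e, u e ≤ τ e := by
    rintro ⟨i, _ | j⟩ <;> simp only [hu]
    · exact hτ.nonneg _
    · split_ifs
      exacts [le_rfl, hτ.nonneg _]
  have hb := hbox u u hu0 huτ hu0 huτ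
  rw [bil_diffMat, bil_smul_fun, bil_smul_fun] at hb
  have hc : ∀ j : Fin H.card, cols u (some j) = if (j : ℕ) < a then (H.card : ℝ)⁻¹ else 0 := by
    intro j
    split_ifs with hj
    · rw [← hτ.cols_some j, cols, cols]
      simp only [hu, hj, if_true]
    · rw [cols]
      simp only [hu, hj, if_false, Finset.sum_const_zero]
  have hHone : H.density⁻¹ * bil H.adjO (cols u) (cols u) = 1 := by
    have : bil H.adjO (cols u) (cols u) = H.density := by
      rw [bil_adjO, H.density_eq, FinGraph.deg2, bil, Finset.sum_div]
      refine Finset.sum_congr rfl fun i _ => ?_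
      rw [Finset.sum_div]
      refine Finset.sum_congr rfl fun j _ => ?_
      rw [hc, hc]
      by_cases hij : (i : ℕ) < a ∧ (j : ℕ) < a
      · rw [if_pos hij.1, if_pos hij.2]; ring
      · have h0 : H.adjR i j = 0 := by
          rw [cliqueGraph_adjR, if_neg fun h' => hij h'.2]
        rw [h0]; simp
    rw [this, inv_mul_cancel₀ (by linarith)]
  have hX : ∑ i, rows u i = 1 / 2 := by
    rw [sum_rows, ← sum_cols, Fintype.sum_option]
    have h0 : cols u none = 0 := Finset.sum_eq_zero fun i _ => rfl
    simp only [h0, zero_add, hc]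
    rw [← Finset.sum_filter, Finset.sum_const, nsmul_eq_mul, hcard]
    have : (Finset.univ.filter fun j : Fin H.card => (j : ℕ) < a).card = a := by
      have := Fin.card_filter_val_lt (n := 2 * a) (m := a)
      refine this.trans ?_
      omega
    rw [this]
    field_simp
  have hB := abs_bil_le G.adjO G.abs_adjO_le_one (rows u) (rows u) (rows_nonneg hu0)
    (rows_nonneg hu0)
  rw [hX] at hB
  have hGle : G.density⁻¹ * bil G.adjO (rows u) (rows u) ≤ 1 / 2 := by
    rw [inv_mul_le_iff₀ (by linarith)]
    linarith [(abs_le.1 hB).2]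
  rw [hHone] at hb
  linarith [(abs_le.1 hb).1]

/-! ### Quasirandom graphs of density one half from Hadamard matrices -/

/-- The `2 × 2` Hadamard matrix. -/
def hadamardTwo (a b : Bool) : ℝ := if a && b then -1 else 1

/-- The Sylvester matrix, a Kronecker power of the `2 × 2` Hadamard matrix. -/
def sylvester {m : ℕ} (x y : Fin m → Bool) : ℝ := ∏ i, hadamardTwo (x i) (y i)

theorem sylvester_symm {m : ℕ} (x y : Fin m → Bool) : sylvester x y = sylvester y x :=
  Finset.prod_congr rfl fun i _ => by simp [hadamardTwo, Bool.and_comm]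

theorem sylvester_eq_one_or {m : ℕ} (x y : Fin m → Bool) :
    sylvester x y = 1 ∨ sylvester x y = -1 := by
  rw [← sq_eq_one_iff, sylvester, ← Finset.prod_pow]
  exact Finset.prod_eq_one fun i _ => by unfold hadamardTwo; split_ifs <;> norm_num

/-- The sum factors over the coordinates, and a coordinate in which `y` and `y'` differ gives `0` by
orthogonality of the columns of the `2 × 2` matrix. -/
theorem sum_sylvester_mul {m : ℕ} (y y' : Fin m → Bool) :
    ∑ x, sylvester x y * sylvester x y' = if y = y' then 2 ^ m else 0 := by
  have h1 : ∀ b c : Bool, ∑ a, hadamardTwo a b * hadamardTwo a c = if b = c then 2 else 0 := by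
    intro b c
    cases b <;> cases c <;> (simp [hadamardTwo]; try norm_num)
  have h2 : ∑ x, sylvester x y * sylvester x y' =
      ∏ i, ∑ a, hadamardTwo a (y i) * hadamardTwo a (y' i) := by
    rw [Finset.prod_univ_sum, Fintype.piFinset_univ]
    exact Finset.sum_congr rfl fun x _ => Finset.prod_mul_distrib.symm
  rw [h2]
  simp only [h1]
  split_ifs with h
  · subst h; simp
  · obtain ⟨i, hi⟩ := Function.ne_iff.1 h
    exact Finset.prod_eq_zero (Finset.mem_univ i) (if_neg hi)

/-- The cut norm of a matrix with orthogonal columns. -/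
theorem sq_bil_le_of_orthogonal {V : Type*} [Fintype V] [DecidableEq V] (h : V → V → ℝ) (c : ℝ)
    (horth : ∀ y y', ∑ x, h x y * h x y' = if y = y' then c else 0) (u v : V → ℝ) :
    (bil h u v) ^ 2 ≤ (∑ x, u x ^ 2) * (c * ∑ y, v y ^ 2) := by
  rw [bil_eq_sum_left]
  -- Cauchy–Schwarz in `x`; expanding the remaining square leaves only the diagonal terms, by
  -- orthogonality.
  refine (Finset.sum_mul_sq_le_sq_mul_sq _ _ _).trans_eq ?_
  congr 1
  calc ∑ x, (∑ y, v y * h x y) ^ 2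
      = ∑ x, ∑ y, ∑ y', (v y * v y') * (h x y * h x y') := by
        refine Finset.sum_congr rfl fun x _ => ?_
        rw [sq, Finset.sum_mul_sum]
        exact Finset.sum_congr rfl fun y _ => Finset.sum_congr rfl fun y' _ => by ring
    _ = ∑ y, ∑ y', (v y * v y') * ∑ x, h x y * h x y' := by
        rw [Finset.sum_comm]
        refine Finset.sum_congr rfl fun y _ => ?_
        rw [Finset.sum_comm]
        exact Finset.sum_congr rfl fun y' _ => by rw [Finset.mul_sum]
    _ = c * ∑ y, v y ^ 2 := by
        simp only [horth, mul_ite, mul_zero, Finset.sum_ite_eq, Finset.mem_univ, if_true]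
        rw [Finset.mul_sum]
        exact Finset.sum_congr rfl fun y _ => by ring

/-- The graph of the positive off-diagonal entries of a Sylvester matrix. -/
def sylvesterGraph (m : ℕ) : FinGraph :=
  ⟨Fintype.card (Fin m → Bool),
    { Adj := fun i j => i ≠ j ∧
        sylvester ((Fintype.equivFin _).symm i) ((Fintype.equivFin _).symm j) = 1
      symm := ⟨fun _ _ h => ⟨h.1.symm, by rw [sylvester_symm]; exact h.2⟩⟩
      loopless := ⟨fun _ h => h.1 rfl⟩ }⟩

theorem sylvesterGraph_card (m : ℕ) : (sylvesterGraph m).card = 2 ^ m := by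
  change Fintype.card (Fin m → Bool) = 2 ^ m
  simp

/-- Off the diagonal, adjacency minus `1/2` is half the Sylvester matrix. With `N = 2^m`,
orthogonality bounds the form of that matrix by `N^(-1/2)`, and the diagonal correction costs at
most `N⁻¹`. -/
theorem isQuasirandom_sylvesterGraph (m : ℕ) :
    IsQuasirandom (sylvesterGraph m) (1 / 2) (2 * √((2 : ℝ) ^ m)⁻¹) := by
  classical
  have hcard : ((sylvesterGraph m).card : ℝ) = 2 ^ m := by rw [sylvesterGraph_card]; push_cast; rfl
  set e := (Fintype.equivFin (Fin m → Bool)).symm with he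
  set h : Fin (sylvesterGraph m).card → Fin (sylvesterGraph m).card → ℝ :=
    fun i j => sylvester (e i) (e j) with hh
  have horth : ∀ y y', ∑ x, h x y * h x y' = if y = y' then (2 : ℝ) ^ m else 0 := by
    intro y y'
    refine (Equiv.sum_comp e fun x => sylvester x (e y) * sylvester x (e y')).trans ?_
    rw [sum_sylvester_mul]
    exact if_congr e.injective.eq_iff rfl rfl
  have hadj : ∀ i j, (sylvesterGraph m).adjR i j - 1 / 2 =
      1 / 2 * h i j + (if i = j then -((1 + h i j) / 2) else 0) := by
    intro i j
    have h1 : (sylvesterGraph m).adjR i j = if i ≠ j ∧ h i j = 1 then 1 else 0 :=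
      if_congr Iff.rfl rfl rfl
    have h2 : h i j = 1 ∨ h i j = -1 := sylvester_eq_one_or _ _
    rw [h1]
    by_cases hij : i = j
    · simp only [hij, ne_eq, not_true_eq_false, false_and, if_false, if_true]; ring
    · rcases h2 with h2 | h2 <;> simp [h2, hij] <;> norm_num
  set N : ℝ := 2 ^ m with hN
  have hN1 : 1 ≤ N := one_le_pow₀ (by norm_num)
  have hN0 : 0 < N := by linarith
  intro u v hu huN hv hvN
  simp only [hcard] at huN hvN
  have hsq : ∀ x : Fin (sylvesterGraph m).card → ℝ, (∀ i, 0 ≤ x i) → (∀ i, x i ≤ N⁻¹) →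
      ∑ i, x i ^ 2 ≤ N⁻¹ := by
    intro x hx hxN
    calc ∑ i, x i ^ 2 ≤ ∑ _i : Fin (sylvesterGraph m).card, N⁻¹ ^ 2 :=
          Finset.sum_le_sum fun i _ => pow_le_pow_left₀ (hx i) (hxN i) 2
      _ = N⁻¹ := by
          rw [Finset.sum_const, Finset.card_univ, Fintype.card_fin, nsmul_eq_mul, hcard]
          field_simp
  have hb : |bil h u v| ≤ √N⁻¹ := by
    refine Real.abs_le_sqrt ((sq_bil_le_of_orthogonal h N horth u v).trans ?_)
    calc (∑ x, u x ^ 2) * (N * ∑ y, v y ^ 2) ≤ N⁻¹ * (N * N⁻¹) := by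
          refine mul_le_mul (hsq u hu huN) (mul_le_mul_of_nonneg_left (hsq v hv hvN) hN0.le)
            (mul_nonneg hN0.le (Finset.sum_nonneg fun y _ => sq_nonneg _)) (by positivity)
      _ = N⁻¹ := by field_simp
  have hdiag : |bil (fun i j => if i = j then -((1 + h i j) / 2) else 0) u v| ≤ N⁻¹ := by
    have h1 : bil (fun i j => if i = j then -((1 + h i j) / 2) else 0) u v =
        ∑ i, u i * v i * -((1 + h i i) / 2) := by
      simp [bil]
    rw [h1]
    calc |∑ i, u i * v i * -((1 + h i i) / 2)| ≤ ∑ i, |u i * v i * -((1 + h i i) / 2)| :=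
          Finset.abs_sum_le_sum_abs _ _
      _ ≤ ∑ _i : Fin (sylvesterGraph m).card, N⁻¹ ^ 2 := by
          refine Finset.sum_le_sum fun i _ => ?_
          have h2 : |-((1 + h i i) / 2)| ≤ 1 := by
            rcases sylvester_eq_one_or (e i) (e i) with h3 | h3 <;>
              simp only [hh, h3] <;> norm_num
          rw [abs_mul, abs_of_nonneg (mul_nonneg (hu i) (hv i)), sq]
          exact (mul_le_of_le_one_right (mul_nonneg (hu i) (hv i)) h2).trans
            (mul_le_mul (huN i) (hvN i) (hv i) (by positivity))
      _ = N⁻¹ := by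
          rw [Finset.sum_const, Finset.card_univ, Fintype.card_fin, nsmul_eq_mul, hcard]
          field_simp
  have hle : N⁻¹ ≤ √N⁻¹ := by
    refine Real.le_sqrt_of_sq_le ?_
    rw [sq]
    exact mul_le_of_le_one_left (by positivity) (inv_le_one_of_one_le₀ hN1)
  simp only [hadj]
  rw [bil_add_fun, bil_smul_fun]
  refine (abs_add_le _ _).trans ?_
  rw [abs_mul, abs_of_pos (by norm_num : (0 : ℝ) < 1 / 2)]
  linarith [abs_nonneg (bil h u v)]

theorem exists_isQuasirandom_half {ε : ℝ} (hε : 0 < ε) :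
    ∃ G : FinGraph, 0 < G.card ∧ IsQuasirandom G (1 / 2) ε := by
  have h1 : Tendsto (fun m : ℕ => 2 * √((2 : ℝ) ^ m)⁻¹) atTop (𝓝 (2 * √0)) := by
    refine Tendsto.const_mul _ ((Real.continuous_sqrt.tendsto 0).comp ?_)
    exact tendsto_inv_atTop_zero.comp (tendsto_pow_atTop_atTop_of_one_lt (by norm_num))
  rw [Real.sqrt_zero, mul_zero] at h1
  obtain ⟨m, hm⟩ := (h1.eventually (gt_mem_nhds hε)).exists
  refine ⟨sylvesterGraph m, by rw [sylvesterGraph_card]; positivity, ?_⟩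
  exact BoxBound.mono (isQuasirandom_sylvesterGraph m) (fun _ => le_rfl) hm.le

/-! ### Alternating sequences without convergent density -/

theorem dense_of_le {G : ℕ → FinGraph} {c : ℝ} (hc : 0 < c) (h : ∀ n, c ≤ (G n).density) :
    Dense G := by
  refine hc.trans_le (le_liminf_of_le ?_ (Eventually.of_forall h))
  exact (isBoundedUnder_of ⟨1, fun n => (G n).density_le_one⟩).isCoboundedUnder_ge

theorem edgeSet_nonempty_of_density_pos (G : FinGraph) (h : 0 < G.density) :
    G.graph.edgeSet.Nonempty := by
  by_contra hne
  have h2 := G.deg2_pos_of_density_pos h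
  rw [G.deg2_eq, Set.not_nonempty_iff_eq_empty.1 hne] at h2
  simp at h2

/-- The constants `p n` may vary without restriction, since rescaling divides them out. -/
theorem cauchyRescaled_of_isQuasirandom {G : ℕ → FinGraph} {p ε : ℕ → ℝ} {c : ℝ} (hc : 0 < c)
    (hρ : ∀ n, c ≤ (G n).density) (hq : ∀ n, IsQuasirandom (G n) (p n) (ε n))
    (hε : Tendsto ε atTop (𝓝 0)) : CauchyRescaled G := by
  refine (isCauchy_iff _).2 fun δ hδ => ?_
  -- Each of the two terms of the bound is then at most `2 * δ / 5`, so their sum is below `δ`.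
  obtain ⟨N, hN⟩ := eventually_atTop.1 (hε.eventually (gt_mem_nhds (by positivity : 0 < c * δ / 5)))
  refine ⟨N, fun m hm n hn => ?_⟩
  refine (rescaledCutDist_le_of_isQuasirandom (hq m) (hq n) (hc.trans_le (hρ m))
    (hc.trans_le (hρ n))).trans_lt ((ENNReal.ofReal_lt_ofReal_iff hδ).2 ?_)
  have key : ∀ k ≥ N, 2 * ε k / (G k).density ≤ 2 * δ / 5 := fun k hk => by
    rw [div_le_iff₀ (hc.trans_le (hρ k))]
    have h1 := hN k hk
    have h2 := mul_le_mul_of_nonneg_right (hρ k) hδ.le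
    linarith
  linarith [key m hm, key n hn]

theorem tendsto_inv_add_nat (c : ℕ) :
    Tendsto (fun n : ℕ => ((n + c : ℕ) : ℝ)⁻¹) atTop (𝓝 0) :=
  tendsto_inv_atTop_zero.comp (tendsto_natCast_atTop_atTop.comp (tendsto_add_atTop_nat c))

/-- Complete graphs alternate with quasirandom graphs of density near `1/2`; the shift by `16` keeps
every error at most `1/16`, as the separation of neighbouring terms demands. -/
theorem exists_cauchyRescaled_not_cauchyStretched :
    ∃ G : ℕ → FinGraph, (∀ n, (G n).graph.edgeSet.Nonempty) ∧ Dense G ∧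
      CauchyRescaled G ∧ ¬ CauchyStretched G := by
  have hε0 : ∀ n : ℕ, (0 : ℝ) < ((n + 16 : ℕ) : ℝ)⁻¹ := fun n => by positivity
  have hε1 : ∀ n : ℕ, ((n + 16 : ℕ) : ℝ)⁻¹ ≤ 1 / 16 := fun n => by
    rw [one_div]
    refine inv_anti₀ (by norm_num) ?_
    push_cast
    linarith [(Nat.cast_nonneg n : (0 : ℝ) ≤ n)]
  choose H hHcard hH using fun n : ℕ => exists_isQuasirandom_half (hε0 n)
  have hK : ∀ n : ℕ, IsQuasirandom (cliqueGraph (n + 16) (n + 16)) 1 ((n + 16 : ℕ) : ℝ)⁻¹ :=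
    fun n => isQuasirandom_cliqueGraph _ (by omega)
  set G : ℕ → FinGraph := fun n =>
    if Even n then cliqueGraph (n + 16) (n + 16) else H n with hG
  have hcard : ∀ n, 0 < (G n).card := fun n => by
    simp only [hG]
    split_ifs
    · exact Nat.succ_pos _
    · exact hHcard n
  have hq : ∀ n, IsQuasirandom (G n) (if Even n then 1 else 1 / 2) ((n + 16 : ℕ) : ℝ)⁻¹ :=
    fun n => by
      simp only [hG]
      split_ifs
      exacts [hK n, hH n]
  have hρ : ∀ n, 1 / 4 ≤ (G n).density := fun n => by
    have h1 := (abs_le.1 ((hq n).abs_density_sub_le (hcard n))).1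
    have h2 := hε1 n
    split_ifs at h1 <;> linarith
  refine ⟨G, fun n => edgeSet_nonempty_of_density_pos _ (by linarith [hρ n]),
    dense_of_le (by norm_num) hρ, cauchyRescaled_of_isQuasirandom (by norm_num) hρ hq
      (tendsto_inv_add_nat 16), fun hS => ?_⟩
  obtain ⟨N, hN⟩ := (isCauchy_iff _).1 hS (1 / 8) (by norm_num)
  have h1 := hN (2 * N) (by omega) (2 * N + 1) (by omega)
  have hG1 : G (2 * N) = cliqueGraph (2 * N + 16) (2 * N + 16) := if_pos (by simp)
  have hG2 : G (2 * N + 1) = H (2 * N + 1) := if_neg (by simp)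
  rw [hG1, hG2] at h1
  refine not_stretchedCutDist_lt_of_isQuasirandom (hε1 (2 * N)) (hK _) ?_ (Nat.succ_pos _)
    (hHcard _) h1
  -- The error at the later index is smaller, so a single `ε` serves both graphs.
  refine BoxBound.mono (hH (2 * N + 1)) (fun _ => le_rfl) (inv_anti₀ (by positivity) ?_)
  push_cast
  linarith

/-- Cliques alternate with cliques to which as many isolated vertices are added. The half-line
graphons are those of the cliques, whose stretched Cauchy property follows from the rescaled one by
the comparison, as their density tends to `1`. -/
theorem exists_cauchyStretched_not_cauchyRescaled :
    ∃ G : ℕ → FinGraph, (∀ n, (G n).graph.edgeSet.Nonempty) ∧ Dense G ∧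
      CauchyStretched G ∧ ¬ CauchyRescaled G := by
  set K : ℕ → FinGraph := fun n => cliqueGraph (n + 2) (n + 2) with hK
  have hKρ : ∀ n, 1 / 2 ≤ (K n).density := fun n => density_cliqueGraph_self _ (by omega)
  have hKq : ∀ n, IsQuasirandom (K n) 1 ((n + 2 : ℕ) : ℝ)⁻¹ := fun n =>
    isQuasirandom_cliqueGraph _ (by omega)
  have hKr : CauchyRescaled K := cauchyRescaled_of_isQuasirandom (p := fun _ => 1)
    (ε := fun n => ((n + 2 : ℕ) : ℝ)⁻¹) (by norm_num) hKρ hKq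
    (tendsto_inv_add_nat 2)
  have hKc : HasConvergentDensity K := by
    refine ⟨1, tendsto_iff_dist_tendsto_zero.2 (squeeze_zero (fun _ => dist_nonneg) (fun n => ?_)
      (tendsto_inv_add_nat 2))⟩
    exact (hKq n).abs_density_sub_le (Nat.succ_pos _)
  have hKs : CauchyStretched K := (cauchyStretched_iff_cauchyRescaled K
    (dense_of_le (by norm_num) hKρ) hKc).2 hKr
  set G : ℕ → FinGraph := fun n =>
    if Even n then K n else cliqueGraph (n + 2) (2 * (n + 2)) with hG
  have hGK : ∀ n, (G n).halfLineGraphon = (K n).halfLineGraphon := fun n => by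
    simp only [hG]
    split_ifs
    · rfl
    · exact cliqueGraph_halfLineGraphon _ _ (by omega)
  have hρ : ∀ n, 1 / 8 ≤ (G n).density := fun n => by
    simp only [hG]
    split_ifs
    · linarith [hKρ n]
    · exact density_cliqueGraph_double _ (by omega)
  refine ⟨G, fun n => edgeSet_nonempty_of_density_pos _ (by linarith [hρ n]),
    dense_of_le (by norm_num) hρ, ?_, fun hR => ?_⟩
  · rw [CauchyStretched] at hKs ⊢
    simp only [hGK]
    exact hKs
  · obtain ⟨N, hN⟩ := (isCauchy_iff _).1 hR (1 / 4) (by norm_num)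
    have h1 := hN (2 * N) (by omega) (2 * N + 1) (by omega)
    have hG1 : G (2 * N) = K (2 * N) := if_pos (by simp)
    have hG2 : G (2 * N + 1) = cliqueGraph (2 * N + 1 + 2) (2 * (2 * N + 1 + 2)) :=
      if_neg (by simp)
    rw [hG1, hG2] at h1
    exact not_rescaledCutDist_lt_cliqueGraph _ (hKρ _) _ (by omega) h1

/-! ### Sparse sequences: concentration of the edges on few vertices -/

/-- The number of ordered pairs of adjacent vertices in `A`. -/
def FinGraph.deg2On (G : FinGraph) (A : Finset (Fin G.card)) : ℝ := ∑ i ∈ A, ∑ j ∈ A, G.adjR i j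

/-- `A` consists of the vertices with more than half of the full weight `w`. Markov's inequality
bounds its size. A pair not inside `A` contributes at most half of its full share, so a form of at
least `3/4` out of a possible `1` forces half of the adjacent pairs into `A`. -/
theorem exists_dense_set_of_weights (G : FinGraph) (h : 0 < G.deg2) (x : Fin G.card → ℝ)
    (hx : ∀ i, 0 ≤ x i) (hxw : ∀ i, x i ≤ (√G.deg2)⁻¹) (hb : 3 / 4 ≤ bil G.adjR x x) :
    ∃ A : Finset (Fin G.card), A.card * (√G.deg2)⁻¹ ≤ 2 * ∑ i, x i ∧
      G.deg2 / 2 ≤ G.deg2On A := by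
  classical
  set w := (√G.deg2)⁻¹ with hw
  have hw0 : 0 < w := inv_pos.2 (Real.sqrt_pos.2 h)
  have hw2 : w ^ 2 * G.deg2 = 1 := by
    rw [hw, inv_pow, Real.sq_sqrt h.le, inv_mul_cancel₀ h.ne']
  refine ⟨Finset.univ.filter fun i => w / 2 < x i, ?_, ?_⟩
  · have h1 : (Finset.univ.filter fun i => w / 2 < x i).card * (w / 2) ≤
        ∑ i ∈ Finset.univ.filter (fun i => w / 2 < x i), x i := by
      rw [← nsmul_eq_mul]
      exact Finset.card_nsmul_le_sum _ _ _ fun i hi => (Finset.mem_filter.1 hi).2.le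
    have h2 : ∑ i ∈ Finset.univ.filter (fun i => w / 2 < x i), x i ≤ ∑ i, x i :=
      Finset.sum_le_sum_of_subset_of_nonneg (Finset.filter_subset _ _) fun i _ _ => hx i
    linarith
  · have h1 : G.deg2On (Finset.univ.filter fun i => w / 2 < x i) =
        ∑ i, ∑ j, if w / 2 < x i ∧ w / 2 < x j then G.adjR i j else 0 := by
      rw [FinGraph.deg2On, Finset.sum_filter]
      refine Finset.sum_congr rfl fun i _ => ?_
      rw [Finset.sum_filter]
      by_cases hi : w / 2 < x i <;> simp [hi]
    have h2 : bil G.adjR x x ≤ w ^ 2 * (G.deg2 / 2 +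
        (G.deg2On (Finset.univ.filter fun i => w / 2 < x i)) / 2) := by
      rw [h1, FinGraph.deg2, ← add_div, ← Finset.sum_add_distrib, Finset.sum_div, Finset.mul_sum,
        bil]
      refine Finset.sum_le_sum fun i _ => ?_
      rw [← Finset.sum_add_distrib, Finset.sum_div, Finset.mul_sum]
      refine Finset.sum_le_sum fun j _ => ?_
      have hA := G.adjR_nonneg i j
      have hij : x i * x j ≤ w * w := mul_le_mul (hxw i) (hxw j) (hx j) hw0.le
      split_ifs with hc
      · nlinarith
      · have : x i * x j ≤ w ^ 2 / 2 := by
          rcases not_and_or.1 hc with hc | hc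
          · have := mul_le_mul (not_lt.1 hc) (hxw j) (hx j) (by positivity)
            linarith
          · have := mul_le_mul (hxw i) (not_lt.1 hc) (hx j) hw0.le
            linarith
        nlinarith
    have h3 := hb.trans h2
    set D := G.deg2On (Finset.univ.filter fun i => w / 2 < x i)
    have h4 : w ^ 2 * (D / 2) ≥ w ^ 2 * (G.deg2 / 4) := by
      have : w ^ 2 * (G.deg2 / 2 + D / 2) = 1 / 2 + w ^ 2 * (D / 2) := by
        rw [mul_add, ← mul_div_assoc, hw2]
      have h5 : w ^ 2 * (G.deg2 / 4) = 1 / 4 := by rw [← mul_div_assoc, hw2]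
      linarith
    have h5 := le_of_mul_le_mul_left h4 (by positivity)
    linarith

/-- The weights are the masses of `V` in the cells; their sum is at most the measure of `V`. -/
theorem exists_dense_set_of_setIntegral {Ω : Type*} [MeasurableSpace Ω] (γ : Measure Ω) [SFinite γ]
    (G : FinGraph) (h : 0 < G.deg2) (p : Ω → Option (Fin G.card))
    (hp : ∀ e, MeasurableSet (p ⁻¹' {e}))
    (hcell : ∀ i, γ (p ⁻¹' {some i}) = ENNReal.ofReal (√G.deg2)⁻¹) {V : Set Ω}
    (hV : MeasurableSet V) (hVtop : γ V ≠ ⊤)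
    (hint : 3 / 4 ≤ ∫ z in V ×ˢ V, G.adjO (p z.1) (p z.2) ∂(γ.prod γ)) :
    ∃ A : Finset (Fin G.card), A.card * (√G.deg2)⁻¹ ≤ 2 * γ.real V ∧
      G.deg2 / 2 ≤ G.deg2On A := by
  have hfin : ∀ e e', G.adjO e e' ≠ 0 → γ (p ⁻¹' {e}) ≠ ⊤ ∧ γ (p ⁻¹' {e'}) ≠ ⊤ := by
    rintro (_ | i) (_ | j) hij
    any_goals simp at hij
    rw [hcell, hcell]
    exact ⟨ENNReal.ofReal_ne_top, ENNReal.ofReal_ne_top⟩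
  rw [setIntegral_comp_index γ p hp G.adjO hfin V V, bil_adjO] at hint
  obtain ⟨A, hA, hA'⟩ := exists_dense_set_of_weights G h _ (fun _ => measureReal_nonneg)
    (fun i => ENNReal.toReal_le_of_le_ofReal (by positivity)
      ((measure_mono Set.inter_subset_right).trans_eq (hcell i))) hint
  refine ⟨A, hA.trans ?_, hA'⟩
  have := sum_cells γ (fun e => V ∩ p ⁻¹' {e}) V hVtop (fun e => hV.inter (hp e))
    (fun e e' hee => (Disjoint.preimage p (by simpa using hee)).mono Set.inter_subset_right
      Set.inter_subset_right) (by ext z; simp)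
  rw [Fintype.sum_option] at this
  linarith [measureReal_nonneg (μ := γ) (s := V ∩ p ⁻¹' {none})]

theorem integral_adjO_eq_one {Ω : Type*} [MeasurableSpace Ω] (γ : Measure Ω) [SFinite γ]
    (G : FinGraph) (h : 0 < G.deg2) (p : Ω → Option (Fin G.card))
    (hp : ∀ e, MeasurableSet (p ⁻¹' {e}))
    (hcell : ∀ i, γ (p ⁻¹' {some i}) = ENNReal.ofReal (√G.deg2)⁻¹) :
    Integrable (fun z : Ω × Ω => G.adjO (p z.1) (p z.2)) (γ.prod γ) ∧
      ∫ z, G.adjO (p z.1) (p z.2) ∂(γ.prod γ) = 1 := by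
  have hfin : ∀ e e', G.adjO e e' ≠ 0 → γ (p ⁻¹' {e}) ≠ ⊤ ∧ γ (p ⁻¹' {e'}) ≠ ⊤ := by
    rintro (_ | i) (_ | j) hij
    any_goals simp at hij
    rw [hcell, hcell]
    exact ⟨ENNReal.ofReal_ne_top, ENNReal.ofReal_ne_top⟩
  refine ⟨integrable_comp_index γ p hp G.adjO hfin, ?_⟩
  have := setIntegral_comp_index γ p hp G.adjO hfin Set.univ Set.univ
  rw [Set.univ_prod_univ, Measure.restrict_univ] at this
  rw [this, bil_adjO]
  simp only [Set.univ_inter, Measure.real, hcell,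
    ENNReal.toReal_ofReal (by positivity : 0 ≤ (√G.deg2)⁻¹), bil, ← Finset.mul_sum]
  change (√G.deg2)⁻¹ * (√G.deg2)⁻¹ * G.deg2 = 1
  rw [← mul_inv, Real.mul_self_sqrt h.le, inv_mul_cancel₀ h.ne']

theorem IsCoupling.map_snd_prod {S₁ : Type u} {S₂ : Type v} [MeasurableSpace S₁]
    [MeasurableSpace S₂] {μ₁ : Measure S₁} {μ₂ : Measure S₂} {γ : Measure (S₁ × S₂)} [SFinite γ]
    (h : IsCoupling μ₁ μ₂ γ) :
    (γ.prod γ).map (Prod.map Prod.snd Prod.snd) = μ₂.prod μ₂ := by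
  rw [← Measure.map_prod_map _ _ measurable_snd measurable_snd, h.2]

theorem IsCoupling.integrable_snd {S₁ : Type u} {S₂ : Type v} [MeasurableSpace S₁]
    [MeasurableSpace S₂] {μ₁ : Measure S₁} {μ₂ : Measure S₂} {γ : Measure (S₁ × S₂)} [SFinite γ]
    (h : IsCoupling μ₁ μ₂ γ) {W : S₂ × S₂ → ℝ} (hW : Integrable W (μ₂.prod μ₂)) :
    Integrable (fun z : (S₁ × S₂) × S₁ × S₂ => W (z.1.2, z.2.2)) (γ.prod γ) := by
  rw [← h.map_snd_prod] at hW
  exact hW.comp_measurable (measurable_snd.prodMap measurable_snd)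

/-- The integral over the squares of an exhaustion by sets of finite measure tends to the full
integral. -/
theorem exists_finite_set_setIntegral (𝒲 : Graphon.{u}) {ε : ℝ} (hε : 0 < ε) :
    ∃ U : Set 𝒲.S, MeasurableSet U ∧ 𝒲.μ U ≠ ⊤ ∧
      ∫ z, 𝒲.W z ∂(𝒲.μ.prod 𝒲.μ) - ε ≤ ∫ z in U ×ˢ U, 𝒲.W z ∂(𝒲.μ.prod 𝒲.μ) := by
  have hmono : Monotone fun n => spanningSets 𝒲.μ n ×ˢ spanningSets 𝒲.μ n := fun m n hmn =>
    Set.prod_mono (monotone_spanningSets 𝒲.μ hmn) (monotone_spanningSets 𝒲.μ hmn)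
  have hU : ⋃ n, spanningSets 𝒲.μ n ×ˢ spanningSets 𝒲.μ n = Set.univ := by
    rw [Set.iUnion_prod_of_monotone (monotone_spanningSets 𝒲.μ) (monotone_spanningSets 𝒲.μ),
      iUnion_spanningSets, Set.univ_prod_univ]
  have := tendsto_setIntegral_of_monotone (μ := 𝒲.μ.prod 𝒲.μ) (f := 𝒲.W)
    (fun n => (measurableSet_spanningSets 𝒲.μ n).prod (measurableSet_spanningSets 𝒲.μ n)) hmono
    𝒲.integrable.integrableOn
  rw [hU, Measure.restrict_univ] at this
  obtain ⟨n, hn⟩ := (this.eventually (lt_mem_nhds (sub_lt_self _ hε))).exists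
  exact ⟨spanningSets 𝒲.μ n, measurableSet_spanningSets _ _, (measure_spanningSets_lt_top _ _).ne,
    hn.le⟩

/-- A set `U` of finite measure carries almost all of the integral of the fixed graphon, and its
preimage under the coupling does the same for the graph. The three errors of `1/16`, from the choice
of `U` and from testing the cut norm on the whole space and on that preimage, leave at least `3/4`.
-/
theorem exists_dense_set_of_couplingDist (𝒲 : Graphon.{v}) :
    ∃ M : ℝ, ∀ (𝒲₁ : Graphon.{u}) (G : FinGraph) (_ : 0 < G.deg2)
      (idx : 𝒲₁.S → Option (Fin G.card)), IsModel 𝒲₁ G.adjO idx (√G.deg2)⁻¹ →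
      couplingDist 𝒲₁ 𝒲 < ENNReal.ofReal (1 / 16) →
      ∃ A : Finset (Fin G.card), A.card * (√G.deg2)⁻¹ ≤ M ∧ G.deg2 / 2 ≤ G.deg2On A := by
  obtain ⟨U, hU, hUtop, hint⟩ := exists_finite_set_setIntegral 𝒲 (by norm_num : (0 : ℝ) < 1 / 16)
  refine ⟨2 * 𝒲.μ.real U, fun 𝒲₁ G hG idx hm hd => ?_⟩
  obtain ⟨γ, hγ, hcut⟩ := exists_coupling_of_couplingDist_lt hd
  have := hγ.sigmaFinite
  have hp : ∀ e, MeasurableSet ((fun z : 𝒲₁.S × 𝒲.S => idx z.1) ⁻¹' {e}) := fun e =>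
    measurable_fst (hm.measurableSet_cell e)
  have hcell : ∀ i, γ ((fun z : 𝒲₁.S × 𝒲.S => idx z.1) ⁻¹' {some i}) =
      ENNReal.ofReal (√G.deg2)⁻¹ := fun i =>
    (hγ.measure_fst (hm.measurableSet_cell _)).trans (hm.measure_cell i)
  obtain ⟨hI1, h1⟩ := integral_adjO_eq_one γ G hG _ hp hcell
  have hI2 := hγ.integrable_snd 𝒲.integrable
  simp only [hm.W_eq] at hcut
  have hV : MeasurableSet (Prod.snd ⁻¹' U : Set (𝒲₁.S × 𝒲.S)) := measurable_snd hU
  have c1 := abs_setIntegral_le_of_cutNorm (by norm_num) hcut MeasurableSet.univ MeasurableSet.univ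
  have c2 := abs_setIntegral_le_of_cutNorm (by norm_num) hcut hV hV
  rw [Set.univ_prod_univ, Measure.restrict_univ, integral_sub hI1 hI2, h1] at c1
  rw [integral_sub hI1.integrableOn hI2.integrableOn] at c2
  have e1 : ∫ z, 𝒲.W z ∂(𝒲.μ.prod 𝒲.μ) =
      ∫ z : (𝒲₁.S × 𝒲.S) × 𝒲₁.S × 𝒲.S, 𝒲.W (z.1.2, z.2.2) ∂(γ.prod γ) := by
    rw [← hγ.map_snd_prod, integral_map (measurable_snd.prodMap measurable_snd).aemeasurable
      𝒲.meas.aestronglyMeasurable]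
    rfl
  have e2 : ∫ z in U ×ˢ U, 𝒲.W z ∂(𝒲.μ.prod 𝒲.μ) =
      ∫ z in (Prod.snd ⁻¹' U : Set (𝒲₁.S × 𝒲.S)) ×ˢ (Prod.snd ⁻¹' U : Set (𝒲₁.S × 𝒲.S)),
        𝒲.W (z.1.2, z.2.2) ∂(γ.prod γ) := by
    rw [← hγ.map_snd_prod, setIntegral_map (hU.prod hU) 𝒲.meas.aestronglyMeasurable
      (measurable_snd.prodMap measurable_snd).aemeasurable]
    rfl
  rw [← e1] at c1
  rw [← e2] at c2
  have hVm : γ (Prod.snd ⁻¹' U) = 𝒲.μ U := hγ.measure_snd hU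
  have key := exists_dense_set_of_setIntegral γ G hG _ hp hcell hV (by rw [hVm]; exact hUtop)
    (by linarith [(abs_le.1 c1).2, (abs_le.1 c2).1])
  rwa [Measure.real, hVm] at key

theorem exists_dense_set_of_stretchedCutDist (𝒲 : Graphon.{u}) :
    ∃ M : ℝ, ∀ G : FinGraph, 0 < G.deg2 →
      stretchedCutDist G.halfLineGraphon 𝒲 < ENNReal.ofReal (1 / 16) →
      ∃ A : Finset (Fin G.card), A.card * (√G.deg2)⁻¹ ≤ M ∧ G.deg2 / 2 ≤ G.deg2On A := by
  obtain ⟨M₁, h₁⟩ := exists_dense_set_of_couplingDist.{0} 𝒲.stretch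
  obtain ⟨M₂, h₂⟩ := exists_dense_set_of_couplingDist.{0} 𝒲.stretch.extend
  -- Which branch of the cut metric applies depends on the mass of the fixed graphon, so both are
  -- covered.
  refine ⟨max M₁ M₂, fun G hG hd => ?_⟩
  rw [stretchedCutDist, stretch_halfLineGraphon G hG, cutDist] at hd
  split_ifs at hd
  · obtain ⟨A, hA, hA'⟩ := h₁ _ G hG _ (stretched_isModel G hG) hd
    exact ⟨A, hA.trans (le_max_left _ _), hA'⟩
  · obtain ⟨A, hA, hA'⟩ := h₂ _ G hG _ (stretched_isModel G hG).extend hd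
    exact ⟨A, hA.trans (le_max_right _ _), hA'⟩

/-! ### Small vertex sets in the rescaled metric -/

theorem setIntegral_rescaled_block {Ω : Type*} [MeasurableSpace Ω] (γ : Measure Ω) [SFinite γ]
    (G : FinGraph) (p : Ω → Option (Fin G.card)) (hp : ∀ e, MeasurableSet (p ⁻¹' {e}))
    (hcell : ∀ i, γ (p ⁻¹' {some i}) = ENNReal.ofReal (G.card : ℝ)⁻¹)
    (A : Finset (Fin G.card)) :
    Integrable (fun z : Ω × Ω => G.density⁻¹ * G.adjO (p z.1) (p z.2)) (γ.prod γ) ∧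
    ∫ z in (p ⁻¹' (some '' A)) ×ˢ (p ⁻¹' (some '' A)), G.density⁻¹ * G.adjO (p z.1) (p z.2)
      ∂(γ.prod γ) = G.density⁻¹ * (G.deg2On A / (G.card : ℝ) ^ 2) := by
  classical
  have hfin : ∀ e e', G.density⁻¹ * G.adjO e e' ≠ 0 →
      γ (p ⁻¹' {e}) ≠ ⊤ ∧ γ (p ⁻¹' {e'}) ≠ ⊤ := by
    rintro (_ | i) (_ | j) hij
    any_goals simp at hij
    rw [hcell, hcell]
    exact ⟨ENNReal.ofReal_ne_top, ENNReal.ofReal_ne_top⟩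
  refine ⟨integrable_comp_index γ p hp (fun e e' => G.density⁻¹ * G.adjO e e') hfin, ?_⟩
  rw [setIntegral_comp_index γ p hp (fun e e' => G.density⁻¹ * G.adjO e e') hfin, bil_smul_fun,
    bil_adjO]
  have hx : ∀ i, γ.real (p ⁻¹' (some '' A) ∩ p ⁻¹' {some i}) =
      if i ∈ A then (G.card : ℝ)⁻¹ else 0 := by
    intro i
    rw [← Set.preimage_inter]
    split_ifs with hi
    · rw [Set.inter_eq_self_of_subset_right (by simpa using hi), Measure.real, hcell,
        ENNReal.toReal_ofReal (by positivity)]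
    · rw [Set.inter_singleton_eq_empty.2 (by simpa using hi)]
      simp
  congr 1
  simp only [bil, hx]
  rw [FinGraph.deg2On, Finset.sum_div, ← Finset.sum_filter_add_sum_filter_not Finset.univ (· ∈ A)]
  rw [Finset.sum_eq_zero (s := Finset.univ.filter fun i => ¬ i ∈ A), add_zero,
    Finset.filter_mem_eq_inter, Finset.univ_inter]
  · refine Finset.sum_congr rfl fun i hi => ?_
    rw [← Finset.sum_filter_add_sum_filter_not Finset.univ (· ∈ A),
      Finset.sum_eq_zero (s := Finset.univ.filter fun i => ¬ i ∈ A), add_zero,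
      Finset.filter_mem_eq_inter, Finset.univ_inter, Finset.sum_div]
    · refine Finset.sum_congr rfl fun j hj => ?_
      rw [if_pos hi, if_pos hj]; ring
    · intro j hj
      rw [if_neg (Finset.mem_filter.1 hj).2]; ring
  · intro i hi
    refine Finset.sum_eq_zero fun j _ => ?_
    rw [if_neg (Finset.mem_filter.1 hi).2]; ring

theorem measureReal_block {Ω : Type*} [MeasurableSpace Ω] (γ : Measure Ω)
    {k : ℕ} (p : Ω → Option (Fin k)) (hp : ∀ e, MeasurableSet (p ⁻¹' {e}))
    (hcell : ∀ i, γ (p ⁻¹' {some i}) = ENNReal.ofReal (k : ℝ)⁻¹) (A : Finset (Fin k)) :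
    γ (p ⁻¹' (some '' A)) = ENNReal.ofReal (A.card / k) := by
  have : p ⁻¹' (some '' A) = ⋃ i ∈ A, p ⁻¹' {some i} := by
    ext z; simp [eq_comm]
  rw [this, measure_biUnion_finset (fun i _ j _ hij => Disjoint.preimage p (by simpa using hij))
    fun i _ => hp _]
  simp only [hcell, Finset.sum_const, nsmul_eq_mul]
  rw [div_eq_mul_inv, ENNReal.ofReal_mul (Nat.cast_nonneg _), ENNReal.ofReal_natCast]

theorem half_le_rescaled_block (G : FinGraph) (h : 0 < G.deg2) (A : Finset (Fin G.card))
    (hA : G.deg2 / 2 ≤ G.deg2On A) : 1 / 2 ≤ G.density⁻¹ * (G.deg2On A / (G.card : ℝ) ^ 2) := by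
  have hρ := G.density_pos h
  have hk := G.card_pos_of_density_pos hρ
  rw [le_inv_mul_iff₀ hρ, G.density_eq, div_mul_eq_mul_div]
  refine div_le_div_of_nonneg_right ?_ (by positivity)
  linarith

/-- Uniform integrability of a single function: it is bounded apart from a part of small integral.
-/
theorem exists_tail_bound {Ω : Type*} [MeasurableSpace Ω] {μ : Measure Ω} {f : Ω → ℝ}
    (hf : Integrable f μ) (hm : Measurable f) {ε : ℝ} (hε : 0 < ε) :
    ∃ K : ℝ, 0 < K ∧ ∃ g : Ω → ℝ, Measurable g ∧ Integrable g μ ∧ (∀ x, 0 ≤ g x) ∧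
      (∀ x, |f x| ≤ K + g x) ∧ ∫ x, g x ∂μ ≤ ε := by
  obtain ⟨M, hM⟩ := (memLp_one_iff_integrable.2 hf).integral_indicator_norm_ge_le
    hm.stronglyMeasurable hε
  have hms : MeasurableSet {x | M ≤ ((‖f x‖₊ : ℝ≥0) : ℝ)} :=
    measurableSet_le measurable_const hm.nnnorm.coe_nnreal_real
  refine ⟨max M 1, lt_max_of_lt_right one_pos,
    fun x => |{x | M ≤ ((‖f x‖₊ : ℝ≥0) : ℝ)}.indicator f x|, (hm.indicator hms).abs,
    (hf.indicator hms).abs, fun x => abs_nonneg _, fun x => ?_, ?_⟩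
  · by_cases hx : x ∈ {x | M ≤ ((‖f x‖₊ : ℝ≥0) : ℝ)}
    · simp only [Set.indicator_of_mem hx]
      linarith [le_max_right M 1]
    · simp only [Set.indicator_of_notMem hx, abs_zero, add_zero]
      have : |f x| < M := not_le.1 hx
      exact this.le.trans (le_max_left _ _)
  · rw [integral_eq_lintegral_of_nonneg_ae (Eventually.of_forall fun x => abs_nonneg _)
      (hm.indicator hms).abs.aestronglyMeasurable]
    refine ENNReal.toReal_le_of_le_ofReal hε.le (le_trans (le_of_eq ?_) hM)
    refine lintegral_congr fun x => ?_
    rw [← Real.norm_eq_abs, ofReal_norm]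
    rfl

/-- On the square of a set of small measure the fixed graphon has integral at most `1/8`, by
truncation at height `K`. A cut distance below `1/16` then leaves the graph at most `3/16` there,
whereas half of the edges would give `1/2`. -/
theorem not_dense_set_of_rescaledCutDist (𝒲 : Graphon.{u}) :
    ∃ δ : ℝ, 0 < δ ∧ ∀ G : FinGraph, 0 < G.deg2 →
      rescaledCutDist G.canonical 𝒲 < ENNReal.ofReal (1 / 16) →
      ∀ A : Finset (Fin G.card), (A.card : ℝ) / G.card ≤ δ → ¬ G.deg2 / 2 ≤ G.deg2On A := by
  obtain ⟨K, hK, g, hgm, hgi, hg0, hfg, hgε⟩ := exists_tail_bound 𝒲.rescale.integrable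
    𝒲.rescale.meas (by norm_num : (0 : ℝ) < 1 / 16)
  refine ⟨min 1 (1 / (16 * K)), by positivity, fun G hG hd A hA hA' => ?_⟩
  obtain ⟨γ, hγ, hcut⟩ := exists_coupling_of_couplingDist_lt hd
  have := hγ.sigmaFinite
  have hm := rescaled_isModel G
  simp only [hm.W_eq] at hcut
  set p : G.canonical.rescale.S × 𝒲.rescale.S → Option (Fin G.card) :=
    fun z => unitIdx G.card z.1 with hpdef
  have hp : ∀ e, MeasurableSet (p ⁻¹' {e}) := fun e => measurable_fst (hm.measurableSet_cell e)
  have hcell : ∀ i, γ (p ⁻¹' {some i}) = ENNReal.ofReal (G.card : ℝ)⁻¹ := fun i =>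
    (hγ.measure_fst (hm.measurableSet_cell _)).trans (hm.measure_cell i)
  obtain ⟨hI1, h1⟩ := setIntegral_rescaled_block γ G p hp hcell A
  have hI2 := hγ.integrable_snd 𝒲.rescale.integrable
  have hIg := hγ.integrable_snd hgi
  have hVm := measureReal_block γ p hp hcell A
  have hV : MeasurableSet (p ⁻¹' (some '' (A : Set (Fin G.card)))) := by
    rw [← Set.biUnion_preimage_singleton]
    exact MeasurableSet.biUnion (Set.to_countable _) fun e _ => hp e
  set V := p ⁻¹' (some '' (A : Set (Fin G.card))) with hVdef
  have hVr : γ.real V = A.card / G.card := by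
    rw [Measure.real, hVm, ENNReal.toReal_ofReal (by positivity)]
  have c := abs_setIntegral_le_of_cutNorm (by norm_num) hcut hV hV
  rw [integral_sub hI1.integrableOn hI2.integrableOn, h1] at c
  have h2 := half_le_rescaled_block G hG A hA'
  have hVV : (γ.prod γ) (V ×ˢ V) ≠ ⊤ := by
    rw [Measure.prod_prod, hVm]
    exact ENNReal.mul_ne_top ENNReal.ofReal_ne_top ENNReal.ofReal_ne_top
  have hIK : Integrable (fun _ => K) ((γ.prod γ).restrict (V ×ˢ V)) := integrableOn_const hVV
  have h3 : ∫ z in V ×ˢ V, 𝒲.rescale.W (z.1.2, z.2.2) ∂(γ.prod γ) ≤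
      K * (A.card / G.card) ^ 2 + 1 / 16 := by
    calc ∫ z in V ×ˢ V, 𝒲.rescale.W (z.1.2, z.2.2) ∂(γ.prod γ)
        ≤ ∫ z in V ×ˢ V, (K + g (z.1.2, z.2.2)) ∂(γ.prod γ) := by
          refine integral_mono hI2.integrableOn
            (hIK.add hIg.integrableOn) fun z => ?_
          exact (le_abs_self _).trans (hfg _)
      _ = K * (A.card / G.card) ^ 2 + ∫ z in V ×ˢ V, g (z.1.2, z.2.2) ∂(γ.prod γ) := by
          rw [integral_add hIK hIg.integrableOn, setIntegral_const,
            measureReal_prod_prod, hVr, smul_eq_mul]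
          ring
      _ ≤ K * (A.card / G.card) ^ 2 + 1 / 16 := by
          gcongr
          refine (setIntegral_le_integral hIg (Eventually.of_forall fun z => hg0 _)).trans ?_
          refine le_trans (le_of_eq ?_) hgε
          rw [← hγ.map_snd_prod, integral_map (measurable_snd.prodMap measurable_snd).aemeasurable
            hgm.aestronglyMeasurable]
          rfl
  have ha0 : (0 : ℝ) ≤ A.card / G.card := by positivity
  have ha1 : (A.card : ℝ) / G.card ≤ 1 := hA.trans (min_le_left _ _)
  have ha2 : K * ((A.card : ℝ) / G.card) ≤ 1 / 16 := by
    have := mul_le_mul_of_nonneg_left (hA.trans (min_le_right _ _)) hK.le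
    refine this.trans_eq ?_
    field_simp
  have ha3 : K * ((A.card : ℝ) / G.card) ^ 2 ≤ 1 / 16 := by
    rw [sq, ← mul_assoc]
    exact (mul_le_of_le_one_right (by positivity) ha1).trans ha2
  linarith [(abs_le.1 c).2]

/-- In a sparse sequence a set of vertices of bounded measure in the stretched scale is a
vanishing proportion of the vertices. -/
theorem eventually_card_div_le (G : ℕ → FinGraph) (hE : ∀ n, (G n).graph.edgeSet.Nonempty)
    (hS : Sparse G) (M : ℝ) {δ : ℝ} (hδ : 0 < δ) :
    ∀ᶠ n in atTop, ∀ A : Finset (Fin (G n).card), A.card * (√(G n).deg2)⁻¹ ≤ M →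
      (A.card : ℝ) / (G n).card ≤ δ := by
  have h1 : Tendsto (fun n => M * √(G n).density) atTop (𝓝 (M * √0)) :=
    ((Real.continuous_sqrt.tendsto 0).comp hS).const_mul M
  rw [Real.sqrt_zero, mul_zero] at h1
  filter_upwards [h1.eventually (gt_mem_nhds hδ)] with n hn A hA
  have hd := (G n).deg2_pos (hE n)
  have hρ := (G n).density_pos hd
  have hk := (G n).card_pos_of_density_pos hρ
  rw [inv_sqrt_deg2 _ hρ] at hA
  have h2 : (A.card : ℝ) * ((√(G n).density)⁻¹ / (G n).card) =
      (A.card : ℝ) / (G n).card / √(G n).density := by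
    field_simp
  rw [h2, div_le_iff₀ (Real.sqrt_pos.2 hρ)] at hA
  exact hA.trans hn.le

/-- The stretched bound yields a set with half of the edges, sparsity makes it a vanishing
proportion of the vertices, and the rescaled bound rules that out. The two graphons need not be
related. -/
theorem not_stretched_and_rescaled_close (G : ℕ → FinGraph)
    (hE : ∀ n, (G n).graph.edgeSet.Nonempty) (hS : Sparse G) (𝒲 : Graphon.{u})
    (𝒲' : Graphon.{v})
    (h : ∀ᶠ n in atTop, stretchedCutDist (G n).halfLineGraphon 𝒲 < ENNReal.ofReal (1 / 16))
    (h' : ∀ᶠ n in atTop, rescaledCutDist (G n).canonical 𝒲' < ENNReal.ofReal (1 / 16)) :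
    False := by
  obtain ⟨M, hM⟩ := exists_dense_set_of_stretchedCutDist 𝒲
  obtain ⟨δ, hδ, hδ'⟩ := not_dense_set_of_rescaledCutDist 𝒲'
  obtain ⟨n, h1, h2, h3⟩ := (h.and (h'.and (eventually_card_div_le G hE hS M hδ))).exists
  have hd := (G n).deg2_pos (hE n)
  obtain ⟨A, hA, hA'⟩ := hM (G n) hd h1
  exact hδ' (G n) hd h2 A (h3 A hA) hA'

/-- Freezing one index lets a term of the sequence play the role of the limit graphon. -/
theorem IsCauchy.exists_eventually_lt {d : ℕ → ℕ → ℝ≥0∞} (h : IsCauchy d) {ε : ℝ} (hε : 0 < ε) :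
    ∃ N, ∀ᶠ n in atTop, d n N < ENNReal.ofReal ε := by
  obtain ⟨N, hN⟩ := (isCauchy_iff d).1 h ε hε
  exact ⟨N, eventually_atTop.2 ⟨N, fun n hn => hN n hn N le_rfl⟩⟩

theorem not_cauchyStretched_and_cauchyRescaled (G : ℕ → FinGraph)
    (hE : ∀ n, (G n).graph.edgeSet.Nonempty) (hS : Sparse G) :
    ¬ (CauchyStretched G ∧ CauchyRescaled G) := by
  rintro ⟨h1, h2⟩
  obtain ⟨N, hN⟩ := IsCauchy.exists_eventually_lt h1 (by norm_num : (0 : ℝ) < 1 / 16)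
  obtain ⟨N', hN'⟩ := IsCauchy.exists_eventually_lt h2 (by norm_num : (0 : ℝ) < 1 / 16)
  exact not_stretched_and_rescaled_close G hE hS _ _ hN hN'

theorem not_tendstoStretched_and_tendstoRescaled (G : ℕ → FinGraph)
    (hE : ∀ n, (G n).graph.edgeSet.Nonempty) (hS : Sparse G) :
    ¬ ((∃ 𝒲 : Graphon.{u}, TendstoStretched G 𝒲) ∧ ∃ 𝒲 : Graphon.{v}, TendstoRescaled G 𝒲) := by
  rintro ⟨⟨𝒲, h⟩, 𝒲', h'⟩
  have hpos : (0 : ℝ≥0∞) < ENNReal.ofReal (1 / 16) := by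
    rw [ENNReal.ofReal_pos]; norm_num
  exact not_stretched_and_rescaled_close G hE hS 𝒲 𝒲' (h.eventually (gt_mem_nhds hpos))
    (h'.eventually (gt_mem_nhds hpos))

/-! ### Sparse sequences: upper regularity and regular tails -/

theorem integrable_blockAverage {S : Type u} [MeasurableSpace S] (μ : Measure S)
    [IsFiniteMeasure μ] (W : S × S → ℝ) {m : ℕ} (P : Fin m → Set S)
    (hP : ∀ a, MeasurableSet (P a)) :
    Measurable (blockAverage μ W P) ∧ Integrable (blockAverage μ W P) (μ.prod μ) := by
  unfold blockAverage
  constructor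
  · exact Finset.measurable_sum _ fun a _ => Finset.measurable_sum _ fun b _ =>
      measurable_const.indicator ((hP a).prod (hP b))
  · exact integrable_finsetSum _ fun a _ => integrable_finsetSum _ fun b _ =>
      (integrable_const _).indicator ((hP a).prod (hP b))

theorem blockAverage_of_mem {S : Type u} [MeasurableSpace S] (μ : Measure S) (W : S × S → ℝ)
    {m : ℕ} (P : Fin m → Set S) (hd : Pairwise (Function.onFun Disjoint P)) (a : Fin m)
    {z : S × S} (hz : z ∈ P a ×ˢ P a) :
    blockAverage μ W P z =
      (μ.real (P a) * μ.real (P a))⁻¹ * ∫ w in P a ×ˢ P a, W w ∂(μ.prod μ) := by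
  have hne : ∀ (x : S) (b : Fin m), x ∈ P a → b ≠ a → x ∉ P b := fun x b hx hb hx' =>
    Set.disjoint_left.1 (hd hb) hx' hx
  rw [blockAverage, Finset.sum_eq_single a, Finset.sum_eq_single a, Set.indicator_of_mem hz]
  · exact fun b _ hb => Set.indicator_of_notMem (fun h => hne _ b hz.2 hb h.2) _
  · simp
  · exact fun b _ hb => Finset.sum_eq_zero fun c _ =>
      Set.indicator_of_notMem (fun h => hne _ b hz.1 hb h.1) _
  · simp

/-- The hypothesis says that the average over the block is at least `K`, so the whole block survives
the truncation, and averaging preserves its integral. -/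
theorem le_largePartNorm_blockAverage {S : Type u} [MeasurableSpace S] (μ : Measure S)
    [IsFiniteMeasure μ] (W : S × S → ℝ) {m : ℕ} (P : Fin m → Set S)
    (hP : ∀ a, MeasurableSet (P a)) (hd : Pairwise (Function.onFun Disjoint P)) (a : Fin m)
    (ha : 0 < μ.real (P a)) {K : ℝ}
    (hK : K * (μ.real (P a) * μ.real (P a)) ≤ ∫ w in P a ×ˢ P a, W w ∂(μ.prod μ)) :
    ∫ w in P a ×ˢ P a, W w ∂(μ.prod μ) ≤ largePartNorm μ (blockAverage μ W P) K := by
  obtain ⟨hm, hi⟩ := integrable_blockAverage μ W P hP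
  have hms : MeasurableSet {w | K ≤ |blockAverage μ W P w|} := measurableSet_le measurable_const hm.abs
  set I := ∫ w in P a ×ˢ P a, W w ∂(μ.prod μ) with hI
  set q := μ.real (P a) * μ.real (P a) with hq
  have hq0 : 0 < q := mul_pos ha ha
  have hval : ∀ z ∈ P a ×ˢ P a,
      |{w | K ≤ |blockAverage μ W P w|}.indicator (blockAverage μ W P) z| = |q⁻¹ * I| := by
    intro z hz
    have h1 := blockAverage_of_mem μ W P hd a hz
    have hKle : K ≤ |q⁻¹ * I| := by
      refine le_trans ?_ (le_abs_self _)
      rw [le_inv_mul_iff₀ hq0, mul_comm]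
      exact hK
    rw [Set.indicator_of_mem, h1]
    change K ≤ |blockAverage μ W P z|
    rw [h1]
    exact hKle
  calc I ≤ q * |q⁻¹ * I| := by
        rw [abs_mul, abs_of_pos (inv_pos.2 hq0), mul_inv_cancel_left₀ hq0.ne']
        exact le_abs_self I
    _ = ∫ z in P a ×ˢ P a,
          |{w | K ≤ |blockAverage μ W P w|}.indicator (blockAverage μ W P) z| ∂(μ.prod μ) := by
        rw [setIntegral_congr_fun ((hP a).prod (hP a)) hval, setIntegral_const,
          measureReal_prod_prod, smul_eq_mul]
    _ ≤ largePartNorm μ (blockAverage μ W P) K :=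
        setIntegral_le_integral (hi.indicator hms).abs (Eventually.of_forall fun z => abs_nonneg _)

theorem vertexBlock_eq {k m : ℕ} (c : Fin k → Fin m) (a : Fin m) :
    vertexBlock c a =
      unitIdx k ⁻¹' (some '' ((Finset.univ.filter fun i => c i = a : Finset (Fin k)) : Set _)) := by
  ext x
  simp [vertexBlock, mem_unitCell, eq_comm]

theorem vertexBlock_meas {k m : ℕ} (c : Fin k → Fin m) (a : Fin m) :
    MeasurableSet (vertexBlock c a) :=
  MeasurableSet.biUnion (Set.to_countable _) fun i _ => unitCell_meas i

theorem disjoint_vertexBlock {k m : ℕ} (c : Fin k → Fin m) :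
    Pairwise (Function.onFun Disjoint (vertexBlock c)) := fun a b hab => by
  refine Set.disjoint_left.2 fun x hx hx' => hab ?_
  simp only [vertexBlock, Set.mem_iUnion, mem_unitCell] at hx hx'
  obtain ⟨i, hi, hxi⟩ := hx
  obtain ⟨j, hj, hxj⟩ := hx'
  have hij : i = j := Option.some.inj (hxi.symm.trans hxj)
  have hi' : c i = a := hi
  have hj' : c j = b := hj
  rw [← hi', ← hj', hij]

theorem volume_vertexBlock {k m : ℕ} (c : Fin k → Fin m) (a : Fin m) :
    (volume : Measure unitInterval).real (vertexBlock c a) =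
      ((Finset.univ.filter fun i => c i = a).card : ℝ) / k := by
  rw [vertexBlock_eq, Measure.real, measureReal_block _ _ measurableSet_unitIdx fun i => by
    rw [unitIdx_preimage_some, volume_unitCell], ENNReal.toReal_ofReal (by positivity)]

/-- The total integral is `1`, so a tail below `1/4` leaves at least `3/4` on `U ×ˢ U`. -/
theorem IsModel.exists_dense_set {𝒲 : Graphon.{u}} {G : FinGraph} (hd : 0 < G.deg2)
    {idx : 𝒲.S → Option (Fin G.card)} (hm : IsModel 𝒲 G.adjO idx (√G.deg2)⁻¹) {U : Set 𝒲.S}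
    (hU : MeasurableSet U) (hUtop : 𝒲.μ U ≠ ⊤)
    (hint : ∫ z, |𝒲.W z - (U ×ˢ U).indicator 𝒲.W z| ∂(𝒲.μ.prod 𝒲.μ) < 1 / 4) :
    ∃ A : Finset (Fin G.card), A.card * (√G.deg2)⁻¹ ≤ 2 * 𝒲.μ.real U ∧
      G.deg2 / 2 ≤ G.deg2On A := by
  have h1 := (integral_adjO_eq_one 𝒲.μ G hd _ hm.measurableSet_cell hm.measure_cell).2
  have hUU := hU.prod hU
  have h2 : (3 : ℝ) / 4 ≤ ∫ z in U ×ˢ U, 𝒲.W z ∂(𝒲.μ.prod 𝒲.μ) := by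
    have e1 : ∫ z, (𝒲.W z - (U ×ˢ U).indicator 𝒲.W z) ∂(𝒲.μ.prod 𝒲.μ) =
        1 - ∫ z in U ×ˢ U, 𝒲.W z ∂(𝒲.μ.prod 𝒲.μ) := by
      rw [integral_sub 𝒲.integrable (𝒲.integrable.indicator hUU), integral_indicator hUU, ← h1]
      congr 1
      exact integral_congr_ae (Eventually.of_forall hm.W_eq)
    have e2 : ∫ z, (𝒲.W z - (U ×ˢ U).indicator 𝒲.W z) ∂(𝒲.μ.prod 𝒲.μ) ≤
        ∫ z, |𝒲.W z - (U ×ˢ U).indicator 𝒲.W z| ∂(𝒲.μ.prod 𝒲.μ) :=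
      (le_abs_self _).trans abs_integral_le_integral_abs
    linarith
  rw [integral_congr_ae (Eventually.of_forall hm.W_eq)] at h2
  exact exists_dense_set_of_setIntegral 𝒲.μ G hd _ hm.measurableSet_cell hm.measure_cell hU hUtop h2

theorem exists_dense_set_of_uniformlyRegularTails (G : ℕ → FinGraph)
    (hE : ∀ n, (G n).graph.edgeSet.Nonempty) (h : UniformlyRegularTails G) :
    ∃ M : ℝ, ∀ n, ∃ A : Finset (Fin (G n).card),
      A.card * (√(G n).deg2)⁻¹ ≤ M ∧ (G n).deg2 / 2 ≤ (G n).deg2On A := by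
  obtain ⟨M, -, hM⟩ := h.2 (1 / 4) (by norm_num)
  refine ⟨2 * M, fun n => ?_⟩
  obtain ⟨U, hU, hint, hUM⟩ := hM (G n).stretchedCanonical ⟨n, rfl⟩
  have hd := (G n).deg2_pos (hE n)
  obtain ⟨A, hA, hA'⟩ := (stretchedCanonical_isModel (G n) hd).exists_dense_set hd hU
    (ne_top_of_le_ne_top ENNReal.coe_ne_top hUM) hint
  refine ⟨A, hA.trans ?_, hA'⟩
  exact mul_le_mul_of_nonneg_left (ENNReal.toReal_le_coe_of_le_coe hUM) zero_le_two

theorem FinGraph.deg2On_mono (G : FinGraph) {A B : Finset (Fin G.card)} (h : A ⊆ B) :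
    G.deg2On A ≤ G.deg2On B :=
  (Finset.sum_le_sum fun i _ => Finset.sum_le_sum_of_subset_of_nonneg h
    fun j _ _ => G.adjR_nonneg i j).trans
    (Finset.sum_le_sum_of_subset_of_nonneg h fun i _ _ =>
      Finset.sum_nonneg fun j _ => G.adjR_nonneg i j)

/-- Regular tails give a small set with half of the edges. It is enlarged to a set `B` that is an
admissible part, and the partition into `B` and its complement has a block of mass at least `1/2`
with an average above any prescribed level, against the bound `1/4`. -/
theorem not_uniformlyUpperRegular_and_uniformlyRegularTails (G : ℕ → FinGraph)
    (hE : ∀ n, (G n).graph.edgeSet.Nonempty) (hS : Sparse G) :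
    ¬ (UniformlyUpperRegular G ∧ UniformlyRegularTails G) := by
  classical
  rintro ⟨⟨K, η, hK, hη0, hη, hηk, hreg⟩, hT⟩
  obtain ⟨M, hM⟩ := exists_dense_set_of_uniformlyRegularTails G hE hT
  set L := K (1 / 4) with hL
  have hL0 : 0 < L := hK _ (by norm_num)
  -- The part `B` will have measure at most `2 * δ`; then `L * (2 * δ)^2 ≤ δ ≤ 1/4`, so mass `1/2`
  -- on its square means an average of at least `L`.
  set δ : ℝ := min (1 / 4) (1 / (4 * L)) with hδ
  have hδ0 : 0 < δ := by positivity
  have hδ4 : δ ≤ 1 / 4 := min_le_left _ _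
  have hδL : L * δ ≤ 1 / 4 := by
    refine (mul_le_mul_of_nonneg_left (min_le_right _ _) hL0.le).trans_eq ?_
    field_simp
  obtain ⟨n, h1, h2⟩ := ((eventually_card_div_le G hE hS M hδ0).and
    (hη.eventually (gt_mem_nhds hδ0))).exists
  obtain ⟨A, hAM, hA⟩ := hM n
  have hAδ := h1 A hAM
  have hd := (G n).deg2_pos (hE n)
  have hk := (G n).card_pos_of_density_pos ((G n).density_pos hd)
  have hηk' := hηk n
  rw [div_lt_iff₀ hk] at hηk'
  -- Since `η n > 1/k`, the rounding up of `η n * k` costs less than another `η n * k`; this gives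
  -- the factor `2` in the next bound.
  rw [div_le_iff₀ hk] at hAδ
  have hceil : (⌈η n * (G n).card⌉₊ : ℝ) ≤ 2 * δ * (G n).card := by
    have h3 := (Nat.ceil_lt_add_one (mul_nonneg (hη0 n).le hk.le)).le
    have h4 := mul_lt_mul_of_pos_right h2 hk
    linarith
  have hcardle : ((max A.card ⌈η n * (G n).card⌉₊ : ℕ) : ℝ) ≤ 2 * δ * (G n).card := by
    rw [Nat.cast_max]
    refine max_le ?_ hceil
    have := mul_pos hδ0 hk
    linarith
  have hmaxle : max A.card ⌈η n * (G n).card⌉₊ ≤ (Finset.univ : Finset (Fin (G n).card)).card := by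
    rw [Finset.card_univ, Fintype.card_fin]
    have h5 := mul_le_mul_of_nonneg_right hδ4 hk.le
    have : ((max A.card ⌈η n * (G n).card⌉₊ : ℕ) : ℝ) ≤ (G n).card := by linarith
    exact_mod_cast this
  -- Enlarging `A` loses no edges and makes the part as large as `η n` requires; the complement has
  -- measure at least `1 - 2 * δ ≥ 1/2`.
  obtain ⟨B, hAB, -, hB⟩ := Finset.exists_subsuperset_card_eq (Finset.subset_univ A)
    (le_max_left A.card ⌈η n * (G n).card⌉₊) hmaxle
  have hBη : η n * (G n).card ≤ B.card := by
    rw [hB, Nat.cast_max]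
    exact (Nat.le_ceil _).trans (le_max_right _ _)
  have hBδ : (B.card : ℝ) ≤ 2 * δ * (G n).card := by rw [hB]; exact hcardle
  set c : Fin (G n).card → Fin 2 := fun i => if i ∈ B then 0 else 1 with hc
  have hc0 : (Finset.univ.filter fun i => c i = 0) = B := by
    ext i; by_cases hi : i ∈ B <;> simp [hc, hi]
  have hc1 : (Finset.univ.filter fun i => c i = 1) = Bᶜ := by
    ext i; by_cases hi : i ∈ B <;> simp [hc, hi]
  have hv0 : (volume : Measure unitInterval).real (vertexBlock c 0) = B.card / (G n).card := by
    rw [volume_vertexBlock, hc0]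
  have hv1 : (volume : Measure unitInterval).real (vertexBlock c 1) = ((G n).card - B.card) / (G n).card := by
    rw [volume_vertexBlock, hc1, Finset.card_compl, Fintype.card_fin,
      Nat.cast_sub (by simpa using Finset.card_le_univ B)]
  have hparts : ∀ a, η n ≤ (volume : Measure unitInterval).real (vertexBlock c a) := by
    intro a
    fin_cases a
    · change η n ≤ (volume : Measure unitInterval).real (vertexBlock c 0)
      rw [hv0, le_div_iff₀ hk]
      exact hBη
    · change η n ≤ (volume : Measure unitInterval).real (vertexBlock c 1)
      rw [hv1, le_div_iff₀ hk]
      have h4 := mul_lt_mul_of_pos_right h2 hk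
      have h5 := mul_le_mul_of_nonneg_right hδ4 hk.le
      linarith
  have hcon := hreg (1 / 4) (by norm_num) n 2 c hparts
  have hint : ∫ w in vertexBlock c 0 ×ˢ vertexBlock c 0, (G n).rescaledCanonical.W w
      ∂((volume : Measure unitInterval).prod volume) =
      (G n).density⁻¹ * ((G n).deg2On B / ((G n).card : ℝ) ^ 2) := by
    have h6 := (setIntegral_rescaled_block (volume : Measure unitInterval) (G n) (unitIdx (G n).card)
      measurableSet_unitIdx (fun i => by rw [unitIdx_preimage_some, volume_unitCell]) B).2
    rw [← h6, vertexBlock_eq, hc0]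
    exact integral_congr_ae (Eventually.of_forall fun z => (rescaled_isModel (G n)).W_eq z)
  have hhalf := half_le_rescaled_block (G n) hd B (hA.trans ((G n).deg2On_mono hAB))
  have hpos : 0 < (volume : Measure unitInterval).real (vertexBlock c 0) :=
    (hη0 n).trans_le (hparts 0)
  have hlarge := le_largePartNorm_blockAverage (volume : Measure unitInterval)
    (G n).rescaledCanonical.W (vertexBlock c) (vertexBlock_meas c) (disjoint_vertexBlock c) 0 hpos
    (K := L) (by
      rw [hint]
      refine le_trans ?_ hhalf
      have h7 : (volume : Measure unitInterval).real (vertexBlock c 0) ≤ 2 * δ := by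
        rw [hv0, div_le_iff₀ hk]; exact hBδ
      have h8 := mul_le_mul h7 h7 hpos.le (by positivity)
      have h9 := mul_le_mul_of_nonneg_left h8 hL0.le
      nlinarith)
  rw [hint] at hlarge
  linarith [hhalf.trans (hlarge.trans hcon)]

end SparseGraphon

end

theorem mainTheorem11 :
    (∀ G : ℕ → SparseGraphon.FinGraph,
      (∀ n, (G n).graph.edgeSet.Nonempty) → SparseGraphon.Sparse G →
        ¬ (SparseGraphon.UniformlyUpperRegular G ∧ SparseGraphon.UniformlyRegularTails G) ∧
        ¬ (SparseGraphon.CauchyStretched G ∧ SparseGraphon.CauchyRescaled G) ∧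
        ¬ ((∃ 𝒲 : SparseGraphon.Graphon.{u}, SparseGraphon.TendstoStretched G 𝒲) ∧
            ∃ 𝒲 : SparseGraphon.Graphon.{v}, SparseGraphon.TendstoRescaled G 𝒲)) ∧
    (∀ G : ℕ → SparseGraphon.FinGraph,
      SparseGraphon.Dense G → SparseGraphon.HasConvergentDensity G →
        (SparseGraphon.CauchyStretched G ↔ SparseGraphon.CauchyRescaled G)) ∧
    (∃ G : ℕ → SparseGraphon.FinGraph,
      (∀ n, (G n).graph.edgeSet.Nonempty) ∧ SparseGraphon.Dense G ∧
        SparseGraphon.CauchyRescaled G ∧ ¬ SparseGraphon.CauchyStretched G) ∧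
    (∃ G : ℕ → SparseGraphon.FinGraph,
      (∀ n, (G n).graph.edgeSet.Nonempty) ∧ SparseGraphon.Dense G ∧
        SparseGraphon.CauchyStretched G ∧ ¬ SparseGraphon.CauchyRescaled G) :=
  ⟨fun G hE hS => ⟨SparseGraphon.not_uniformlyUpperRegular_and_uniformlyRegularTails G hE hS,
      SparseGraphon.not_cauchyStretched_and_cauchyRescaled G hE hS,
      SparseGraphon.not_tendstoStretched_and_tendstoRescaled G hE hS⟩,
    SparseGraphon.cauchyStretched_iff_cauchyRescaled,
    SparseGraphon.exists_cauchyRescaled_not_cauchyStretched,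
    SparseGraphon.exists_cauchyStretched_not_cauchyRescaled⟩
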